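/- **Theorem 6.2.** Let $m\ge 0$ and let $M$ be a connected, oriented, closed (compact, without boundary) smooth Riemannian manifold of dimension $2m$. Let $\phi$ be an orientation-preserving isometry of $M$ that fixes a point of $M$, and let $M^\phi=\{x\in M:\phi(x)=x\}$. Write $\mathrm{ord}(\phi)\in\{1,2,\dots\}\cup\{\infty\}$ for the order of $\phi$. A spin structure on $M$ is a principal $\mathrm{Spin}(2m)$-bundle $P\to M$ together with a two-sheeted covering $\Lambda:P\to \mathrm{SO}(M)$ of the bundle of oriented orthonormal frames, over $M$, equivariant with respect to $\mathrm{Spin}(2m)\to\mathrm{SO}(2m)$; $\phi$ lifts to a symmetry $\hat\phi$ of it if $\hat\phi:P\to P$ is a $\mathrm{Spin}(2m)$-equivariant homeomorphism with $\Lambda\circ\hat\phi=\phi_*\circ\Lambda$, where $\phi_*$ is the map of frames induced by $d\phi$; the order of $\hat\phi$ is its order as a homeomorphism of $P$. Then: 1. $M^\phi$ has only finitely many connected components, and each of them is a totally geodesic, closed (compact, without boundary), even-dimensional, embedded submanifold of $M$. 2. If $\mathrm{ord}(\phi)=2$ and $\phi$ lifts to a symmetry of order $4$ of a spin structure on $M$,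 then the codimension of each connected component of $M^\phi$ is congruent to $2$ modulo $4$; if moreover $m$ is even, then no point of $M^\phi$ is isolated in $M^\phi$. 3. If $\mathrm{ord}(\phi)=2$ and $\phi$ lifts to a symmetry of order $2$ of a spin structure on $M$, then the codimension of each connected component of $M^\phi$ is congruent to $0$ modulo $4$; if moreover $m$ is odd, then no point of $M^\phi$ is isolated in $M^\phi$. 4. If $\mathrm{ord}(\phi)$ is finite and even, $\phi$ lifts to a symmetry of the same order of a spin structure on $M$, and $m=2$, then every point of $M^\phi$ is isolated in $M^\phi$. 5. If $\mathrm{ord}(\phi)>2$ (possibly infinite), then each connected component of $M^\phi$ of codimension two is orientable. -/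

import Mathlib

open Set Filter Topology Manifold Bundle
open scoped ContDiff MulOpposite

universe u v

namespace FixedSet

/-! ### Riemannian geodesics -/

section Geodesic

variable {n : ℕ} {M : Type*} [TopologicalSpace M] [ChartedSpace (EuclideanSpace ℝ (Fin n)) M]
  [IsManifold (𝓡 n) ∞ M] [RiemannianBundle (fun x : M => TangentSpace (𝓡 n) x)]

/-- The Riemannian metric in the preferred chart around `x₀`: the inner product, at the point with
coordinates `y`, of the tangent vectors with coordinates `u` and `v`. -/
noncomputable def chartMetric (x₀ : M) (y u v : EuclideanSpace ℝ (Fin n)) : ℝ :=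
  inner ℝ
    (mfderiv 𝓘(ℝ, EuclideanSpace ℝ (Fin n)) (𝓡 n) (extChartAt (𝓡 n) x₀).symm y u :
      TangentSpace (𝓡 n) ((extChartAt (𝓡 n) x₀).symm y))
    (mfderiv 𝓘(ℝ, EuclideanSpace ℝ (Fin n)) (𝓡 n) (extChartAt (𝓡 n) x₀).symm y v)

/-- The Christoffel symbol of the first kind,
`Γ(u, v; w) = ½ (∂_u g(v, w) + ∂_v g(u, w) - ∂_w g(u, v))`,
in the preferred chart around `x₀`, at the point with coordinates `y`. -/
noncomputable def christoffel (x₀ : M) (y u v w : EuclideanSpace ℝ (Fin n)) : ℝ :=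
  (1 / 2 : ℝ) * (fderiv ℝ (fun z => chartMetric x₀ z v w) y u
    + fderiv ℝ (fun z => chartMetric x₀ z u w) y v
    - fderiv ℝ (fun z => chartMetric x₀ z u v) y w)

/-- `γ` is a geodesic on the open set `J` of times: it is smooth there and satisfies the geodesic
equation `c'' + Γ(c', c') = 0` (with the index lowered by the metric, that is, paired with an
arbitrary vector `w`). At time `t` the equation is read in the preferred chart around `γ t`. -/
def IsGeodesicOn (γ : ℝ → M) (J : Set ℝ) : Prop :=
  ContMDiffOn 𝓘(ℝ, ℝ) (𝓡 n) ∞ γ J ∧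
  ∀ t ∈ J, ∀ w : EuclideanSpace ℝ (Fin n),
    chartMetric (γ t) (extChartAt (𝓡 n) (γ t) (γ t))
        (deriv (deriv fun s => extChartAt (𝓡 n) (γ t) (γ s)) t) w
      + christoffel (γ t) (extChartAt (𝓡 n) (γ t) (γ t))
        (deriv (fun s => extChartAt (𝓡 n) (γ t) (γ s)) t)
        (deriv (fun s => extChartAt (𝓡 n) (γ t) (γ s)) t) w = 0

end Geodesic

/-! ### Orientations -/

/-- An orientation of a smooth manifold: an orientation of every tangent space which is locally
constant when it is read in the local trivializations of the tangent bundle. -/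
structure ManifoldOrientation (d : ℕ) (N : Type*) [TopologicalSpace N]
    [ChartedSpace (EuclideanSpace ℝ (Fin d)) N] [IsManifold (𝓡 d) ∞ N] where
  /-- The orientation of the tangent space at a point. -/
  orient : ∀ x : N, Orientation ℝ (TangentSpace (𝓡 d) x) (Fin d)
  isLocallyConstant : ∀ x₀ : N, IsLocallyConstant
    fun x : (trivializationAt (EuclideanSpace ℝ (Fin d)) (TangentSpace (𝓡 d) : N → Type _)
        x₀).baseSet =>
      Orientation.map (Fin d)
        ((trivializationAt (EuclideanSpace ℝ (Fin d)) (TangentSpace (𝓡 d) : N → Type _)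
          x₀).linearEquivAt ℝ (x : N) x.2) (orient x)

/-! ### Embedded submanifolds -/

section Submanifold

variable {n : ℕ} {M : Type*} [TopologicalSpace M] [ChartedSpace (EuclideanSpace ℝ (Fin n)) M]

/-- The structure of a `d`-dimensional embedded submanifold (without boundary) on a subset `C` of a
manifold: a smooth atlas on the subspace `C` for which the inclusion is a smooth embedding. -/
structure EmbeddedSubmanifold (d : ℕ) (C : Set M) where
  chartedSpace : ChartedSpace (EuclideanSpace ℝ (Fin d)) C
  isManifold : IsManifold (𝓡 d) ∞ C
  isSmoothEmbedding : IsSmoothEmbedding (𝓡 d) (𝓡 n) ∞ (Subtype.val : C → M)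

namespace EmbeddedSubmanifold

variable {d : ℕ} {C : Set M}

/-- The tangent space of the submanifold at `x`, as a subspace of that of the ambient manifold. -/
noncomputable def tangentSubspace (S : EmbeddedSubmanifold (n := n) d C) (x : C) :
    Submodule ℝ (TangentSpace (𝓡 n) (x : M)) :=
  letI := S.chartedSpace
  LinearMap.range (mfderiv (𝓡 d) (𝓡 n) (Subtype.val : C → M) x).toLinearMap

/-- The submanifold is orientable. -/
def Orientable (S : EmbeddedSubmanifold (n := n) d C) : Prop :=
  letI := S.chartedSpace
  letI := S.isManifold
  Nonempty (ManifoldOrientation d C)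

/-- The submanifold is totally geodesic: every geodesic of the ambient manifold which starts at a
point of the submanifold, in a direction tangent to it, stays in it for a short time. -/
def TotallyGeodesic [IsManifold (𝓡 n) ∞ M] [RiemannianBundle (fun x : M => TangentSpace (𝓡 n) x)]
    (S : EmbeddedSubmanifold (n := n) d C) : Prop :=
  ∀ (γ : ℝ → M) (ε : ℝ), 0 < ε → IsGeodesicOn (n := n) γ (Ioo (-ε) ε) →
    ∀ h : γ 0 ∈ C,
      mfderiv 𝓘(ℝ, ℝ) (𝓡 n) γ 0 (1 : ℝ) ∈ S.tangentSubspace ⟨γ 0, h⟩ →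
      ∃ δ > 0, ∀ t : ℝ, |t| < δ → γ t ∈ C

end EmbeddedSubmanifold

/-- The connected components of a subset, as subsets of the ambient space. -/
def components (F : Set M) : Set (Set M) :=
  {C | ∃ x ∈ F, C = connectedComponentIn F x}

end Submanifold

/-! ### The spin group and its vector representation -/

section Spin

/-- The quadratic form `v ↦ ⟪v, v⟫` on Euclidean space. -/
noncomputable def euclideanForm (n : ℕ) : QuadraticForm ℝ (EuclideanSpace ℝ (Fin n)) :=
  LinearMap.BilinMap.toQuadraticMap (innerₗ (EuclideanSpace ℝ (Fin n)))

/-- The group `Spin(n)`. -/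
abbrev Spin (n : ℕ) : Type := spinGroup (euclideanForm n)

/-- `Spin(n)` carries the subspace topology from the Clifford algebra, a finite-dimensional real
vector space with its canonical topology. -/
noncomputable instance instTopologicalSpaceSpin (n : ℕ) : TopologicalSpace (Spin n) :=
  TopologicalSpace.induced Subtype.val (moduleTopology ℝ (CliffordAlgebra (euclideanForm n)))

theorem exists_spinRep {n : ℕ} (g : Spin n) (v : EuclideanSpace ℝ (Fin n)) :
    ∃ w, CliffordAlgebra.ι (euclideanForm n) w
      = (g : CliffordAlgebra (euclideanForm n)) * CliffordAlgebra.ι (euclideanForm n) v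
        * ((g⁻¹ : Spin n) : CliffordAlgebra (euclideanForm n)) := by
  have h := spinGroup.conjAct_smul_ι_mem_range_ι (x := spinGroup.toUnits g) g.2 v
  rw [ConjAct.units_smul_def] at h
  exact h

/-- The double covering `Spin(n) → SO(n)`, as the action on vectors: `g` sends `v` to the vector
`g v g⁻¹` of the Clifford algebra. -/
noncomputable def spinRep {n : ℕ} (g : Spin n) (v : EuclideanSpace ℝ (Fin n)) :
    EuclideanSpace ℝ (Fin n) :=
  Classical.choose (exists_spinRep g v)

end Spin

/-! ### Oriented orthonormal frames, spin structures and their symmetries -/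

section SpinStructure

variable {n : ℕ} {M : Type*} [TopologicalSpace M] [ChartedSpace (EuclideanSpace ℝ (Fin n)) M]
  [IsManifold (𝓡 n) ∞ M] [RiemannianBundle (fun x : M => TangentSpace (𝓡 n) x)]

/-- The total space of the bundle of positively oriented orthonormal frames. -/
structure Frame (o : ManifoldOrientation n M) where
  pt : M
  basis : OrthonormalBasis (Fin n) ℝ (TangentSpace (𝓡 n) pt)
  oriented : basis.toBasis.orientation = o.orient pt

namespace Frame

variable {o : ManifoldOrientation n M}

/-- The tangent vector whose coordinates in the frame are `w`. -/
noncomputable def vec (u : Frame o) (w : EuclideanSpace ℝ (Fin n)) : TangentBundle (𝓡 n) M :=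
  ⟨u.pt, u.basis.repr.symm w⟩

/-- The frame bundle as a subspace of `M × TM × ⋯ × TM`. -/
noncomputable instance instTopologicalSpaceFrame : TopologicalSpace (Frame o) :=
  TopologicalSpace.induced
    (fun u => (u.pt, fun i => (⟨u.pt, u.basis i⟩ : TangentBundle (𝓡 n) M))) inferInstance

end Frame

/-- An orientation-preserving Riemannian isometry of `M` onto itself: a diffeomorphism which
preserves the Riemannian metric and the orientation. -/
structure OrientedIsometry (o : ManifoldOrientation n M) where
  toDiffeo : M ≃ₘ⟮𝓡 n, 𝓡 n⟯ M
  inner_map : ∀ (x : M) (v w : TangentSpace (𝓡 n) x),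
    inner ℝ (mfderiv (𝓡 n) (𝓡 n) toDiffeo x v : TangentSpace (𝓡 n) (toDiffeo x))
      (mfderiv (𝓡 n) (𝓡 n) toDiffeo x w) = inner ℝ v w
  orient_map : ∀ x : M, Orientation.map (Fin n)
    (toDiffeo.mfderivToContinuousLinearEquiv (by simp) x).toLinearEquiv (o.orient x)
      = o.orient (toDiffeo x)

namespace OrientedIsometry

variable {o : ManifoldOrientation n M}

/-- The underlying homeomorphism, an element of the group of homeomorphisms of `M`. -/
noncomputable def toHomeo (φ : OrientedIsometry o) : M ≃ₜ M := φ.toDiffeo.toHomeomorph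

/-- The fixed set. -/
def fixedSet (φ : OrientedIsometry o) : Set M := {x | φ.toHomeo x = x}

/-- The differential at a point, as a linear isometry. -/
noncomputable def differential (φ : OrientedIsometry o) (x : M) :
    TangentSpace (𝓡 n) x ≃ₗᵢ[ℝ] TangentSpace (𝓡 n) (φ.toDiffeo x) :=
  (φ.toDiffeo.mfderivToContinuousLinearEquiv (by simp) x).toLinearEquiv.isometryOfInner
    (φ.inner_map x)

/-- The induced map of the oriented orthonormal frame bundle. -/
noncomputable def frameMap (φ : OrientedIsometry o) (u : Frame o) : Frame o where
  pt := φ.toDiffeo u.pt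
  basis := u.basis.map (φ.differential u.pt)
  oriented := by
    have h := u.basis.toBasis.orientation_map (φ.differential u.pt).toLinearEquiv
    rw [u.oriented] at h
    exact h.trans (φ.orient_map u.pt)

end OrientedIsometry

/-- A continuous right action of a topological group `G` on `P`, together with `proj : P → B`, is a
principal `G`-bundle: locally on `B` it is equivariantly homeomorphic to `U × G`. -/
structure IsPrincipalBundle (G : Type*) [Group G] [TopologicalSpace G] {P B : Type*}
    [TopologicalSpace P] [TopologicalSpace B] [MulAction Gᵐᵒᵖ P] (proj : P → B) : Prop where
  continuous_proj : Continuous proj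
  continuous_act : Continuous fun q : P × G => MulOpposite.op q.2 • q.1
  proj_smul : ∀ (p : P) (g : G), proj (MulOpposite.op g • p) = proj p
  locally_trivial : ∀ b : B, ∃ U : Set B, IsOpen U ∧ b ∈ U ∧ ∃ e : (proj ⁻¹' U) ≃ₜ U × G,
    (∀ p, ((e p).1 : B) = proj p) ∧
    ∀ (p q : proj ⁻¹' U) (g : G), (q : P) = MulOpposite.op g • (p : P) → (e q).2 = (e p).2 * g

/-- A spin structure on an oriented Riemannian manifold: a principal `Spin(n)`-bundle `P` over `M`
together with a two-sheeted covering map from `P` to the oriented orthonormal frame bundle, over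
`M` and equivariant with respect to `Spin(n) → SO(n)`. -/
structure SpinStructure {n : ℕ} {M : Type u} [TopologicalSpace M]
    [ChartedSpace (EuclideanSpace ℝ (Fin n)) M] [IsManifold (𝓡 n) ∞ M]
    [RiemannianBundle (fun x : M => TangentSpace (𝓡 n) x)] (o : ManifoldOrientation n M) where
  P : Type v
  [topP : TopologicalSpace P]
  [actP : MulAction (Spin n)ᵐᵒᵖ P]
  toFrame : P → Frame o
  isPrincipalBundle : IsPrincipalBundle (Spin n) fun p => (toFrame p).pt
  isCoveringMap : IsCoveringMap toFrame
  two_sheeted : ∀ u : Frame o, (toFrame ⁻¹' {u}).ncard = 2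
  equivariant : ∀ (p : P) (g : Spin n) (v : EuclideanSpace ℝ (Fin n)),
    (toFrame (MulOpposite.op g • p)).vec v = (toFrame p).vec (spinRep g v)

attribute [instance] SpinStructure.topP SpinStructure.actP

/-- The homeomorphism `Φ` is a symmetry of the spin structure which lifts the isometry `φ`: it
commutes with the action of `Spin(n)` and covers the map of frames induced by `φ`. -/
structure SpinStructure.IsLift {o : ManifoldOrientation n M} (s : SpinStructure o)
    (φ : OrientedIsometry o) (Φ : s.P ≃ₜ s.P) : Prop where
  map_smul : ∀ (p : s.P) (g : Spin n),
    Φ (MulOpposite.op g • p) = MulOpposite.op g • Φ p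
  covers : ∀ p : s.P, s.toFrame (Φ p) = φ.frameMap (s.toFrame p)

/-- `φ` lifts to a symmetry of order `k` of some spin structure on `M`. -/
def OrientedIsometry.LiftsWithOrder {n : ℕ} {M : Type u} [TopologicalSpace M]
    [ChartedSpace (EuclideanSpace ℝ (Fin n)) M] [IsManifold (𝓡 n) ∞ M]
    [RiemannianBundle (fun x : M => TangentSpace (𝓡 n) x)] {o : ManifoldOrientation n M} (φ : OrientedIsometry o)
    (k : ℕ) : Prop :=
  ∃ (s : SpinStructure.{u, v} o) (Φ : s.P ≃ₜ s.P), s.IsLift φ Φ ∧ orderOf Φ = k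

end SpinStructure

end FixedSet

open FixedSet

/-! The local picture rests on the exponential map at a fixed point `p`: an isometry carries
geodesics to geodesics, so it acts near `p` as its differential acts near `0`. In a chart the
geodesic spray is a vector field for which `(p, 0)` is an equilibrium with square-zero
linearization, so its flow for a short time `T` is differentiable there, with derivative `T` times
the identity from velocity to position. Isometries preserve the spray, so uniqueness of integral
curves shows that the geodesics leaving `p` in fixed directions consist of fixed points
(`IsMetricOn.exists_fixed_family`). With the inverse function theorem this yields charts in which
the fixed set is a linear subspace, tangent to the fixed vectors of the differential
(`IsMetricOn.exists_slice`, `IsRiemannianMap.exists_isSliceChart`).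

Components are therefore relatively open in the compact fixed set, so finitely many, and they are
embedded and totally geodesic. Rigidity follows too: an isometry of a connected manifold with a
fixed point where its differential is the identity is the identity (`IsRiemannianMap.eq_id`).
Codimensions are even because the differential preserves orientation: a linear isometry is a product
of as many reflections as the codimension of its fixed space, and positive determinant makes that
number even.

For the spin statements, a lift acts on a point over a fixed point `x` as right translation by some
`g` in the spin group whose vector representation is the differential at `x`, read in a frame. If
the `k`-th power of the differential is an involution with `-1`-eigenspace of dimension `2 * j`,
then `g ^ k` is, up to sign, the product of an orthonormal basis of that eigenspace, and so `g ^ (2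
* k) = (-1) ^ j` (`IsLift.pow_two_mul_eq`). A symmetry covering the identity is determined by its
value at one point, since it acts on a covering of the frame bundle over a connected base. Hence for
an involution, order two makes `j` even and order four makes it odd. In dimension four with a lift
of the same order `2 * k`, a nonisolated fixed point would make `j = 1` for the `k`-th power, which
is not even.

For orientability in codimension two, let `A` be the differential. If `A` is not an involution, a
vector `v` outside the fixed space and its image `A v` span a complement of that space, so
contracting the ambient volume form with `v` and `A v` orients it. The choice of `v` is immaterial
because the complement of a subspace of codimension two is connected. Rigidity excludes `A ^ 2 = 1`
when the order exceeds two. -/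

namespace FixedSet

/-! ### The flow of a vector field near an equilibrium -/

section Flow

variable {Z : Type*} [NormedAddCommGroup Z] [NormedSpace ℝ Z]

/-- A local flow of `S` around the equilibrium `z₀`, on the time interval `[0, T]`. -/
structure LocalFlow (S : Z → Z) (z₀ : Z) (T r L : ℝ) (α : Z → ℝ → Z) : Prop where
  T_pos : 0 < T
  r_pos : 0 < r
  L_pos : 0 < L
  initial : ∀ x ∈ Metric.closedBall z₀ r, α x 0 = x
  deriv : ∀ x ∈ Metric.closedBall z₀ r, ∀ t ∈ Icc 0 T,
    HasDerivWithinAt (α x) (S (α x t)) (Icc 0 T) t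
  lipschitz : ∀ x ∈ Metric.closedBall z₀ r, ∀ y ∈ Metric.closedBall z₀ r, ∀ t ∈ Icc 0 T,
    ‖α x t - α y t‖ ≤ L * ‖x - y‖
  equilibrium : ∀ t ∈ Icc 0 T, α z₀ t = z₀

/-- Picard–Lindelöf gives a flow that is Lipschitz in the initial value. That `z₀` stays put needs
uniqueness, hence a region where `S` is Lipschitz, so the time is shortened until the curve from
`z₀` remains in one. -/
theorem exists_localFlow [CompleteSpace Z] {S : Z → Z} {z₀ : Z} (hS : ContDiffAt ℝ 1 S z₀) (h0 : S z₀ = 0) :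
    ∃ T r L α, LocalFlow S z₀ T r L α := by
  obtain ⟨ε, hε, a, r, L, K, hr, hPL⟩ := IsPicardLindelof.of_contDiffAt_one hS
  obtain ⟨α, hα, L', hL'⟩ :=
    (hPL 0).exists_forall_mem_closedBall_eq_hasDerivWithinAt_lipschitzOnWith
  obtain ⟨K', s, hs, hlip⟩ := hS.exists_lipschitzOnWith
  have hz : z₀ ∈ Metric.closedBall z₀ (r : ℝ) := Metric.mem_closedBall_self hr.le
  have hsub : Icc (0 : ℝ) ε ⊆ Icc (0 - ε) (0 + ε) := Icc_subset_Icc (by linarith) (by linarith)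
  have hd : ∀ x ∈ Metric.closedBall z₀ (r : ℝ), ∀ t ∈ Icc 0 ε,
      HasDerivWithinAt (α x) (S (α x t)) (Icc 0 ε) t := fun x hx t ht =>
    ((hα x hx).2 t (hsub ht)).mono hsub
  have hc : ContinuousWithinAt (α z₀) (Icc 0 ε) 0 := (hd z₀ hz 0 ⟨le_rfl, hε.le⟩).continuousWithinAt
  have hα0 : α z₀ 0 = z₀ := (hα z₀ hz).1
  have hmem : ∀ᶠ t in 𝓝[Icc 0 ε] (0 : ℝ), α z₀ t ∈ s := hc (by rw [hα0]; exact hs)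
  obtain ⟨δ, hδ, hδs⟩ := Metric.mem_nhdsWithin_iff.1 hmem
  have hT : 0 < min ε (δ / 2) := lt_min hε (half_pos hδ)
  have hTsub : Icc 0 (min ε (δ / 2)) ⊆ Icc 0 ε := Icc_subset_Icc le_rfl (min_le_left _ _)
  have hin : ∀ t ∈ Icc 0 (min ε (δ / 2)), α z₀ t ∈ s := by
    intro t ht
    refine hδs ⟨?_, hTsub ht⟩
    rw [Metric.mem_ball, dist_zero_right, Real.norm_of_nonneg ht.1]
    linarith [ht.2, min_le_right ε (δ / 2)]
  have heq : EqOn (α z₀) (fun _ => z₀) (Icc 0 (min ε (δ / 2))) := by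
    refine ODE_solution_unique_of_mem_Icc_right (v := fun _ => S) (s := fun _ => s) (K := K')
      (fun _ _ => hlip) ?_ ?_ (fun t ht => hin t ⟨ht.1, ht.2.le⟩) continuousOn_const ?_
      (fun _ _ => mem_of_mem_nhds hs) hα0
    · exact fun t ht => ((hd z₀ hz t (hTsub ht)).mono hTsub).continuousWithinAt
    · intro t ht
      exact ((hd z₀ hz t (hTsub ⟨ht.1, ht.2.le⟩)).mono hTsub).mono_of_mem_nhdsWithin
        (mem_of_superset (Icc_mem_nhdsGE ht.2) (Icc_subset_Icc_left ht.1))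
    · intro t _
      rw [h0]
      exact hasDerivWithinAt_const _ _ _
  refine ⟨min ε (δ / 2), r, L' + 1, α, hT, hr, by positivity, fun x hx => (hα x hx).1, ?_, ?_, heq⟩
  · exact fun x hx t ht => (hd x hx t (hTsub ht)).mono hTsub
  · intro x hx y hy t ht
    have := (hL' t (hsub (hTsub ht))).dist_le_mul x hx y hy
    rw [dist_eq_norm, dist_eq_norm] at this
    exact this.trans (by gcongr; linarith)

variable {S : Z → Z} {z₀ : Z} {T r L : ℝ} {α : Z → ℝ → Z}

/-- Since `z₀` does not move, a trajectory stays within `L` times its initial distance from `z₀`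
throughout the time interval. -/
theorem LocalFlow.eventually_mem (h : LocalFlow S z₀ T r L α) {s : Set Z} (hs : s ∈ 𝓝 z₀) :
    ∀ᶠ x in 𝓝 z₀, x ∈ Metric.closedBall z₀ r ∧ ∀ t ∈ Icc 0 T, α x t ∈ s := by
  obtain ⟨δ, hδ, hδs⟩ := Metric.mem_nhds_iff.1 hs
  have hz : z₀ ∈ Metric.closedBall z₀ r := Metric.mem_closedBall_self h.r_pos.le
  filter_upwards [Metric.closedBall_mem_nhds z₀ h.r_pos,
    Metric.ball_mem_nhds z₀ (div_pos hδ h.L_pos)] with x hx hx'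
  refine ⟨hx, fun t ht => hδs ?_⟩
  have := h.lipschitz x hx z₀ hz t ht
  rw [h.equilibrium t ht] at this
  rw [Metric.mem_ball, dist_eq_norm] at hx' ⊢
  have h2 := mul_lt_mul_of_pos_left hx' h.L_pos
  rw [mul_div_cancel₀ _ h.L_pos.ne'] at h2
  exact this.trans_lt h2

/-- The differential of the time-`T` flow at an equilibrium at which the linearization is
nilpotent of order two. -/
theorem LocalFlow.hasStrictFDerivAt (h : LocalFlow S z₀ T r L α) {N : Z →L[ℝ] Z}
    (hS : HasStrictFDerivAt S N z₀) (hN : N ∘L N = 0) :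
    HasStrictFDerivAt (fun x => α x T) (ContinuousLinearMap.id ℝ Z + T • N) z₀ := by
  have hNN : ∀ x, N (N x) = 0 := fun x => congrArg (fun A : Z →L[ℝ] Z => A x) hN
  have hT := h.T_pos
  have hL := h.L_pos
  rw [hasStrictFDerivAt_iff_isLittleO, Asymptotics.isLittleO_iff]
  intro c hc
  -- The final estimate multiplies the relative error `c / B` of `S` by these factors: `L` from the
  -- Lipschitz bound, `T` from integration, and `1 + T * ‖N‖` twice, for applying `1 - t • N` and
  -- for undoing it.
  set B : ℝ := (1 + T * ‖N‖) * (T * ((1 + T * ‖N‖) * L)) with hB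
  have hBpos : 0 < B := by positivity
  have hε : 0 < c / B := div_pos hc hBpos
  have hS' := hS.isLittleO.bound hε
  rw [nhds_prod_eq] at hS'
  obtain ⟨s, hs, hsS⟩ := Filter.eventually_prod_self_iff'.1 hS'
  have hev := h.eventually_mem hs
  rw [nhds_prod_eq]
  filter_upwards [hev.prod_mk hev] with ⟨x, y⟩ ⟨⟨hx, hxs⟩, hy, hys⟩
  dsimp only at hx hxs hy hys ⊢
  set e : ℝ → Z := fun t => α x t - α y t with he
  set R : ℝ → Z := fun t => S (α x t) - S (α y t) - N (e t) with hR
  have he' : ∀ t ∈ Icc 0 T, HasDerivWithinAt e (N (e t) + R t) (Icc 0 T) t := by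
    intro t ht
    refine ((h.deriv x hx t ht).sub (h.deriv y hy t ht)).congr_deriv ?_
    simp [hR]
  -- Variation of constants: as `N ∘L N = 0`, `1 - t • N` is the exponential of `-t • N`, and
  -- multiplying by it removes the linear term from the equation for `e`.
  have hh' : ∀ t ∈ Icc 0 T, HasDerivWithinAt (fun t => e t - t • N (e t)) (R t - t • N (R t))
      (Icc 0 T) t := by
    intro t ht
    have h1 := he' t ht
    have h2 := N.hasFDerivAt.comp_hasDerivWithinAt t h1
    refine (h1.sub ((hasDerivWithinAt_id t _).smul h2)).congr_deriv ?_
    simp only [Function.comp, id, map_add, hNN, zero_add, one_smul]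
    abel
  have hRb : ∀ t ∈ Icc 0 T, ‖R t‖ ≤ c / B * (L * ‖x - y‖) := by
    intro t ht
    refine (hsS _ (hxs t ht) _ (hys t ht)).trans ?_
    gcongr
    exact h.lipschitz x hx y hy t ht
  have hbound : ∀ t ∈ Ico 0 T, ‖R t - t • N (R t)‖ ≤
      (1 + T * ‖N‖) * (c / B * (L * ‖x - y‖)) := by
    intro t ht
    have hRt := hRb t ⟨ht.1, ht.2.le⟩
    calc ‖R t - t • N (R t)‖ ≤ ‖R t‖ + ‖t • N (R t)‖ := norm_sub_le _ _
      _ ≤ ‖R t‖ + T * (‖N‖ * ‖R t‖) := by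
        rw [norm_smul, Real.norm_of_nonneg ht.1]
        gcongr
        · exact ht.2.le
        · exact N.le_opNorm _
      _ = (1 + T * ‖N‖) * ‖R t‖ := by ring
      _ ≤ _ := by gcongr
  have hfin := norm_image_sub_le_of_norm_deriv_le_segment' hh' hbound T ⟨hT.le, le_rfl⟩
  have he0 : e 0 = x - y := by rw [he]; simp only [h.initial x hx, h.initial y hy]
  simp only [he0, zero_smul, sub_zero] at hfin
  set w := e T - T • N (e T) - (x - y) with hw
  -- `1 + T • N` inverts `1 - T • N`, again because `N ∘L N = 0`.
  have key : α x T - α y T - (ContinuousLinearMap.id ℝ Z + T • N) (x - y) = w + T • N w := by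
    simp only [hw, map_sub, map_smul, hNN, smul_zero, sub_zero, he, add_apply,
      ContinuousLinearMap.id_apply, smul_apply, smul_sub]
    abel
  rw [key]
  calc ‖w + T • N w‖ ≤ ‖w‖ + T * (‖N‖ * ‖w‖) := by
        refine (norm_add_le _ _).trans ?_
        rw [norm_smul, Real.norm_of_nonneg hT.le]
        gcongr
        exact N.le_opNorm _
    _ = (1 + T * ‖N‖) * ‖w‖ := by ring
    _ ≤ (1 + T * ‖N‖) * ((1 + T * ‖N‖) * (c / B * (L * ‖x - y‖)) * T) := by gcongr
    _ = c / B * B * ‖x - y‖ := by rw [hB]; ring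
    _ = c * ‖x - y‖ := by rw [div_mul_cancel₀ _ hBpos.ne']

end Flow

/-! ### Metrics on open subsets of a vector space -/

section LocalMetric

variable {E : Type*} [NormedAddCommGroup E] [NormedSpace ℝ E]

/-- Shortcut instance: the dual space. -/
noncomputable instance instNormedAddCommGroupDual : NormedAddCommGroup (E →L[ℝ] ℝ) :=
  ContinuousLinearMap.toNormedAddCommGroup

/-- Shortcut instance: the dual space. -/
noncomputable instance instNormedSpaceDual : NormedSpace ℝ (E →L[ℝ] ℝ) :=
  ContinuousLinearMap.toNormedSpace

/-- Shortcut instance: bilinear forms. -/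
noncomputable instance instNormedAddCommGroupBilin : NormedAddCommGroup (E →L[ℝ] E →L[ℝ] ℝ) :=
  ContinuousLinearMap.toNormedAddCommGroup

/-- Shortcut instance: bilinear forms. -/
noncomputable instance instNormedSpaceBilin : NormedSpace ℝ (E →L[ℝ] E →L[ℝ] ℝ) :=
  ContinuousLinearMap.toNormedSpace

/-- Shortcut instance: trilinear forms. -/
noncomputable instance instNormedAddCommGroupTrilin :
    NormedAddCommGroup (E →L[ℝ] E →L[ℝ] E →L[ℝ] ℝ) :=
  ContinuousLinearMap.toNormedAddCommGroup

/-- Shortcut instance: trilinear forms. -/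
noncomputable instance instNormedSpaceTrilin : NormedSpace ℝ (E →L[ℝ] E →L[ℝ] E →L[ℝ] ℝ) :=
  ContinuousLinearMap.toNormedSpace

/-- The Christoffel symbol of the first kind of the metric `G` on a vector space. -/
noncomputable def christoffelForm (G : E → E →L[ℝ] E →L[ℝ] ℝ) (y u : E) : E →L[ℝ] E →L[ℝ] ℝ :=
  (1 / 2 : ℝ) • (fderiv ℝ G y u + (fderiv ℝ G y).flip u - ((fderiv ℝ G y).flip u).flip)

theorem christoffelForm_apply (G : E → E →L[ℝ] E →L[ℝ] ℝ) (y u v w : E) :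
    christoffelForm G y u v w =
      (1 / 2 : ℝ) * (fderiv ℝ G y u v w + fderiv ℝ G y v u w - fderiv ℝ G y w u v) := by
  simp [christoffelForm]

/-- The tangent map of a self-map of a vector space. -/
noncomputable def vectorTangentMap (F : E → E) (z : E × E) : E × E := (F z.1, fderiv ℝ F z.1 z.2)

/-- `F` pulls the metric `G'` back to `G` near `y`. -/
def IsMetricMapAt (G G' : E → E →L[ℝ] E →L[ℝ] ℝ) (F : E → E) (y : E) : Prop :=
  ∀ᶠ z in 𝓝 y, ∀ u v, G' (F z) (fderiv ℝ F z u) (fderiv ℝ F z v) = G z u v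

/-- Differentiating the isometry relation at `y` gives one term in the derivative of `G'` and two in
the second derivative of `F`. In the Koszul combination the symmetry of the second derivative
cancels all of the latter but one. -/
theorem christoffelForm_eq_of_isMetricMapAt {G G' : E → E →L[ℝ] E →L[ℝ] ℝ} {F : E → E} {y : E}
    (hG : DifferentiableAt ℝ G y) (hG' : DifferentiableAt ℝ G' (F y)) (hF : ContDiffAt ℝ 2 F y)
    (hsymm : ∀ u v, G' (F y) u v = G' (F y) v u) (hiso : IsMetricMapAt G G' F y) (u v w : E) :
    christoffelForm G y u v w =
      G' (F y) (fderiv ℝ (fderiv ℝ F) y u v) (fderiv ℝ F y w) +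
        christoffelForm G' (F y) (fderiv ℝ F y u) (fderiv ℝ F y v) (fderiv ℝ F y w) := by
  have hF1 : HasFDerivAt F (fderiv ℝ F y) y := (hF.differentiableAt (by norm_num)).hasFDerivAt
  have hF2 : HasFDerivAt (fderiv ℝ F) (fderiv ℝ (fderiv ℝ F) y) y :=
    ((hF.fderiv_right (m := 1) (by norm_num)).differentiableAt (by norm_num)).hasFDerivAt
  have hD : ∀ a b, fderiv ℝ (fderiv ℝ F) y a b = fderiv ℝ (fderiv ℝ F) y b a :=
    (hF.isSymmSndFDerivAt (by simp)).eq
  have key : ∀ a b c, fderiv ℝ G y c a b =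
      fderiv ℝ G' (F y) (fderiv ℝ F y c) (fderiv ℝ F y a) (fderiv ℝ F y b)
      + G' (F y) (fderiv ℝ (fderiv ℝ F) y c a) (fderiv ℝ F y b)
      + G' (F y) (fderiv ℝ F y a) (fderiv ℝ (fderiv ℝ F) y c b) := by
    intro a b c
    have h1 := (((hG'.hasFDerivAt.comp y hF1).clm_apply (hF2.clm_apply (hasFDerivAt_const a y))
      ).clm_apply (hF2.clm_apply (hasFDerivAt_const b y)))
    have h2 := (hG.hasFDerivAt.clm_apply (hasFDerivAt_const a y)).clm_apply (hasFDerivAt_const b y)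
    have h3 := (h1.congr_of_eventuallyEq (f₁ := fun z => G z a b)
      (by filter_upwards [hiso] with z hz; exact (hz a b).symm)).unique h2
    have h4 := congrArg (fun A : E →L[ℝ] ℝ => A c) h3
    simp only [Function.comp_apply, ContinuousLinearMap.comp_zero, zero_add, add_apply,
      ContinuousLinearMap.comp_apply, ContinuousLinearMap.flip_apply] at h4
    rw [← h4]
    ring
  rw [christoffelForm_apply, christoffelForm_apply, key v w u, key u w v, key u v w, hD w u, hD w v,
    hD v u, hsymm (fderiv ℝ F y v) (fderiv ℝ (fderiv ℝ F) y u w),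
    hsymm (fderiv ℝ F y u) (fderiv ℝ (fderiv ℝ F) y v w)]
  ring

theorem exists_equiv_of_posDef [FiniteDimensional ℝ E] {g : E →L[ℝ] E →L[ℝ] ℝ} (hg : ∀ u, u ≠ 0 → 0 < g u u) :
    ∃ e : E ≃L[ℝ] (E →L[ℝ] ℝ), (e : E →L[ℝ] (E →L[ℝ] ℝ)) = g := by
  have hinj : Function.Injective g.toLinearMap := by
    rw [injective_iff_map_eq_zero]
    intro u hu
    by_contra hne
    have := hg u hne
    have hu' : g u = 0 := hu
    simp [hu'] at this
  have hdim : Module.finrank ℝ E = Module.finrank ℝ (E →L[ℝ] ℝ) := by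
    rw [← (LinearMap.toContinuousLinearMap (𝕜 := ℝ) (E := E) (F' := ℝ)).finrank_eq]
    exact (Subspace.dual_finrank_eq).symm
  refine ⟨(LinearEquiv.ofInjectiveOfFinrankEq g.toLinearMap hinj hdim).toContinuousLinearEquiv, ?_⟩
  ext u
  rfl

/-- The geodesic spray of the metric `G`, a vector field on the tangent bundle. -/
noncomputable def spray (G : E → E →L[ℝ] E →L[ℝ] ℝ) (z : E × E) : E × E :=
  (z.2, (-((G z.1).inverse ∘L christoffelForm G z.1 z.2)) z.2)

/-- The geodesic equation with lowered index is the form in which both `IsGeodesicOn` and the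
transformation law are stated; this removes the inverse of the metric. -/
theorem spray_snd_eq_iff [FiniteDimensional ℝ E] {G : E → E →L[ℝ] E →L[ℝ] ℝ} {z : E × E}
    (hpos : ∀ u, u ≠ 0 → 0 < G z.1 u u) (q : E) :
    (spray G z).2 = q ↔ G z.1 q + christoffelForm G z.1 z.2 z.2 = 0 := by
  obtain ⟨e, he⟩ := exists_equiv_of_posDef hpos
  simp only [spray, ← he, ContinuousLinearMap.inverse_equiv, neg_apply,
    ContinuousLinearMap.comp_apply, ContinuousLinearEquiv.coe_coe]
  rw [neg_eq_iff_eq_neg, ContinuousLinearEquiv.symm_apply_eq, map_neg, add_comm,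
    add_eq_zero_iff_eq_neg]

theorem contDiffAt_christoffelForm {G : E → E →L[ℝ] E →L[ℝ] ℝ} {z : E × E}
    (hG : ContDiffAt ℝ 2 G z.1) :
    ContDiffAt ℝ 1 (fun z : E × E => christoffelForm G z.1 z.2) z := by
  have h1 : ContDiffAt ℝ 1 (fun z : E × E => fderiv ℝ G z.1) z :=
    (hG.fderiv_right (m := 1) (by norm_num)).comp z contDiffAt_fst
  have h2 : ContDiffAt ℝ 1 (fun z : E × E => (fderiv ℝ G z.1).flip) z :=
    (ContinuousLinearMap.flipₗᵢ ℝ E E (E →L[ℝ] ℝ)).contDiff.contDiffAt.comp z h1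
  have h3 := h2.clm_apply (contDiffAt_snd (𝕜 := ℝ) (n := 1) (p := z))
  have h4 : ContDiffAt ℝ 1 (fun z : E × E => ((fderiv ℝ G z.1).flip z.2).flip) z :=
    (ContinuousLinearMap.flipₗᵢ ℝ E E ℝ).contDiff.contDiffAt.comp z h3
  exact (((h1.clm_apply contDiffAt_snd).add h3).sub h4).const_smul _

theorem contDiffAt_sprayOp [FiniteDimensional ℝ E] {G : E → E →L[ℝ] E →L[ℝ] ℝ} {z : E × E}
    (hG : ContDiffAt ℝ 2 G z.1) (hpos : ∀ u, u ≠ 0 → 0 < G z.1 u u) :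
    ContDiffAt ℝ 1
      (fun z : E × E => -((G z.1).inverse ∘L christoffelForm G z.1 z.2)) z := by
  obtain ⟨e, he⟩ := exists_equiv_of_posDef hpos
  have h1 : ContDiffAt ℝ 1 (fun z : E × E => (G z.1).inverse) z := by
    have h : ContDiffAt ℝ 1 (ContinuousLinearMap.inverse (R := ℝ) (M := E) (M₂ := E →L[ℝ] ℝ))
        (G z.1) := by
      rw [← he]
      exact contDiffAt_map_inverse e
    exact h.comp z ((hG.of_le (by norm_num)).comp z contDiffAt_fst)
  exact (h1.clm_comp (contDiffAt_christoffelForm hG)).neg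

theorem contDiffAt_spray [FiniteDimensional ℝ E] {G : E → E →L[ℝ] E →L[ℝ] ℝ} {z : E × E}
    (hG : ContDiffAt ℝ 2 G z.1) (hpos : ∀ u, u ≠ 0 → 0 < G z.1 u u) :
    ContDiffAt ℝ 1 (spray G) z :=
  contDiffAt_snd.prodMk ((contDiffAt_sprayOp hG hpos).clm_apply contDiffAt_snd)

/-- The acceleration is quadratic in the velocity, so at velocity zero only `(y, v) ↦ (v, 0)`
survives. This map has square zero, as `LocalFlow.hasStrictFDerivAt` requires. -/
theorem hasStrictFDerivAt_spray [FiniteDimensional ℝ E] {G : E → E →L[ℝ] E →L[ℝ] ℝ} {p : E}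
    (hG : ContDiffAt ℝ 2 G p) (hpos : ∀ u, u ≠ 0 → 0 < G p u u) :
    HasStrictFDerivAt (spray G)
      (ContinuousLinearMap.inl ℝ E E ∘L ContinuousLinearMap.snd ℝ E E) (p, 0) := by
  have h1 := ((contDiffAt_sprayOp (z := (p, 0)) hG hpos).hasStrictFDerivAt (by norm_num)).clm_apply
    (hasStrictFDerivAt_snd (𝕜 := ℝ) (p := ((p, 0) : E × E)))
  refine ((hasStrictFDerivAt_snd (𝕜 := ℝ) (p := ((p, 0) : E × E))).prodMk h1).congr_fderiv ?_
  ext w <;> simp [christoffelForm]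

theorem hasFDerivAt_vectorTangentMap {F : E → E} {z : E × E} (hF : ContDiffAt ℝ 2 F z.1) :
    ∃ D : E × E →L[ℝ] E × E, HasFDerivAt (vectorTangentMap F) D z ∧ ∀ a b,
      D (a, b) = (fderiv ℝ F z.1 a, fderiv ℝ (fderiv ℝ F) z.1 a z.2 + fderiv ℝ F z.1 b) := by
  have hF1 : HasFDerivAt F (fderiv ℝ F z.1) z.1 := (hF.differentiableAt (by norm_num)).hasFDerivAt
  have hF2 : HasFDerivAt (fderiv ℝ F) (fderiv ℝ (fderiv ℝ F) z.1) z.1 :=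
    ((hF.fderiv_right (m := 1) (by norm_num)).differentiableAt (by norm_num)).hasFDerivAt
  refine ⟨_, (hF1.comp z hasFDerivAt_fst).prodMk
    ((hF2.comp z hasFDerivAt_fst).clm_apply hasFDerivAt_snd), fun a b => ?_⟩
  simp [add_comm]

/-- Isometries carry geodesic sprays to geodesic sprays. -/
theorem fderiv_spray_eq_of_isMetricMapAt [FiniteDimensional ℝ E] {G G' : E → E →L[ℝ] E →L[ℝ] ℝ} {F : E → E} {z : E × E}
    (hG : DifferentiableAt ℝ G z.1) (hG' : DifferentiableAt ℝ G' (F z.1))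
    (hF : ContDiffAt ℝ 2 F z.1) (hsymm : ∀ u v, G' (F z.1) u v = G' (F z.1) v u)
    (hiso : IsMetricMapAt G G' F z.1) (hpos : ∀ u, u ≠ 0 → 0 < G z.1 u u)
    (hpos' : ∀ u, u ≠ 0 → 0 < G' (F z.1) u u) :
    HasFDerivAt (vectorTangentMap F) (fderiv ℝ (vectorTangentMap F) z) z ∧
      fderiv ℝ (vectorTangentMap F) z (spray G z) = spray G' (vectorTangentMap F z) := by
  obtain ⟨D, hD, hDa⟩ := hasFDerivAt_vectorTangentMap (z := z) hF
  rw [hD.fderiv]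
  refine ⟨hD, ?_⟩
  have hq := (spray_snd_eq_iff hpos (spray G z).2).1 rfl
  -- Preserving a positive definite form makes the differential injective, hence surjective, so
  -- covectors may be tested on its values.
  have hsurj : Function.Surjective (fderiv ℝ F z.1) := by
    have : Function.Injective (fderiv ℝ F z.1).toLinearMap := by
      rw [injective_iff_map_eq_zero]
      intro u hu
      by_contra hne
      have h1 := hpos u hne
      have hu' : fderiv ℝ F z.1 u = 0 := hu
      rw [← hiso.self_of_nhds u u, hu'] at h1
      simp at h1
    exact LinearMap.injective_iff_surjective.1 this
  have h2 : (spray G' (vectorTangentMap F z)).2 =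
      fderiv ℝ (fderiv ℝ F) z.1 z.2 z.2 + fderiv ℝ F z.1 (spray G z).2 := by
    rw [spray_snd_eq_iff (by exact hpos')]
    ext w
    obtain ⟨w, rfl⟩ := hsurj w
    have h3 := christoffelForm_eq_of_isMetricMapAt hG hG' hF hsymm hiso z.2 z.2 w
    have h4 := congrArg (fun A : E →L[ℝ] ℝ => A w) hq
    simp only [add_apply, zero_apply] at h4
    rw [h3, ← hiso.self_of_nhds] at h4
    simp only [vectorTangentMap, map_add, add_apply, zero_apply]
    linarith
  rw [← Prod.mk.eta (p := spray G z), hDa, Prod.ext_iff]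
  exact ⟨rfl, h2.symm⟩

end LocalMetric

/-! ### The fixed set of an isometry in coordinates -/

section LocalSlice

variable {E : Type*} [NormedAddCommGroup E] [NormedSpace ℝ E]

/-- `G` is a smooth Riemannian metric on the open set `U`. -/
structure IsMetricOn (G : E → E →L[ℝ] E →L[ℝ] ℝ) (U : Set E) : Prop where
  isOpen : IsOpen U
  contDiffOn : ContDiffOn ℝ ∞ G U
  symm : ∀ y ∈ U, ∀ u v, G y u v = G y v u
  pos : ∀ y ∈ U, ∀ u, u ≠ 0 → 0 < G y u u

variable {G G' : E → E →L[ℝ] E →L[ℝ] ℝ} {U U' : Set E}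

theorem IsMetricOn.contDiffAt (h : IsMetricOn G U) {y : E} (hy : y ∈ U) : ContDiffAt ℝ ∞ G y :=
  h.contDiffOn.contDiffAt (h.isOpen.mem_nhds hy)

variable [FiniteDimensional ℝ E]

theorem IsMetricOn.contDiffAt_spray (h : IsMetricOn G U) {z : E × E} (hz : z.1 ∈ U) :
    ContDiffAt ℝ 1 (spray G) z :=
  FixedSet.contDiffAt_spray ((h.contDiffAt hz).of_le ENat.LEInfty.out) (h.pos _ hz)

theorem IsMetricOn.fderiv_spray_eq (h : IsMetricOn G U) (h' : IsMetricOn G' U') {F : E → E}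
    {z : E × E} (hz : z.1 ∈ U) (hFz : F z.1 ∈ U') (hF : ContDiffAt ℝ ∞ F z.1)
    (hiso : IsMetricMapAt G G' F z.1) :
    HasFDerivAt (vectorTangentMap F) (fderiv ℝ (vectorTangentMap F) z) z ∧
      fderiv ℝ (vectorTangentMap F) z (spray G z) = spray G' (vectorTangentMap F z) :=
  fderiv_spray_eq_of_isMetricMapAt ((h.contDiffAt hz).differentiableAt (by simp))
    ((h'.contDiffAt hFz).differentiableAt (by simp)) (hF.of_le ENat.LEInfty.out)
    (h'.symm _ hFz) hiso (h.pos _ hz) (h'.pos _ hFz)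

/-- Local uniqueness of integral curves of the geodesic spray. -/
theorem IsMetricOn.eventuallyEq_of_spray (h : IsMetricOn G U) {z z' : ℝ → E × E} {t : ℝ}
    (ht : (z t).1 ∈ U) (hz : ∀ᶠ s in 𝓝 t, HasDerivAt z (spray G (z s)) s)
    (hz' : ∀ᶠ s in 𝓝 t, HasDerivAt z' (spray G (z' s)) s) (heq : z t = z' t) : z =ᶠ[𝓝 t] z' := by
  obtain ⟨K, s, hs, hlip⟩ := (h.contDiffAt_spray ht).exists_lipschitzOnWith
  have hc : ∀ᶠ r in 𝓝 t, z r ∈ s := hz.self_of_nhds.continuousAt.eventually_mem hs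
  have hc' : ∀ᶠ r in 𝓝 t, z' r ∈ s :=
    hz'.self_of_nhds.continuousAt.eventually_mem (by rw [← heq]; exact hs)
  exact ODE_solution_unique_of_eventually (v := fun _ => spray G) (s := fun _ => s) (K := K)
    (Eventually.of_forall fun _ => hlip) (hz.and hc) (hz'.and hc') heq

/-- Extend to `E` a right inverse of `N` onto its range. The point is that `1 - B ∘L N` is then a
projection onto the kernel of `N`. -/
theorem exists_generalizedInverse (N : E →L[ℝ] E) :
    ∃ B : E →L[ℝ] E, ∀ y, N (B (N y)) = N y := by
  obtain ⟨g, hg⟩ := (N : E →ₗ[ℝ] E).rangeRestrict.exists_rightInverse_of_surjective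
    (LinearMap.range_rangeRestrict _)
  obtain ⟨B, hB⟩ := LinearMap.exists_extend g
  refine ⟨B.toContinuousLinearMap, fun y => ?_⟩
  have h1 : B (N y) = g ⟨N y, y, rfl⟩ := by rw [← hB]; rfl
  have h2 := congrArg Subtype.val (LinearMap.congr_fun hg ⟨N y, y, rfl⟩)
  change N (B (N y)) = N y
  rw [h1]
  exact h2

/-- Near a fixed point `p` of an isometry `F`, there is a family of fixed points of `F`
parametrized by the fixed vectors of the differential: the image of the exponential map. -/
theorem IsMetricOn.exists_fixed_family (h : IsMetricOn G U) {F : E → E} {p : E} (hp : p ∈ U)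
    (hF : ContDiffOn ℝ ∞ F U) (hFp : F p = p) (hiso : ∀ y ∈ U, F y ∈ U → IsMetricMapAt G G F y) :
    ∃ (T : ℝ) (e : E → E), T ≠ 0 ∧ e 0 = p ∧ HasStrictFDerivAt e (T • ContinuousLinearMap.id ℝ E) 0 ∧
      ∀ᶠ v in 𝓝 (0 : E), fderiv ℝ F p v = v → F (e v) = e v := by
  have hS1 : ContDiffAt ℝ 1 (spray G) (p, 0) := h.contDiffAt_spray hp
  have hS0 : spray G (p, 0) = 0 := by simp [spray]
  -- The flow exists only up to a small time `T`, so the family below is the exponential map at `p`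
  -- precomposed with scaling by `T`.
  obtain ⟨T, r, L, α, hα⟩ := exists_localFlow hS1 hS0
  have hN := hasStrictFDerivAt_spray ((h.contDiffAt hp).of_le ENat.LEInfty.out) (h.pos p hp)
  have hflow := hα.hasStrictFDerivAt hN (by ext <;> simp)
  have hin : HasStrictFDerivAt (fun v : E => (p, v)) (ContinuousLinearMap.inr ℝ E E) 0 :=
    (hasStrictFDerivAt_const p 0).prodMk (hasStrictFDerivAt_id 0)
  refine ⟨T, fun v => (α (p, v) T).1, hα.T_pos.ne', ?_, ?_, ?_⟩
  · simp only [hα.equilibrium T ⟨hα.T_pos.le, le_rfl⟩]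
  · refine (hasStrictFDerivAt_fst.comp (0 : E)
      (HasStrictFDerivAt.comp (g := fun x => α x T) (0 : E) hflow hin)).congr_fderiv ?_
    ext v
    simp
  obtain ⟨K, s, hs, hlip⟩ := hS1.exists_lipschitzOnWith
  have hUn : U ∈ 𝓝 p := h.isOpen.mem_nhds hp
  have hFc : ContDiffAt ℝ ∞ F p := hF.contDiffAt hUn
  have hFU : ∀ᶠ y in 𝓝 p, F y ∈ U := hFc.continuousAt.eventually_mem (by rwa [hFp])
  have hTF : ContinuousAt (vectorTangentMap F) (p, 0) :=
    (hasFDerivAt_vectorTangentMap (z := (p, 0)) (hFc.of_le ENat.LEInfty.out)).choose_spec.1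
      |>.continuousAt
  have hTF0 : vectorTangentMap F (p, 0) = (p, 0) := by simp [vectorTangentMap, hFp]
  have hs' : ∀ᶠ z in 𝓝 ((p, 0) : E × E),
      z ∈ s ∧ vectorTangentMap F z ∈ s ∧ z.1 ∈ U ∧ F z.1 ∈ U := by
    filter_upwards [hs, hTF.eventually_mem (by rwa [hTF0]),
      (continuousAt_fst (p := ((p, 0) : E × E))).eventually hUn,
      (continuousAt_fst (p := ((p, 0) : E × E))).eventually hFU] with z h1 h2 h3 h4
    exact ⟨h1, h2, h3, h4⟩
  have hev := hin.continuousAt.eventually (hα.eventually_mem hs')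
  filter_upwards [hev] with v ⟨hvr, hvs⟩ hAv
  have hd := hα.deriv (p, v) hvr
  have hmono : ∀ t ∈ Ico 0 T, Icc 0 T ∈ 𝓝[Ici t] t := fun t ht =>
    mem_of_superset (Icc_mem_nhdsGE ht.2) (Icc_subset_Icc_left ht.1)
  -- The tangent map of `F` carries the trajectory to another trajectory of the spray. When the
  -- differential fixes `v` both start at `(p, v)`, so they coincide.
  have hTd : ∀ t ∈ Icc 0 T, HasDerivWithinAt (fun t => vectorTangentMap F (α (p, v) t))
      (spray G (vectorTangentMap F (α (p, v) t))) (Icc 0 T) t := by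
    intro t ht
    obtain ⟨_, _, h3, h4⟩ := hvs t ht
    obtain ⟨h5, h6⟩ := h.fderiv_spray_eq h (F := F) h3 h4 (hF.contDiffAt (h.isOpen.mem_nhds h3))
      (hiso _ h3 h4)
    rw [← h6]
    exact h5.comp_hasDerivWithinAt t (hd t ht)
  have heq := ODE_solution_unique_of_mem_Icc_right (v := fun _ => spray G) (s := fun _ => s) (K := K)
    (f := fun t => vectorTangentMap F (α (p, v) t)) (g := α (p, v)) (a := 0) (b := T)
    (fun _ _ => hlip) (fun t ht => (hTd t ht).continuousWithinAt)
    (fun t ht => (hTd t ⟨ht.1, ht.2.le⟩).mono_of_mem_nhdsWithin (hmono t ht))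
    (fun t ht => (hvs t ⟨ht.1, ht.2.le⟩).2.1) (fun t ht => (hd t ht).continuousWithinAt)
    (fun t ht => (hd t ⟨ht.1, ht.2.le⟩).mono_of_mem_nhdsWithin (hmono t ht))
    (fun t ht => (hvs t ⟨ht.1, ht.2.le⟩).1)
    (by simp [hα.initial _ hvr, vectorTangentMap, hFp, hAv])
  exact congrArg Prod.fst (heq ⟨hα.T_pos.le, le_rfl⟩)

/-- The fixed set of an isometry is, near a fixed point, a linear subspace in suitable
coordinates. -/
theorem IsMetricOn.exists_slice (h : IsMetricOn G U) {F : E → E} {p : E} (hp : p ∈ U)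
    (hF : ContDiffOn ℝ ∞ F U) (hFp : F p = p) (hiso : ∀ y ∈ U, F y ∈ U → IsMetricMapAt G G F y) :
    ∃ Ψ : OpenPartialHomeomorph E E, p ∈ Ψ.source ∧ Ψ.source ⊆ U ∧ ContDiffOn ℝ ∞ Ψ Ψ.source ∧
      ContDiffOn ℝ ∞ Ψ.symm Ψ.target ∧
      (∀ y ∈ Ψ.source, F y = y ↔ fderiv ℝ F p (Ψ y) = Ψ y) ∧
      ∀ y ∈ Ψ.source, F y = y → ∀ u, fderiv ℝ F y u = u ↔
        fderiv ℝ F p (fderiv ℝ Ψ y u) = fderiv ℝ Ψ y u := by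
  set A := fderiv ℝ F p with hA
  set N : E →L[ℝ] E := A - ContinuousLinearMap.id ℝ E with hN
  have hNA : ∀ u, A u = u ↔ N u = 0 := fun u => by simp [hN, sub_eq_zero]
  obtain ⟨B, hB⟩ := exists_generalizedInverse N
  have hUn : U ∈ 𝓝 p := h.isOpen.mem_nhds hp
  -- At fixed points of `F` the last term vanishes and `ψ y` is the projection of `y - p` to the
  -- kernel of `N`. At `p` its derivative cancels that of `-B N`, so `ψ` has derivative the identity
  -- there.
  set ψ : E → E := fun y => (y - p) - B (N (y - p)) + B (F y - y) with hψ
  have hψd : ∀ y ∈ U, HasFDerivAt ψ (ContinuousLinearMap.id ℝ E - B ∘L N +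
      B ∘L (fderiv ℝ F y - ContinuousLinearMap.id ℝ E)) y := by
    intro y hy
    have h1 : HasFDerivAt F (fderiv ℝ F y) y :=
      ((hF.contDiffAt (h.isOpen.mem_nhds hy)).differentiableAt (by simp)).hasFDerivAt
    have h2 : HasFDerivAt (fun y => y - p) (ContinuousLinearMap.id ℝ E) y :=
      (hasFDerivAt_id y).sub_const p
    exact (h2.sub ((B ∘L N).hasFDerivAt.comp y h2)).add
      (B.hasFDerivAt.comp y (h1.sub (hasFDerivAt_id y)))
  have hψs : ContDiffOn ℝ ∞ ψ U := by
    have h2 : ContDiffOn ℝ ∞ (fun y : E => y - p) U := contDiffOn_id.sub contDiffOn_const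
    exact (h2.sub ((B ∘L N).contDiff.comp_contDiffOn h2)).add
      (B.contDiff.comp_contDiffOn (hF.sub contDiffOn_id))
  have hψp : HasFDerivAt ψ ((ContinuousLinearEquiv.refl ℝ E : E ≃L[ℝ] E) : E →L[ℝ] E) p := by
    refine (hψd p hp).congr_fderiv ?_
    ext u
    simp [hN, hA]
  have hψ0 : ψ p = 0 := by simp [hψ, hFp]
  -- the set of points at which the differential is invertible
  have hinv : ∀ᶠ y in 𝓝 p, ∃ e : E ≃L[ℝ] E, (e : E →L[ℝ] E) = fderiv ℝ ψ y := by
    have hc : ContinuousAt (fderiv ℝ ψ) p :=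
      ((hψs.contDiffAt hUn).fderiv_right (m := 0) (by simp)).continuousAt
    have := ContinuousLinearEquiv.nhds (ContinuousLinearEquiv.refl ℝ E : E ≃L[ℝ] E)
    rw [← hψp.fderiv] at this
    filter_upwards [hc.eventually_mem this] with y hy
    exact hy
  obtain ⟨T, e, hT, he0, hed, heF⟩ := h.exists_fixed_family hp hF hFp hiso
  -- the slice is covered by fixed points
  let V : Submodule ℝ E := LinearMap.ker N.toLinearMap
  let P : E →L[ℝ] E := ContinuousLinearMap.id ℝ E - B ∘L N
  have hPV : ∀ u, P u ∈ V := fun u => by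
    change N (u - B (N u)) = 0
    rw [map_sub, hB, sub_self]
  let PV : E →L[ℝ] V := P.codRestrict V hPV
  -- The family `e`, restricted to `V` and read through the projection `PV`, is a submersion at `0`.
  -- Hence every small value of `ψ` in `V` is attained at a fixed point, and local injectivity of
  -- `ψ` leaves no other point with that value.
  have hcov : ∀ᶠ y in 𝓝 p, N (ψ y) = 0 → F y = y := by
    have hs : HasStrictFDerivAt (fun v : V => PV (e v - p)) (T • ContinuousLinearMap.id ℝ V) 0 := by
      have h1 : HasStrictFDerivAt (fun v : V => e v - p)
          ((T • ContinuousLinearMap.id ℝ E) ∘L V.subtypeL) 0 :=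
        (HasStrictFDerivAt.comp (g := e) (f := fun v : V => (v : E)) (0 : V) hed
          V.subtypeL.hasStrictFDerivAt).sub_const p
      refine (PV.hasStrictFDerivAt.comp (0 : V) h1).congr_fderiv ?_
      ext v
      have hv : N v = 0 := v.2
      simp [PV, P, hv]
    have hmap := hs.map_nhds_eq_of_surj (by
      rw [LinearMap.range_eq_top]
      intro v
      exact ⟨T⁻¹ • v, by simp [smul_smul, hT]⟩)
    have hz : PV (e (0 : V) - p) = 0 := by simp [he0]
    rw [hz] at hmap
    -- the open partial homeomorphism given by the inverse function theorem
    have hstrict : HasStrictFDerivAt ψ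
        ((ContinuousLinearEquiv.refl ℝ E : E ≃L[ℝ] E) : E →L[ℝ] E) p :=
      (hψs.contDiffAt hUn).hasStrictFDerivAt' hψp (by simp)
    set Θ := hstrict.toOpenPartialHomeomorph ψ with hΘ
    have hpΘ : Θ.source ∈ 𝓝 p := Θ.open_source.mem_nhds hstrict.mem_toOpenPartialHomeomorph_source
    have hec : ContinuousAt (fun v : V => e v) 0 := by
      have h1 : ContinuousAt e ((0 : V) : E) := hed.continuousAt
      exact h1.comp (f := fun v : V => (v : E)) continuous_subtype_val.continuousAt
    have hgood : ∀ᶠ v : V in 𝓝 (0 : V), e v ∈ Θ.source ∧ F (e v) = e v := by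
      have h1 : ∀ᶠ v : V in 𝓝 (0 : V), e v ∈ Θ.source :=
        hec.eventually_mem (by simpa [he0] using hpΘ)
      have h2 : ∀ᶠ v : V in 𝓝 (0 : V), A (v : E) = v → F (e v) = e v :=
        (continuous_subtype_val.tendsto' (0 : V) (0 : E) rfl).eventually heF
      filter_upwards [h1, h2] with v h1 h2
      exact ⟨h1, h2 ((hNA _).2 v.2)⟩
    have himg : ∀ᶠ w in 𝓝 (0 : V), ∃ v : V, PV (e v - p) = w ∧ e v ∈ Θ.source ∧ F (e v) = e v := by
      rw [← hmap]
      exact eventually_map.2 (hgood.mono fun v hv => ⟨v, rfl, hv⟩)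
    obtain ⟨O, hO⟩ := mem_nhdsWithin.1 (mem_nhds_subtype_iff_nhdsWithin.1 himg)
    have hOψ : ∀ᶠ y in 𝓝 p, ψ y ∈ O := by
      have : ContinuousAt ψ p := hψp.continuousAt
      exact this.eventually_mem (hO.1.mem_nhds (by rw [hψ0]; exact hO.2.1))
    filter_upwards [hOψ, hpΘ] with y hyO hyΘ hyV
    obtain ⟨w, hw, hwy⟩ := hO.2.2 ⟨hyO, hyV⟩
    obtain ⟨v, hv, hvΘ, hvF⟩ := hw
    have h1 : ψ (e v) = ψ y := by
      rw [← hwy, ← hv]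
      simp only [hψ, hvF, sub_self, map_zero, add_zero]
      rfl
    have h2 : e v = y := Θ.injOn hvΘ hyΘ h1
    rw [← h2, hvF]
  -- the slice chart
  have hstrict : HasStrictFDerivAt ψ
      ((ContinuousLinearEquiv.refl ℝ E : E ≃L[ℝ] E) : E →L[ℝ] E) p :=
    (hψs.contDiffAt hUn).hasStrictFDerivAt' hψp (by simp)
  obtain ⟨O, hOsub, hOo, hpO⟩ := mem_nhds_iff.1 (Filter.inter_mem (Filter.inter_mem hinv hcov) hUn)
  let Ψ := (hstrict.toOpenPartialHomeomorph ψ).restrOpen O hOo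
  have hΨ : ∀ y, Ψ y = ψ y := fun y => rfl
  have hΨO : Ψ.source ⊆ O := fun y hy => hy.2
  have hΨU : Ψ.source ⊆ U := fun y hy => (hOsub (hΨO hy)).2
  have hΨs : ContDiffOn ℝ ∞ Ψ Ψ.source := hψs.mono hΨU
  have hsymm : ContDiffOn ℝ ∞ Ψ.symm Ψ.target := by
    intro a ha
    have hm := Ψ.map_target ha
    obtain ⟨e', he'⟩ := (hOsub (hΨO hm)).1.1
    refine (Ψ.contDiffAt_symm (f₀' := e') ha ?_ (hψs.contDiffAt (h.isOpen.mem_nhds (hΨU hm)))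
      ).contDiffWithinAt
    rw [he']
    exact ((hψd _ (hΨU hm)).differentiableAt).hasFDerivAt
  have hfix : ∀ y ∈ Ψ.source, F y = y ↔ A (Ψ y) = Ψ y := by
    intro y hy
    rw [hNA]
    refine ⟨fun hy' => ?_, (hOsub (hΨO hy)).1.2⟩
    have : Ψ y = P (y - p) := by simp [hΨ, hψ, hy', P]
    rw [this]
    exact hPV _
  refine ⟨Ψ, ⟨hstrict.mem_toOpenPartialHomeomorph_source, hpO⟩, hΨU, hΨs, hsymm, hfix, ?_⟩
  intro y hy hFy u
  have hyU := hΨU hy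
  have hd : HasFDerivAt Ψ _ y := hψd y hyU
  have hFd : HasFDerivAt F (fderiv ℝ F y) y :=
    ((hF.contDiffAt (h.isOpen.mem_nhds hyU)).differentiableAt (by simp)).hasFDerivAt
  constructor
  · intro hu
    rw [hNA, hd.fderiv]
    have : (ContinuousLinearMap.id ℝ E - B ∘L N +
      B ∘L (fderiv ℝ F y - ContinuousLinearMap.id ℝ E)) u = P u := by simp [P, hu]
    rw [this]
    exact hPV _
  · intro hu
    set w := fderiv ℝ Ψ y u with hw
    -- the curve of fixed points through `y` with velocity `u`
    let c : ℝ → E := fun t => Ψ.symm (Ψ y + t • w)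
    have hyt : Ψ y ∈ Ψ.target := Ψ.map_source hy
    have hline : HasDerivAt (fun t : ℝ => Ψ y + t • w) w 0 := by
      simpa using ((hasDerivAt_id (0 : ℝ)).smul_const w).const_add (Ψ y)
    have hline0 : Ψ y + (0 : ℝ) • w = Ψ y := by simp
    have hsd : HasFDerivAt Ψ.symm (fderiv ℝ Ψ.symm (Ψ y)) (Ψ y + (0 : ℝ) • w) := by
      rw [hline0]
      exact ((hsymm.contDiffAt (Ψ.open_target.mem_nhds hyt)).differentiableAt (by simp)).hasFDerivAt
    have hcd : HasDerivAt c (fderiv ℝ Ψ.symm (Ψ y) w) 0 := hsd.comp_hasDerivAt 0 hline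
    have hinvd : fderiv ℝ Ψ.symm (Ψ y) w = u := by
      have h1 : HasFDerivAt (Ψ.symm ∘ Ψ) (fderiv ℝ Ψ.symm (Ψ y) ∘L fderiv ℝ Ψ y) y := by
        rw [hline0] at hsd
        exact hsd.comp y hd.differentiableAt.hasFDerivAt
      have h2 : HasFDerivAt (Ψ.symm ∘ Ψ) (ContinuousLinearMap.id ℝ E) y :=
        (hasFDerivAt_id y).congr_of_eventuallyEq (by
          filter_upwards [Ψ.open_source.mem_nhds hy] with z hz using Ψ.left_inv hz)
      exact congrArg (fun D : E →L[ℝ] E => D u) (h1.unique h2)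
    rw [hinvd] at hcd
    have hc0 : c 0 = y := by simp only [c, hline0]; exact Ψ.left_inv hy
    have hct : ∀ᶠ t in 𝓝 (0 : ℝ), F (c t) = c t := by
      have : ∀ᶠ t in 𝓝 (0 : ℝ), Ψ y + t • w ∈ Ψ.target :=
        hline.continuousAt.eventually_mem (by rw [hline0]; exact Ψ.open_target.mem_nhds hyt)
      filter_upwards [this] with t ht
      refine (hfix _ (Ψ.map_target ht)).2 ?_
      rw [Ψ.right_inv ht, map_add, map_smul, hu, (hfix y hy).1 hFy]
    have h1 : HasDerivAt (fun t => F (c t)) (fderiv ℝ F y u) 0 := by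
      rw [← hc0] at hFd
      have := hFd.comp_hasDerivAt 0 hcd
      rwa [hc0] at this
    exact h1.unique (hcd.congr_of_eventuallyEq hct)

end LocalSlice

/-! ### The metric in charts -/

section ChartMetric

variable {n : ℕ} {M : Type*} [TopologicalSpace M] [ChartedSpace (EuclideanSpace ℝ (Fin n)) M]
  [IsManifold (𝓡 n) ∞ M]

theorem mdifferentiableAt_extChartAt_symm (x₀ : M) {y : EuclideanSpace ℝ (Fin n)}
    (hy : y ∈ (extChartAt (𝓡 n) x₀).target) :
    MDifferentiableAt 𝓘(ℝ, EuclideanSpace ℝ (Fin n)) (𝓡 n) (extChartAt (𝓡 n) x₀).symm y := by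
  have := mdifferentiableWithinAt_extChartAt_symm (I := 𝓡 n) hy
  simpa using! this

theorem contMDiffAt_extChartAt_symm' (x₀ : M) {y : EuclideanSpace ℝ (Fin n)}
    (hy : y ∈ (extChartAt (𝓡 n) x₀).target) :
    ContMDiffAt 𝓘(ℝ, EuclideanSpace ℝ (Fin n)) (𝓡 n) ∞ (extChartAt (𝓡 n) x₀).symm y :=
  (contMDiffOn_extChartAt_symm x₀).contMDiffAt ((isOpen_extChartAt_target x₀).mem_nhds hy)

theorem mfderiv_extChartAt_symm_injective (x₀ : M) {y : EuclideanSpace ℝ (Fin n)}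
    (hy : y ∈ (extChartAt (𝓡 n) x₀).target) :
    Function.Injective
      (mfderiv 𝓘(ℝ, EuclideanSpace ℝ (Fin n)) (𝓡 n) (extChartAt (𝓡 n) x₀).symm y) := by
  have h := (isInvertible_mfderivWithin_extChartAt_symm (I := 𝓡 n) hy).injective
  have h2 : mfderivWithin 𝓘(ℝ, EuclideanSpace ℝ (Fin n)) (𝓡 n) (extChartAt (𝓡 n) x₀).symm
      (range (𝓡 n)) y =
      mfderiv 𝓘(ℝ, EuclideanSpace ℝ (Fin n)) (𝓡 n) (extChartAt (𝓡 n) x₀).symm y := by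
    rw [ModelWithCorners.Boundaryless.range_eq_univ, mfderivWithin_univ]
  rwa [h2] at h

variable [RiemannianBundle (fun x : M => TangentSpace (𝓡 n) x)]

/-- The inner product on a tangent space. -/
noncomputable def tangentInner {n : ℕ} {M : Type*} [TopologicalSpace M]
    [ChartedSpace (EuclideanSpace ℝ (Fin n)) M]
    [RiemannianBundle (fun x : M => TangentSpace (𝓡 n) x)] (x : M) (a b : TangentSpace (𝓡 n) x) :
    ℝ :=
  inner ℝ a b

/-- The metric in the preferred chart around `x₀`, as a field of bilinear forms. -/
noncomputable def chartForm (x₀ : M) (y : EuclideanSpace ℝ (Fin n)) :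
    EuclideanSpace ℝ (Fin n) →L[ℝ] EuclideanSpace ℝ (Fin n) →L[ℝ] ℝ :=
  LinearMap.toContinuousLinearMap
    ((LinearMap.toContinuousLinearMap (𝕜 := ℝ) (E := EuclideanSpace ℝ (Fin n))
      (F' := ℝ)).toLinearMap ∘ₗ LinearMap.mk₂ ℝ (chartMetric x₀ y)
        (fun u u' _ => (congrArg (tangentInner _ · _) (map_add _ u u')).trans
          (inner_add_left _ _ _))
        (fun c u _ => (congrArg (tangentInner _ · _) (map_smul _ c u)).trans
          (real_inner_smul_left _ _ _))
        (fun _ v v' => (congrArg (tangentInner _ _ ·) (map_add _ v v')).trans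
          (inner_add_right _ _ _))
        (fun c _ v => (congrArg (tangentInner _ _ ·) (map_smul _ c v)).trans
          (real_inner_smul_right _ _ _)))

omit [IsManifold (𝓡 n) ∞ M] in
@[simp] theorem chartForm_apply (x₀ : M) (y u v : EuclideanSpace ℝ (Fin n)) :
    chartForm x₀ y u v = chartMetric x₀ y u v := rfl

variable [IsContMDiffRiemannianBundle (𝓡 n) ∞ (EuclideanSpace ℝ (Fin n))
      (fun x : M => TangentSpace (𝓡 n) x)]

/-- Coordinate vector fields are smooth sections of the tangent bundle, and a smooth bundle metric
pairs smooth sections smoothly. -/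
theorem contDiffOn_chartMetric (x₀ : M) (u v : EuclideanSpace ℝ (Fin n)) :
    ContDiffOn ℝ ∞ (fun y => chartMetric x₀ y u v) (extChartAt (𝓡 n) x₀).target := by
  have hU : IsOpen (extChartAt (𝓡 n) x₀).target := isOpen_extChartAt_target x₀
  have hsec : ∀ w : EuclideanSpace ℝ (Fin n),
      ContMDiffOn 𝓘(ℝ, EuclideanSpace ℝ (Fin n)) (𝓡 n).tangent ∞
      (fun y => (⟨(extChartAt (𝓡 n) x₀).symm y,
        mfderiv 𝓘(ℝ, EuclideanSpace ℝ (Fin n)) (𝓡 n) (extChartAt (𝓡 n) x₀).symm y w⟩ :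
          TangentBundle (𝓡 n) M)) (extChartAt (𝓡 n) x₀).target := by
    intro w
    have h1 := (contMDiffOn_extChartAt_symm (I := 𝓡 n) (n := ∞) x₀).contMDiffOn_tangentMapWithin
      (m := ∞) (by simp) hU.uniqueMDiffOn
    have h2 : ContMDiff 𝓘(ℝ, EuclideanSpace ℝ (Fin n)) 𝓘(ℝ, EuclideanSpace ℝ (Fin n)).tangent ∞
        (fun y => (⟨y, w⟩ : TangentBundle 𝓘(ℝ, EuclideanSpace ℝ (Fin n))
          (EuclideanSpace ℝ (Fin n)))) :=
      contMDiff_vectorSpace_iff_contDiff.2 contDiff_const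
    refine (h1.comp h2.contMDiffOn (fun y hy => hy)).congr fun y hy => ?_
    simp only [Function.comp, tangentMapWithin, mfderivWithin_of_isOpen hU hy]
  exact ((hsec u).inner_bundle (hsec v)).contDiffOn

theorem isMetricOn_chartForm (x₀ : M) :
    IsMetricOn (chartForm x₀) (extChartAt (𝓡 n) x₀).target where
  isOpen := isOpen_extChartAt_target x₀
  contDiffOn := contDiffOn_clm_apply.2 fun u => contDiffOn_clm_apply.2 fun v =>
    contDiffOn_chartMetric x₀ u v
  symm y _ u v := (real_inner_comm (F := TangentSpace (𝓡 n) ((extChartAt (𝓡 n) x₀).symm y)) _ _)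
  pos y hy u hu := by
    refine (real_inner_self_pos (F := TangentSpace (𝓡 n) ((extChartAt (𝓡 n) x₀).symm y))).2
      fun h => ?_
    exact hu (mfderiv_extChartAt_symm_injective x₀ hy (h.trans (map_zero _).symm))

/-- An entry of the derivative is the derivative of an entry; this links the equation in
`IsGeodesicOn` to `spray`. -/
theorem christoffel_eq (x₀ : M) {y : EuclideanSpace ℝ (Fin n)}
    (hy : y ∈ (extChartAt (𝓡 n) x₀).target) (u v w : EuclideanSpace ℝ (Fin n)) :
    christoffel x₀ y u v w = christoffelForm (chartForm x₀) y u v w := by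
  have hd : DifferentiableAt ℝ (chartForm x₀) y :=
    ((isMetricOn_chartForm x₀).contDiffAt hy).differentiableAt (by simp)
  have key : ∀ a b c : EuclideanSpace ℝ (Fin n),
      fderiv ℝ (fun z => chartMetric x₀ z a b) y c = fderiv ℝ (chartForm x₀) y c a b := by
    intro a b c
    have h1 : HasFDerivAt (fun z => chartForm x₀ z a b) _ y :=
      (hd.hasFDerivAt.clm_apply (hasFDerivAt_const a y)).clm_apply (hasFDerivAt_const b y)
    have h2 := h1.fderiv
    simp only [chartForm_apply] at h2
    rw [h2]
    simp
  rw [christoffelForm_apply, christoffel, key, key, key]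

end ChartMetric

/-! ### Isometries in charts -/

section Isometry

variable {n : ℕ} {M : Type*} [TopologicalSpace M] [ChartedSpace (EuclideanSpace ℝ (Fin n)) M]
  [IsManifold (𝓡 n) ∞ M] [RiemannianBundle (fun x : M => TangentSpace (𝓡 n) x)]

/-- A smooth self-map of a Riemannian manifold which preserves the metric. -/
structure IsRiemannianMap (n : ℕ) {M : Type*} [TopologicalSpace M]
    [ChartedSpace (EuclideanSpace ℝ (Fin n)) M]
    [RiemannianBundle (fun x : M => TangentSpace (𝓡 n) x)] (f : M → M) : Prop where
  contMDiff : ContMDiff (𝓡 n) (𝓡 n) ∞ f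
  inner_map : ∀ (x : M) (v w : TangentSpace (𝓡 n) x),
    inner ℝ (mfderiv (𝓡 n) (𝓡 n) f x v : TangentSpace (𝓡 n) (f x)) (mfderiv (𝓡 n) (𝓡 n) f x w)
      = inner ℝ v w

omit [IsManifold (𝓡 n) ∞ M] in
theorem IsRiemannianMap.id : IsRiemannianMap n (id : M → M) :=
  ⟨contMDiff_id, fun x v w => by rw [mfderiv_id]; rfl⟩

omit [IsManifold (𝓡 n) ∞ M] in
theorem IsRiemannianMap.comp {f g : M → M} (hg : IsRiemannianMap n g) (hf : IsRiemannianMap n f) :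
    IsRiemannianMap n (g ∘ f) :=
  ⟨hg.contMDiff.comp hf.contMDiff, fun x v w => by
    rw [mfderiv_comp x (hg.contMDiff.mdifferentiableAt (by simp))
      (hf.contMDiff.mdifferentiableAt (by simp))]
    exact (hg.inner_map _ _ _).trans (hf.inner_map _ _ _)⟩

omit [IsManifold (𝓡 n) ∞ M] in
theorem IsRiemannianMap.iterate {f : M → M} (hf : IsRiemannianMap n f) (k : ℕ) :
    IsRiemannianMap n f^[k] := by
  induction k with
  | zero => exact .id
  | succ k ih => rw [Function.iterate_succ]; exact ih.comp hf

theorem OrientedIsometry.isRiemannianMap {o : ManifoldOrientation n M} (φ : OrientedIsometry o) :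
    IsRiemannianMap n φ.toHomeo :=
  ⟨φ.toDiffeo.contMDiff, φ.inner_map⟩

/-- A self-map of `M` read in the preferred charts around `x₀` and `x₁`. -/
noncomputable def chartMap (f : M → M) (x₀ x₁ : M) :
    EuclideanSpace ℝ (Fin n) → EuclideanSpace ℝ (Fin n) :=
  fun y => extChartAt (𝓡 n) x₁ (f ((extChartAt (𝓡 n) x₀).symm y))

variable {f : M → M} {x₀ x₁ : M} {y : EuclideanSpace ℝ (Fin n)}

theorem IsRiemannianMap.contDiffAt_chartMap (hf : IsRiemannianMap n f)
    (hy : y ∈ (extChartAt (𝓡 n) x₀).target)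
    (hfy : f ((extChartAt (𝓡 n) x₀).symm y) ∈ (extChartAt (𝓡 n) x₁).source) :
    ContDiffAt ℝ ∞ (chartMap f x₀ x₁) y := by
  rw [← contMDiffAt_iff_contDiffAt]
  have h1 := contMDiffAt_extChartAt' (I := 𝓡 n) (n := ∞) (by rwa [extChartAt_source] at hfy)
  exact h1.comp y ((hf.contMDiff _).comp y (contMDiffAt_extChartAt_symm' x₀ hy))

/-- Differentiate the relation between `f` and its coordinate expression. Two base points are
allowed so that `f = id` covers changes of coordinates. -/
theorem IsRiemannianMap.isMetricMapAt_chartMap (hf : IsRiemannianMap n f)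
    (hy : y ∈ (extChartAt (𝓡 n) x₀).target)
    (hfy : f ((extChartAt (𝓡 n) x₀).symm y) ∈ (extChartAt (𝓡 n) x₁).source) :
    IsMetricMapAt (chartForm x₀) (chartForm x₁) (chartMap f x₀ x₁) y := by
  have hcont : ContinuousAt (fun z => f ((extChartAt (𝓡 n) x₀).symm z)) y :=
    hf.contMDiff.continuous.continuousAt.comp (contMDiffAt_extChartAt_symm' x₀ hy).continuousAt
  have hev : ∀ᶠ z in 𝓝 y, z ∈ (extChartAt (𝓡 n) x₀).target ∧
      f ((extChartAt (𝓡 n) x₀).symm z) ∈ (extChartAt (𝓡 n) x₁).source :=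
    Filter.Eventually.and ((isOpen_extChartAt_target x₀).mem_nhds hy)
      (hcont.eventually_mem ((isOpen_extChartAt_source x₁).mem_nhds hfy))
  filter_upwards [hev.eventually_nhds] with z hz u v
  obtain ⟨hz1, hz2⟩ := hz.self_of_nhds
  have heq : (fun z => (extChartAt (𝓡 n) x₁).symm (chartMap f x₀ x₁ z)) =ᶠ[𝓝 z]
      fun z => f ((extChartAt (𝓡 n) x₀).symm z) := by
    filter_upwards [hz] with w hw using (extChartAt (𝓡 n) x₁).left_inv hw.2
  have hT : chartMap f x₀ x₁ z ∈ (extChartAt (𝓡 n) x₁).target :=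
    (extChartAt (𝓡 n) x₁).map_source hz2
  have hchart : MDifferentiableAt 𝓘(ℝ, EuclideanSpace ℝ (Fin n)) 𝓘(ℝ, EuclideanSpace ℝ (Fin n))
      (chartMap f x₀ x₁) z :=
    (hf.contDiffAt_chartMap hz1 hz2).contMDiffAt.mdifferentiableAt (by simp)
  have h1 : HasMFDerivAt 𝓘(ℝ, EuclideanSpace ℝ (Fin n)) (𝓡 n)
      (fun z => (extChartAt (𝓡 n) x₁).symm (chartMap f x₀ x₁ z)) z _ :=
    (mdifferentiableAt_extChartAt_symm x₁ hT).hasMFDerivAt.comp z hchart.hasMFDerivAt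
  have h2 : HasMFDerivAt 𝓘(ℝ, EuclideanSpace ℝ (Fin n)) (𝓡 n)
      (fun z => f ((extChartAt (𝓡 n) x₀).symm z)) z _ :=
    (hf.contMDiff.mdifferentiableAt (by simp)).hasMFDerivAt.comp z
      (mdifferentiableAt_extChartAt_symm x₀ hz1).hasMFDerivAt
  have hpt : (extChartAt (𝓡 n) x₁).symm (chartMap f x₀ x₁ z) = f ((extChartAt (𝓡 n) x₀).symm z) :=
    (extChartAt (𝓡 n) x₁).left_inv hz2
  have h3 := hasMFDerivAt_unique (h1.congr_of_eventuallyEq heq.symm) h2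
  have key : ∀ w : EuclideanSpace ℝ (Fin n),
      (mfderiv 𝓘(ℝ, EuclideanSpace ℝ (Fin n)) (𝓡 n) (extChartAt (𝓡 n) x₁).symm
        (chartMap f x₀ x₁ z) (fderiv ℝ (chartMap f x₀ x₁) z w) : EuclideanSpace ℝ (Fin n)) =
      mfderiv (𝓡 n) (𝓡 n) f ((extChartAt (𝓡 n) x₀).symm z)
        (mfderiv 𝓘(ℝ, EuclideanSpace ℝ (Fin n)) (𝓡 n) (extChartAt (𝓡 n) x₀).symm z w) := by
    intro w
    rw [← mfderiv_eq_fderiv]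
    exact congrArg (fun D : EuclideanSpace ℝ (Fin n) →L[ℝ] EuclideanSpace ℝ (Fin n) => D w) h3
  -- The two base points are only propositionally equal, so the inner product is transported along
  -- the equality.
  have aux : ∀ (p q : M) (_ : p = q) (a b a' b' : EuclideanSpace ℝ (Fin n)), a = a' → b = b' →
      tangentInner (n := n) p a b = tangentInner (n := n) q a' b' := by
    rintro p q rfl a b a' b' rfl rfl
    rfl
  exact (aux _ _ hpt _ _ _ _ (key u) (key v)).trans (hf.inner_map _ _ _)

end Isometry

/-! ### Slice charts, rigidity and geodesics -/

section Slice

variable {n : ℕ} {M : Type*} [TopologicalSpace M] [ChartedSpace (EuclideanSpace ℝ (Fin n)) M]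

/-- The differential of a self-map of `M` at `x`, as an operator on the model space. At a fixed
point this is an endomorphism of the tangent space. -/
noncomputable def tangentOp (f : M → M) (x : M) :
    EuclideanSpace ℝ (Fin n) →L[ℝ] EuclideanSpace ℝ (Fin n) :=
  mfderiv (𝓡 n) (𝓡 n) f x

/-- The differential of a coordinate map at `x`, as an operator on the model space. -/
noncomputable def coordDeriv (Θ : M → EuclideanSpace ℝ (Fin n)) (x : M) :
    EuclideanSpace ℝ (Fin n) →L[ℝ] EuclideanSpace ℝ (Fin n) :=
  mfderiv (𝓡 n) 𝓘(ℝ, EuclideanSpace ℝ (Fin n)) Θ x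

variable [IsManifold (𝓡 n) ∞ M]

theorem coordDeriv_extChartAt_bijective {x₀ x : M} (hx : x ∈ (extChartAt (𝓡 n) x₀).source) :
    Function.Bijective (coordDeriv (extChartAt (𝓡 n) x₀) x) :=
  (isInvertible_mfderiv_extChartAt (I := 𝓡 n) hx).bijective

variable [RiemannianBundle (fun x : M => TangentSpace (𝓡 n) x)] {f : M → M}

theorem IsRiemannianMap.fderiv_chartMap_apply (hf : IsRiemannianMap n f) {x₀ x₁ x : M}
    (hx : x ∈ (extChartAt (𝓡 n) x₀).source) (hfx : f x ∈ (extChartAt (𝓡 n) x₁).source)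
    (u : EuclideanSpace ℝ (Fin n)) :
    fderiv ℝ (chartMap f x₀ x₁) (extChartAt (𝓡 n) x₀ x) (coordDeriv (extChartAt (𝓡 n) x₀) x u) =
      coordDeriv (extChartAt (𝓡 n) x₁) (f x) (tangentOp f x u) := by
  have hl : (extChartAt (𝓡 n) x₀).symm (extChartAt (𝓡 n) x₀ x) = x :=
    (extChartAt (𝓡 n) x₀).left_inv hx
  have hF : MDifferentiableAt 𝓘(ℝ, EuclideanSpace ℝ (Fin n)) 𝓘(ℝ, EuclideanSpace ℝ (Fin n))
      (chartMap f x₀ x₁) (extChartAt (𝓡 n) x₀ x) :=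
    (hf.contDiffAt_chartMap ((extChartAt (𝓡 n) x₀).map_source hx)
      (by rwa [hl])).contMDiffAt.mdifferentiableAt (by simp)
  have hd : ∀ {y z : M}, y ∈ (extChartAt (𝓡 n) z).source →
      MDifferentiableAt (𝓡 n) 𝓘(ℝ, EuclideanSpace ℝ (Fin n)) (extChartAt (𝓡 n) z) y := fun h =>
    mdifferentiableAt_extChartAt (by rwa [extChartAt_source] at h)
  have h1 := hF.hasMFDerivAt.comp x (hd hx).hasMFDerivAt
  have h2 := (hd hfx).hasMFDerivAt.comp x
    (hf.contMDiff.mdifferentiableAt (x := x) (by simp)).hasMFDerivAt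
  have h3 : (extChartAt (𝓡 n) x₁ ∘ f) =ᶠ[𝓝 x] (chartMap f x₀ x₁ ∘ extChartAt (𝓡 n) x₀) := by
    filter_upwards [(isOpen_extChartAt_source x₀).mem_nhds hx] with y hy
    simp only [Function.comp, chartMap, (extChartAt (𝓡 n) x₀).left_inv hy]
  have h4 := hasMFDerivAt_unique h1 (h2.congr_of_eventuallyEq h3.symm)
  rw [← mfderiv_eq_fderiv]
  exact congrArg (fun D : EuclideanSpace ℝ (Fin n) →L[ℝ] EuclideanSpace ℝ (Fin n) => D u) h4

/-- A chart of `M` in which the fixed set of `f` is the linear subspace `V`. -/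
structure IsSliceChart (f : M → M) (Θ : OpenPartialHomeomorph M (EuclideanSpace ℝ (Fin n)))
    (V : Submodule ℝ (EuclideanSpace ℝ (Fin n))) : Prop where
  mem_maximalAtlas : Θ ∈ IsManifold.maximalAtlas (𝓡 n) ∞ M
  fixed_iff : ∀ y ∈ Θ.source, f y = y ↔ Θ y ∈ V
  tangent_iff : ∀ y ∈ Θ.source, f y = y → ∀ u, tangentOp f y u = u ↔ coordDeriv Θ y u ∈ V

omit [IsManifold (𝓡 n) ∞ M] [RiemannianBundle (fun x : M => TangentSpace (𝓡 n) x)] in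
theorem coordDeriv_bijective {Θ : OpenPartialHomeomorph M (EuclideanSpace ℝ (Fin n))}
    (h : Θ ∈ IsManifold.maximalAtlas (𝓡 n) ∞ M) {y : M} (hy : y ∈ Θ.source) :
    Function.Bijective (coordDeriv Θ y) :=
  OpenPartialHomeomorph.MDifferentiable.mfderiv_bijective
    ⟨(contMDiffOn_of_mem_maximalAtlas h).mdifferentiableOn (by simp),
      (contMDiffOn_symm_of_mem_maximalAtlas h).mdifferentiableOn (by simp)⟩ hy

variable [IsContMDiffRiemannianBundle (𝓡 n) ∞ (EuclideanSpace ℝ (Fin n))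
      (fun x : M => TangentSpace (𝓡 n) x)]

/-- The preferred chart is followed by the coordinate change of `IsMetricOn.exists_slice`, over the
points whose image under `f` is still in the chart domain. -/
theorem IsRiemannianMap.exists_isSliceChart (hf : IsRiemannianMap n f) {x : M} (hx : f x = x) :
    ∃ (Θ : OpenPartialHomeomorph M (EuclideanSpace ℝ (Fin n)))
      (V : Submodule ℝ (EuclideanSpace ℝ (Fin n))), x ∈ Θ.source ∧ IsSliceChart f Θ V := by
  set φ := extChartAt (𝓡 n) x with hφ
  set p := φ x
  have hxs : x ∈ φ.source := mem_extChartAt_source x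
  have hcont : ContinuousOn (fun y => f (φ.symm y)) φ.target :=
    hf.contMDiff.continuous.comp_continuousOn (continuousOn_extChartAt_symm x)
  have hUo : IsOpen (φ.target ∩ (fun y => f (φ.symm y)) ⁻¹' φ.source) :=
    hcont.isOpen_inter_preimage (isOpen_extChartAt_target x) (isOpen_extChartAt_source x)
  set U := φ.target ∩ (fun y => f (φ.symm y)) ⁻¹' φ.source
  have hG := isMetricOn_chartForm (n := n) x
  have hGU : IsMetricOn (chartForm (n := n) x) U :=
    ⟨hUo, hG.contDiffOn.mono inter_subset_left, fun y hy => hG.symm y hy.1,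
      fun y hy => hG.pos y hy.1⟩
  have hpx : φ.symm p = x := φ.left_inv hxs
  have hpU : p ∈ U := ⟨φ.map_source hxs, by
    change f (φ.symm p) ∈ φ.source
    rw [hpx, hx]
    exact hxs⟩
  have hFp : chartMap f x x p = p := by
    change φ (f (φ.symm p)) = p
    rw [hpx, hx]
  obtain ⟨Ψ, hpΨ, hΨU, hΨs, hΨt, hfix, htan⟩ := hGU.exists_slice (F := chartMap f x x) hpU
    (fun y hy => (hf.contDiffAt_chartMap hy.1 hy.2).contDiffWithinAt) hFp
    (fun y hy _ => hf.isMetricMapAt_chartMap hy.1 hy.2)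
  set A := fderiv ℝ (chartMap f x x) p
  let V : Submodule ℝ (EuclideanSpace ℝ (Fin n)) :=
    LinearMap.ker (A - ContinuousLinearMap.id ℝ _).toLinearMap
  have hV : ∀ w, w ∈ V ↔ A w = w := fun w => by
    change A w - w = 0 ↔ _
    rw [sub_eq_zero]
  let Θ : OpenPartialHomeomorph M (EuclideanSpace ℝ (Fin n)) :=
    (chartAt (EuclideanSpace ℝ (Fin n)) x).trans Ψ
  have hφc : ∀ y, chartAt (EuclideanSpace ℝ (Fin n)) x y = φ y := fun y => by simp [hφ, extChartAt]
  have hφs : φ.source = (chartAt (EuclideanSpace ℝ (Fin n)) x).source :=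
    extChartAt_source (I := 𝓡 n) x
  have hsrc : ∀ y ∈ Θ.source, y ∈ φ.source ∧ φ y ∈ Ψ.source := by
    intro y hy
    rw [OpenPartialHomeomorph.trans_source] at hy
    exact ⟨by rw [hφs]; exact hy.1, by rw [← hφc]; exact hy.2⟩
  have hΘ : ∀ y, Θ y = Ψ (φ y) := fun y => by rw [← hφc]; rfl
  have hffix : ∀ y ∈ Θ.source, f y = y ↔ chartMap f x x (φ y) = φ y := by
    intro y hy
    obtain ⟨h1, h2⟩ := hsrc y hy
    have h3 := (hΨU h2).2
    simp only [mem_preimage] at h3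
    change _ ↔ φ (f (φ.symm (φ y))) = φ y
    rw [φ.left_inv h1] at h3 ⊢
    exact ⟨fun h => by rw [h], fun h => φ.injOn h3 h1 h⟩
  refine ⟨Θ, V, ?_, ?_, ?_, ?_⟩
  · rw [OpenPartialHomeomorph.trans_source]
    refine ⟨mem_chart_source _ x, ?_⟩
    simp only [mem_preimage, hφc]
    exact hpΨ
  · refine Θ.mem_maximalAtlas_of_contMDiffOn ?_ ?_
    · exact hΨs.contMDiffOn.comp ((contMDiffOn_chart (I := 𝓡 n) (n := ∞) (x := x)).mono
        (fun y hy => (hφs ▸ (hsrc y hy).1 : _)))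
        (fun y hy => by have := (hsrc y hy).2; rwa [← hφc] at this)
    · rw [OpenPartialHomeomorph.trans_target]
      exact (contMDiffOn_chart_symm (I := 𝓡 n) (n := ∞) (x := x)).comp
        (hΨt.contMDiffOn.mono inter_subset_left) (fun y hy => hy.2)
  · intro y hy
    rw [hffix y hy, hfix _ (hsrc y hy).2, hV, hΘ]
  · intro y hy hfy u
    obtain ⟨h1, h2⟩ := hsrc y hy
    have hF := (hffix y hy).1 hfy
    have h3 := hf.fderiv_chartMap_apply (x₀ := x) (x₁ := x) h1 (by rw [hfy]; exact h1) u
    have h4 : coordDeriv Θ y u = fderiv ℝ Ψ (φ y) (coordDeriv φ y u) := by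
      have h5 : HasMFDerivAt 𝓘(ℝ, EuclideanSpace ℝ (Fin n)) 𝓘(ℝ, EuclideanSpace ℝ (Fin n)) Ψ (φ y)
          (fderiv ℝ Ψ (φ y)) :=
        ((hΨs.contDiffAt (Ψ.open_source.mem_nhds h2)).differentiableAt
          (by simp)).hasFDerivAt.hasMFDerivAt
      have h6 := (mdifferentiableAt_extChartAt (I := 𝓡 n) (x := x) (y := y)
        (by rwa [← hφs])).hasMFDerivAt
      have h7 := (h5.comp y h6).mfderiv
      have h8 : (Θ : M → EuclideanSpace ℝ (Fin n)) = Ψ ∘ φ := funext hΘ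
      rw [h8]
      exact congrArg (fun D : EuclideanSpace ℝ (Fin n) →L[ℝ] EuclideanSpace ℝ (Fin n) => D u) h7
    rw [h4, hV, ← htan _ h2 hF, h3, hfy]
    exact ⟨fun h => by rw [h], fun h => (coordDeriv_extChartAt_bijective h1).1 h⟩

/-- **Rigidity.** An isometry which fixes a point, and whose differential there is the identity, is
the identity. -/
theorem IsRiemannianMap.eq_id [T2Space M] [PreconnectedSpace M] (hf : IsRiemannianMap n f) {x : M}
    (hx : f x = x) (hd : ∀ u, tangentOp (n := n) f x u = u) (y : M) : f y = y := by
  have key : ∀ (Θ : OpenPartialHomeomorph M (EuclideanSpace ℝ (Fin n)))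
      (V : Submodule ℝ (EuclideanSpace ℝ (Fin n))) (_ : IsSliceChart f Θ V) (_ : V = ⊤),
      Θ.source ⊆ interior {z | f z = z} := by
    intro Θ V h hV
    refine interior_maximal (fun z hz => (h.fixed_iff z hz).2 ?_) Θ.open_source
    rw [hV]
    trivial
  -- At a limit point of the interior, a slice chart contains an open set of fixed points, so its
  -- subspace `V` has nonempty interior and is everything.
  have hclopen : IsClopen (interior {z | f z = z}) := by
    refine ⟨isClosed_of_closure_subset fun z hz => ?_, isOpen_interior⟩
    have hzf : f z = z := by
      have : IsClosed {z | f z = z} := isClosed_eq hf.contMDiff.continuous continuous_id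
      exact closure_minimal interior_subset this hz
    obtain ⟨Θ, V, hzΘ, h⟩ := hf.exists_isSliceChart hzf
    refine key Θ V h ?_ hzΘ
    obtain ⟨w, hwΘ, hw⟩ := mem_closure_iff.1 hz _ Θ.open_source hzΘ
    refine Submodule.eq_top_of_nonempty_interior' V ⟨Θ w, ?_⟩
    rw [mem_interior]
    refine ⟨Θ '' (Θ.source ∩ interior {z | f z = z}), ?_,
      Θ.isOpen_image_of_subset_source (Θ.open_source.inter isOpen_interior) inter_subset_left,
      mem_image_of_mem _ ⟨hwΘ, hw⟩⟩
    rintro _ ⟨q, ⟨hq1, hq2⟩, rfl⟩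
    exact (h.fixed_iff q hq1).1 (interior_subset (s := {z | f z = z}) hq2)
  obtain ⟨Θ, V, hxΘ, h⟩ := hf.exists_isSliceChart hx
  have hV : V = ⊤ := by
    rw [eq_top_iff]
    intro w _
    obtain ⟨u, rfl⟩ := (coordDeriv_bijective h.mem_maximalAtlas hxΘ).2 w
    exact (h.tangent_iff x hxΘ hx u).1 (hd u)
  have huniv := hclopen.eq_univ ⟨x, key Θ V h hV hxΘ⟩
  exact interior_subset (s := {z | f z = z}) (huniv ▸ mem_univ y)

omit [IsContMDiffRiemannianBundle (𝓡 n) ∞ (EuclideanSpace ℝ (Fin n))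
      (fun x : M => TangentSpace (𝓡 n) x)] in
theorem IsGeodesicOn.contDiffAt_extChartAt {γ : ℝ → M} {J : Set ℝ} (hγ : IsGeodesicOn (n := n) γ J)
    (hJ : IsOpen J) {t : ℝ} (ht : t ∈ J) {x : M} (hx : γ t ∈ (extChartAt (𝓡 n) x).source) :
    ContDiffAt ℝ ∞ (fun s => extChartAt (𝓡 n) x (γ s)) t := by
  rw [← contMDiffAt_iff_contDiffAt]
  exact (contMDiffAt_extChartAt' (I := 𝓡 n) (n := ∞) (by rwa [extChartAt_source] at hx)).comp t
    (hγ.1.contMDiffAt (hJ.mem_nhds ht))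

/-- The coordinates and velocity of a geodesic are an integral curve of the geodesic spray. -/
theorem IsGeodesicOn.hasDerivAt_spray {γ : ℝ → M} {J : Set ℝ} (hγ : IsGeodesicOn (n := n) γ J)
    (hJ : IsOpen J) {t : ℝ} (ht : t ∈ J) {x : M} (hx : γ t ∈ (extChartAt (𝓡 n) x).source) :
    HasDerivAt (fun s => (extChartAt (𝓡 n) x (γ s), deriv (fun s => extChartAt (𝓡 n) x (γ s)) s))
      (spray (chartForm (n := n) x)
        (extChartAt (𝓡 n) x (γ t), deriv (fun s => extChartAt (𝓡 n) x (γ s)) t)) t := by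
  set x' := γ t with hx'
  set c : ℝ → EuclideanSpace ℝ (Fin n) := fun s => extChartAt (𝓡 n) x' (γ s) with hc
  -- The geodesic equation at time `t` is given only in the chart around `γ t`. The change `F` to
  -- the chart around `x` is an isometry of the chart metrics, hence respects sprays.
  set F := chartMap (n := n) (id : M → M) x' x with hF
  have hsrc : x' ∈ (extChartAt (𝓡 n) x').source := mem_extChartAt_source x'
  have hcs : ContDiffAt ℝ ∞ c t := hγ.contDiffAt_extChartAt hJ ht (by rw [← hx']; exact hsrc)
  have htgt : c t ∈ (extChartAt (𝓡 n) x').target := (extChartAt (𝓡 n) x').map_source hsrc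
  have hl : (extChartAt (𝓡 n) x').symm (c t) = x' := (extChartAt (𝓡 n) x').left_inv hsrc
  have hmem : id ((extChartAt (𝓡 n) x').symm (c t)) ∈ (extChartAt (𝓡 n) x).source := by
    rw [hl]; exact hx
  -- the curve in the preferred chart around `γ t` satisfies the spray equation at `t`
  have h1 : HasDerivAt (fun s => (c s, deriv c s)) (spray (chartForm (n := n) x') (c t, deriv c t))
      t := by
    have hd1 : HasDerivAt c (deriv c t) t := (hcs.differentiableAt (by simp)).hasDerivAt
    have hd2 : HasDerivAt (deriv c) (deriv (deriv c) t) t :=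
      (((hcs.fderiv_right (m := ∞) (by simp)).clm_apply
        (contDiffAt_const (c := (1 : ℝ)))).differentiableAt (by simp)).hasDerivAt
    have hq : (spray (chartForm (n := n) x') (c t, deriv c t)).2 = deriv (deriv c) t := by
      rw [spray_snd_eq_iff ((isMetricOn_chartForm x').pos _ htgt)]
      ext w
      have := hγ.2 t ht w
      rw [christoffel_eq _ htgt] at this
      exact this
    rw [← Prod.mk.eta (p := spray (chartForm (n := n) x') (c t, deriv c t)), hq]
    exact hd1.prodMk hd2
  have hFs : ∀ᶠ y in 𝓝 (c t), DifferentiableAt ℝ F y := by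
    have hcont : ContinuousOn (extChartAt (𝓡 n) x').symm (extChartAt (𝓡 n) x').target :=
      continuousOn_extChartAt_symm x'
    filter_upwards [(hcont.isOpen_inter_preimage (isOpen_extChartAt_target x')
      (isOpen_extChartAt_source x)).mem_nhds ⟨htgt, hmem⟩] with y hy
    exact (IsRiemannianMap.id.contDiffAt_chartMap (n := n) hy.1 hy.2).differentiableAt (by simp)
  obtain ⟨h2, h3⟩ := (isMetricOn_chartForm x').fderiv_spray_eq (isMetricOn_chartForm x) (F := F)
    (z := (c t, deriv c t)) htgt ((extChartAt (𝓡 n) x).map_source hmem)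
    (IsRiemannianMap.id.contDiffAt_chartMap htgt hmem)
    (IsRiemannianMap.id.isMetricMapAt_chartMap htgt hmem)
  have h4 := h2.comp_hasDerivAt t h1
  rw [h3] at h4
  have hγc : ContinuousAt γ t := (hγ.1.contMDiffAt (hJ.mem_nhds ht)).continuousAt
  have hev : ∀ᶠ s in 𝓝 t, extChartAt (𝓡 n) x (γ s) = F (c s) := by
    filter_upwards [hγc.eventually_mem ((isOpen_extChartAt_source (I := 𝓡 n) x').mem_nhds hsrc)]
      with s hs
    simp only [hF, hc, chartMap, id, (extChartAt (𝓡 n) x').left_inv hs]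
  have hev2 : ∀ᶠ s in 𝓝 t, (extChartAt (𝓡 n) x (γ s), deriv (fun s => extChartAt (𝓡 n) x (γ s)) s) =
      vectorTangentMap F (c s, deriv c s) := by
    filter_upwards [hev.eventually_nhds, hcs.continuousAt.eventually hFs,
      (hcs.of_le (m := 1) (by simp)).eventually (by simp)] with s hs1 hs2 hs3
    have h5 : HasDerivAt (fun s => F (c s)) (fderiv ℝ F (c s) (deriv c s)) s :=
      hs2.hasFDerivAt.comp_hasDerivAt s (hs3.differentiableAt (by simp)).hasDerivAt
    rw [vectorTangentMap, hs1.self_of_nhds, Filter.EventuallyEq.deriv_eq hs1, h5.deriv]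
  have h6 := h4.congr_of_eventuallyEq hev2
  have h7 := hev2.self_of_nhds
  rw [h7]
  exact h6

/-- A geodesic which starts at a fixed point of an isometry in a fixed direction consists of fixed
points, for a short time. -/
theorem IsRiemannianMap.eventually_fixed_geodesic (hf : IsRiemannianMap n f) {γ : ℝ → M} {J : Set ℝ}
    (hγ : IsGeodesicOn (n := n) γ J) (hJ : IsOpen J) (h0 : (0 : ℝ) ∈ J) (hfix : f (γ 0) = γ 0)
    (hv : tangentOp (n := n) f (γ 0) (mfderiv 𝓘(ℝ, ℝ) (𝓡 n) γ 0 (1 : ℝ)) =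
      mfderiv 𝓘(ℝ, ℝ) (𝓡 n) γ 0 (1 : ℝ)) :
    ∀ᶠ t in 𝓝 (0 : ℝ), f (γ t) = γ t := by
  set x := γ 0 with hx
  set c : ℝ → EuclideanSpace ℝ (Fin n) := fun s => extChartAt (𝓡 n) x (γ s) with hc
  set F := chartMap (n := n) f x x with hF
  have hsrc : x ∈ (extChartAt (𝓡 n) x).source := mem_extChartAt_source x
  have hγm : ∀ t ∈ J, ContMDiffAt 𝓘(ℝ, ℝ) (𝓡 n) ∞ γ t := fun t ht =>
    hγ.1.contMDiffAt (hJ.mem_nhds ht)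
  have hγc : ContinuousAt γ 0 := (hγm 0 h0).continuousAt
  have hfγc : ContinuousAt (fun s => f (γ s)) 0 := hf.contMDiff.continuous.continuousAt.comp hγc
  have hgood : ∀ᶠ s in 𝓝 (0 : ℝ), s ∈ J ∧ γ s ∈ (extChartAt (𝓡 n) x).source ∧
      f (γ s) ∈ (extChartAt (𝓡 n) x).source := by
    filter_upwards [hJ.mem_nhds h0,
      hγc.eventually_mem ((isOpen_extChartAt_source (I := 𝓡 n) x).mem_nhds hsrc),
      hfγc.eventually_mem ((isOpen_extChartAt_source (I := 𝓡 n) x).mem_nhds (by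
        rw [← hx, hfix]; exact hsrc))] with s h1 h2 h3
    exact ⟨h1, h2, h3⟩
  have hz : ∀ᶠ s in 𝓝 (0 : ℝ), HasDerivAt (fun s => (c s, deriv c s))
      (spray (chartForm (n := n) x) (c s, deriv c s)) s := by
    filter_upwards [hgood] with s hs using hγ.hasDerivAt_spray hJ hs.1 hs.2.1
  -- The curve `f ∘ γ` with its velocity is a second integral curve of the spray, and `hfix` and
  -- `hv` give it the same initial value.
  have hz' : ∀ᶠ s in 𝓝 (0 : ℝ), HasDerivAt (fun s => vectorTangentMap F (c s, deriv c s))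
      (spray (chartForm (n := n) x) (vectorTangentMap F (c s, deriv c s))) s := by
    filter_upwards [hgood, hz] with s hs hzs
    have htgt : c s ∈ (extChartAt (𝓡 n) x).target := (extChartAt (𝓡 n) x).map_source hs.2.1
    have hmem : f ((extChartAt (𝓡 n) x).symm (c s)) ∈ (extChartAt (𝓡 n) x).source := by
      rw [hc, (extChartAt (𝓡 n) x).left_inv hs.2.1]
      exact hs.2.2
    obtain ⟨h2, h3⟩ := (isMetricOn_chartForm x).fderiv_spray_eq (isMetricOn_chartForm x) (F := F)
      (z := (c s, deriv c s)) htgt ((extChartAt (𝓡 n) x).map_source hmem)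
      (hf.contDiffAt_chartMap htgt hmem) (hf.isMetricMapAt_chartMap htgt hmem)
    rw [← h3]
    exact h2.comp_hasDerivAt s hzs
  have hvel : deriv c 0 =
      coordDeriv (extChartAt (𝓡 n) x) x (mfderiv 𝓘(ℝ, ℝ) (𝓡 n) γ 0 (1 : ℝ)) := by
    have h1 : HasMFDerivAt 𝓘(ℝ, ℝ) 𝓘(ℝ, EuclideanSpace ℝ (Fin n)) c 0 _ :=
      ((mdifferentiableAt_extChartAt (I := 𝓡 n) (mem_chart_source _ x)).hasMFDerivAt).comp
        (0 : ℝ) ((hγm 0 h0).mdifferentiableAt (by simp)).hasMFDerivAt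
    have h2 : HasFDerivAt c
      (coordDeriv (extChartAt (𝓡 n) x) x ∘L (mfderiv 𝓘(ℝ, ℝ) (𝓡 n) γ 0 :
        ℝ →L[ℝ] EuclideanSpace ℝ (Fin n))) 0 := hasMFDerivAt_iff_hasFDerivAt.1 h1
    exact h2.hasDerivAt.deriv
  have heq : (c 0, deriv c 0) = vectorTangentMap F (c 0, deriv c 0) := by
    have h1 := hf.fderiv_chartMap_apply (x₀ := x) (x₁ := x) (x := x) hsrc (by rw [hfix]; exact hsrc)
      (mfderiv 𝓘(ℝ, ℝ) (𝓡 n) γ 0 (1 : ℝ))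
    rw [hfix, hv] at h1
    rw [hvel]
    refine Prod.ext ?_ h1.symm
    change extChartAt (𝓡 n) x x = extChartAt (𝓡 n) x (f ((extChartAt (𝓡 n) x).symm _))
    rw [show (extChartAt (𝓡 n) x).symm (c 0) = x from (extChartAt (𝓡 n) x).left_inv hsrc, hfix]
  have hfin := (isMetricOn_chartForm (n := n) x).eventuallyEq_of_spray (t := 0)
    (by exact (extChartAt (𝓡 n) x).map_source hsrc) hz hz' heq
  filter_upwards [hfin, hgood] with s hs hs'
  have h1 : c s = F (c s) := congrArg Prod.fst hs
  have h2 : F (c s) = extChartAt (𝓡 n) x (f (γ s)) := by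
    simp only [hF, hc, chartMap, (extChartAt (𝓡 n) x).left_inv hs'.2.1]
  exact ((extChartAt (𝓡 n) x).injOn hs'.2.1 hs'.2.2 (h1.trans h2)).symm

end Slice

/-! ### Embedded submanifolds from slice charts -/

section SliceSubmanifold

variable {n d : ℕ} {F : Type} [NormedAddCommGroup F] [NormedSpace ℝ F] {M : Type*}
  [TopologicalSpace M] {C : Set M}

/-- The chart of `C` induced by a chart `Θ` of `M` in which `C` is a linear subspace. -/
noncomputable def sliceChart (Θ : OpenPartialHomeomorph M (EuclideanSpace ℝ (Fin n)))
    (L : (EuclideanSpace ℝ (Fin d) × F) ≃L[ℝ] EuclideanSpace ℝ (Fin n))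
    (h : ∀ y ∈ Θ.source, y ∈ C ↔ (L.symm (Θ y)).2 = 0) (x₀ : C) :
    OpenPartialHomeomorph C (EuclideanSpace ℝ (Fin d)) := by
  classical
  have hmem : ∀ u : EuclideanSpace ℝ (Fin d), L (u, 0) ∈ Θ.target → Θ.symm (L (u, 0)) ∈ C :=
    fun u hu => (h _ (Θ.map_target hu)).2 (by rw [Θ.right_inv hu]; simp)
  have hLc : Continuous fun u : EuclideanSpace ℝ (Fin d) => L (u, 0) :=
    L.continuous.comp (continuous_id.prodMk continuous_const)
  have hpair : ∀ c : C, (c : M) ∈ Θ.source → L ((L.symm (Θ c)).1, 0) = Θ c := by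
    intro c hc
    have h2 := (h c hc).1 c.2
    rw [← h2, Prod.mk.eta, L.apply_symm_apply]
  exact
  { toFun := fun c => (L.symm (Θ c)).1
    -- The value `x₀` is a default off the target, where the inverse is irrelevant.
    invFun := fun u => if hu : L (u, 0) ∈ Θ.target then ⟨Θ.symm (L (u, 0)), hmem u hu⟩ else x₀
    source := Subtype.val ⁻¹' Θ.source
    target := (fun u => L (u, 0)) ⁻¹' Θ.target
    map_source' := fun c hc => by
      change L ((L.symm (Θ c)).1, 0) ∈ Θ.target
      rw [hpair c hc]
      exact Θ.map_source hc
    map_target' := fun u hu => by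
      have hu' : L (u, 0) ∈ Θ.target := hu
      rw [dif_pos hu']
      exact Θ.map_target hu'
    left_inv' := fun c hc => by
      have h1 := hpair c hc
      have h2 : L ((L.symm (Θ c)).1, 0) ∈ Θ.target := by rw [h1]; exact Θ.map_source hc
      rw [dif_pos h2]
      ext1
      change Θ.symm (L ((L.symm (Θ c)).1, 0)) = c
      rw [h1, Θ.left_inv hc]
    right_inv' := fun u hu => by
      have hu' : L (u, 0) ∈ Θ.target := hu
      simp only [dif_pos hu', Θ.right_inv hu', L.symm_apply_apply]
    open_source := Θ.open_source.preimage continuous_subtype_val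
    open_target := Θ.open_target.preimage hLc
    continuousOn_toFun := by
      have h1 : ContinuousOn (fun c : C => Θ c) (Subtype.val ⁻¹' Θ.source) :=
        Θ.continuousOn.comp continuous_subtype_val.continuousOn fun c hc => hc
      exact (continuous_fst.comp L.symm.continuous).comp_continuousOn h1
    continuousOn_invFun := by
      rw [IsInducing.subtypeVal.continuousOn_iff]
      refine (Θ.continuousOn_symm.comp hLc.continuousOn fun u hu => hu).congr fun u hu => ?_
      have hu' : L (u, 0) ∈ Θ.target := hu
      simp only [Function.comp, dif_pos hu'] }

section

variable (Θ : OpenPartialHomeomorph M (EuclideanSpace ℝ (Fin n)))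
    (L : (EuclideanSpace ℝ (Fin d) × F) ≃L[ℝ] EuclideanSpace ℝ (Fin n))
    (h : ∀ y ∈ Θ.source, y ∈ C ↔ (L.symm (Θ y)).2 = 0) (x₀ : C)

theorem coe_sliceChart_symm_apply {u : EuclideanSpace ℝ (Fin d)} (hu : L (u, 0) ∈ Θ.target) :
    ((sliceChart Θ L h x₀).symm u : M) = Θ.symm (L (u, 0)) := by
  exact congrArg Subtype.val (dif_pos hu)

end

variable [ChartedSpace (EuclideanSpace ℝ (Fin n)) M]

/-- In these charts a transition map is one of `M` preceded by `u ↦ L (u, 0)` and followed by a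
linear projection, and the inclusion is exactly `u ↦ L (u, 0)`, the normal form of an immersion. -/
theorem exists_embeddedSubmanifold
    (h : ∀ x : C, ∃ Θ ∈ IsManifold.maximalAtlas (𝓡 n) ∞ M,
      ∃ L : (EuclideanSpace ℝ (Fin d) × F) ≃L[ℝ] EuclideanSpace ℝ (Fin n), (x : M) ∈ Θ.source ∧
        ∀ y ∈ Θ.source, y ∈ C ↔ (L.symm (Θ y)).2 = 0) :
    Nonempty (EmbeddedSubmanifold (n := n) d C) := by
  choose Θ hΘ L hx hC using h
  let e : C → OpenPartialHomeomorph C (EuclideanSpace ℝ (Fin d)) := fun x =>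
    sliceChart (Θ x) (L x) (hC x) x
  let cs : ChartedSpace (EuclideanSpace ℝ (Fin d)) C :=
    { atlas := range e
      chartAt := e
      mem_chart_source := fun x => hx x
      chart_mem_atlas := fun x => mem_range_self x }
  let := cs
  have hman : IsManifold (𝓡 d) ∞ C := by
    refine isManifold_of_contDiffOn (𝓡 d) ∞ C ?_
    rintro _ _ ⟨x, rfl⟩ ⟨x', rfl⟩
    have h1 : ContMDiffOn 𝓘(ℝ, EuclideanSpace ℝ (Fin n)) 𝓘(ℝ, EuclideanSpace ℝ (Fin n)) ∞
        (Θ x' ∘ (Θ x).symm) ((Θ x).target ∩ (Θ x).symm ⁻¹' (Θ x').source) :=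
      (contMDiffOn_of_mem_maximalAtlas (hΘ x')).comp
        ((contMDiffOn_symm_of_mem_maximalAtlas (hΘ x)).mono inter_subset_left)
        fun y hy => hy.2
    have h2 := h1.contDiffOn
    have h3 : ContDiff ℝ ∞ fun u : EuclideanSpace ℝ (Fin d) => L x (u, (0 : F)) :=
      (L x).contDiff.comp (contDiff_id.prodMk contDiff_const)
    have h4 : ContDiff ℝ ∞ fun z : EuclideanSpace ℝ (Fin n) => ((L x').symm z).1 :=
      contDiff_fst.comp (L x').symm.contDiff
    have h5 := h4.comp_contDiffOn (h2.comp h3.contDiffOn (s := (e x).target ∩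
      (e x).symm ⁻¹' (e x').source) fun u hu => ?_)
    · refine (h5.congr fun u hu => ?_).mono ?_
      · have hu' : L x (u, 0) ∈ (Θ x).target := hu.1
        change ((L x').symm (Θ x' ((e x).symm u))).1 = _
        rw [coe_sliceChart_symm_apply _ _ _ _ hu']
        rfl
      · intro u hu
        simpa [OpenPartialHomeomorph.trans_source] using hu
    · have hu' : L x (u, 0) ∈ (Θ x).target := hu.1
      refine ⟨hu', ?_⟩
      have := hu.2
      change ((e x).symm u : M) ∈ (Θ x').source at this
      rwa [coe_sliceChart_symm_apply _ _ _ _ hu'] at this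
  refine ⟨⟨cs, hman, ⟨?_, IsEmbedding.subtypeVal⟩⟩⟩
  refine IsImmersionOfComplement.isImmersion (F := F) fun x => ?_
  refine IsImmersionAtOfComplement.mk_of_continuousAt continuous_subtype_val.continuousAt (L x)
    (e x) (Θ x) (hx x) (hx x) ?_ (hΘ x) ?_
  · exact IsManifold.subset_maximalAtlas (mem_range_self x)
  · intro u hu
    have hu' : u ∈ (e x).target := by
      simpa [OpenPartialHomeomorph.extend_target] using hu
    have h1 : ((e x).symm u : M) = (Θ x).symm (L x (u, 0)) := coe_sliceChart_symm_apply _ _ _ _ hu'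
    change Θ x ((e x).symm u) = L x (u, 0)
    rw [h1, (Θ x).right_inv hu']

/-- A linear subspace of dimension `d` is a coordinate subspace in suitable linear coordinates. -/
theorem exists_equiv_prod (V : Submodule ℝ (EuclideanSpace ℝ (Fin n)))
    (hV : Module.finrank ℝ V = d) :
    ∃ L : (EuclideanSpace ℝ (Fin d) × EuclideanSpace ℝ (Fin (n - d))) ≃L[ℝ]
      EuclideanSpace ℝ (Fin n), ∀ w, w ∈ V ↔ (L.symm w).2 = 0 := by
  have hV' : Module.finrank ℝ Vᗮ = n - d := by
    have := V.finrank_add_finrank_orthogonal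
    rw [hV, finrank_euclideanSpace_fin] at this
    omega
  let e1 : EuclideanSpace ℝ (Fin d) ≃ₗ[ℝ] V := LinearEquiv.ofFinrankEq _ _ (by simp [hV])
  let e2 : EuclideanSpace ℝ (Fin (n - d)) ≃ₗ[ℝ] Vᗮ := LinearEquiv.ofFinrankEq _ _ (by simp [hV'])
  let L := (e1.prodCongr e2).trans (V.prodEquivOfIsCompl Vᗮ (Submodule.isCompl_orthogonal V))
  refine ⟨L.toContinuousLinearEquiv, fun w => ?_⟩
  obtain ⟨⟨a, b⟩, rfl⟩ := L.surjective w
  have h1 : L.toContinuousLinearEquiv.symm (L (a, b)) = (a, b) := L.symm_apply_apply _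
  rw [h1]
  have h2 : L (a, b) = (e1 a : EuclideanSpace ℝ (Fin n)) + e2 b := rfl
  rw [h2, V.add_mem_iff_right (e1 a).2]
  constructor
  · intro h
    have h3 : (e2 b : EuclideanSpace ℝ (Fin n)) = 0 :=
      Submodule.disjoint_def.1 V.orthogonal_disjoint _ h (e2 b).2
    have h4 : e2 b = 0 := Subtype.ext h3
    exact e2.map_eq_zero_iff.1 h4
  · intro h
    have h' : b = 0 := h
    rw [h', map_zero]
    exact V.zero_mem

end SliceSubmanifold

/-! ### Tangent spaces of submanifolds of fixed points -/

section Tangent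

variable {n d : ℕ} {M : Type*} [TopologicalSpace M] [ChartedSpace (EuclideanSpace ℝ (Fin n)) M]
  {C : Set M}

namespace EmbeddedSubmanifold

/-- The differential of the inclusion of a submanifold. -/
noncomputable def inclDeriv (S : EmbeddedSubmanifold (n := n) d C) (x : C) :
    EuclideanSpace ℝ (Fin d) →L[ℝ] EuclideanSpace ℝ (Fin n) :=
  letI := S.chartedSpace
  mfderiv (𝓡 d) (𝓡 n) (Subtype.val : C → M) x

theorem mem_tangentSubspace (S : EmbeddedSubmanifold (n := n) d C) (x : C)
    (w : EuclideanSpace ℝ (Fin n)) : w ∈ S.tangentSubspace x ↔ ∃ u, S.inclDeriv x u = w := Iff.rfl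

/-- In suitable charts the inclusion is `u ↦ (u, 0)` up to a linear equivalence; the chain rule does
the rest. -/
theorem inclDeriv_injective (S : EmbeddedSubmanifold (n := n) d C) (x : C) :
    Function.Injective (S.inclDeriv x) := by
  let := S.chartedSpace
  have := S.isManifold
  have h := S.isSmoothEmbedding.isImmersion.isImmersionAt x
  set e := h.domChart
  set ψ := h.codChart
  have hxe : x ∈ e.source := h.mem_domChart_source
  have hxψ : (x : M) ∈ ψ.source := h.mem_codChart_source
  have he := h.domChart_mem_maximalAtlas
  have hψ := h.codChart_mem_maximalAtlas
  have hed : MDifferentiableAt (𝓡 d) (𝓡 d) e x :=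
    (contMDiffAt_of_mem_maximalAtlas he hxe).mdifferentiableAt (by simp)
  have hψd : MDifferentiableAt (𝓡 n) (𝓡 n) ψ x :=
    (contMDiffAt_of_mem_maximalAtlas hψ hxψ).mdifferentiableAt (by simp)
  have hι : MDifferentiableAt (𝓡 d) (𝓡 n) (Subtype.val : C → M) x :=
    S.isSmoothEmbedding.contMDiff.mdifferentiableAt (by simp)
  have heq : ψ ∘ (Subtype.val : C → M) =ᶠ[𝓝 x] (fun u => h.equiv (u, 0)) ∘ e := by
    filter_upwards [e.open_source.mem_nhds hxe] with y hy
    have hy' : e y ∈ (e.extend (𝓡 d)).target := by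
      simpa [OpenPartialHomeomorph.extend_target] using e.map_source hy
    have h1 := h.writtenInCharts hy'
    have h2 : (e.extend (𝓡 d)).symm (e y) = y := by
      simpa using e.left_inv hy
    simp only [Function.comp] at h1
    rw [h2] at h1
    exact h1
  have hLd : HasFDerivAt (fun u : EuclideanSpace ℝ (Fin d) => h.equiv (u, 0))
      (h.equiv.toContinuousLinearMap ∘L
        ContinuousLinearMap.inl ℝ (EuclideanSpace ℝ (Fin d)) h.complement) (e x) :=
    (h.equiv.toContinuousLinearMap ∘L
      ContinuousLinearMap.inl ℝ (EuclideanSpace ℝ (Fin d)) h.complement).hasFDerivAt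
  have h3 := hψd.hasMFDerivAt.comp x hι.hasMFDerivAt
  have h4 := (hLd.hasMFDerivAt).comp x hed.hasMFDerivAt
  have h5 := hasMFDerivAt_unique h3 (h4.congr_of_eventuallyEq heq)
  have hinj : Function.Injective (mfderiv (𝓡 d) (𝓡 d) e x) :=
    OpenPartialHomeomorph.MDifferentiable.mfderiv_injective
      ⟨(contMDiffOn_of_mem_maximalAtlas he).mdifferentiableOn (by simp),
        (contMDiffOn_symm_of_mem_maximalAtlas he).mdifferentiableOn (by simp)⟩ hxe
  intro u v huv
  have h6 : ∀ w : EuclideanSpace ℝ (Fin d),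
      (mfderiv (𝓡 n) (𝓡 n) ψ x (S.inclDeriv x w) : EuclideanSpace ℝ (Fin n)) =
      h.equiv ((mfderiv (𝓡 d) (𝓡 d) e x w : EuclideanSpace ℝ (Fin d)), 0) := fun w =>
    congrArg (fun D : EuclideanSpace ℝ (Fin d) →L[ℝ] EuclideanSpace ℝ (Fin n) => D w) h5
  have h7 : h.equiv ((mfderiv (𝓡 d) (𝓡 d) e x u : EuclideanSpace ℝ (Fin d)), 0) =
      h.equiv ((mfderiv (𝓡 d) (𝓡 d) e x v : EuclideanSpace ℝ (Fin d)), 0) := by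
    rw [← h6, ← h6, huv]
  exact hinj (congrArg Prod.fst (h.equiv.injective h7))

end EmbeddedSubmanifold

/-- The fixed vectors of the differential. -/
noncomputable def fixedVectors (f : M → M) (x : M) : Submodule ℝ (EuclideanSpace ℝ (Fin n)) :=
  LinearMap.ker (tangentOp f x - ContinuousLinearMap.id ℝ _).toLinearMap

theorem mem_fixedVectors {f : M → M} {x : M} {u : EuclideanSpace ℝ (Fin n)} :
    u ∈ fixedVectors f x ↔ tangentOp f x u = u := by
  change tangentOp f x u - u = 0 ↔ _
  rw [sub_eq_zero]

variable {f : M → M}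

/-- The derivative of the chart maps the fixed vectors onto `V` at every fixed point of its domain,
so their dimension is locally constant along the fixed set. -/
theorem IsSliceChart.finrank_fixedVectors
    {Θ : OpenPartialHomeomorph M (EuclideanSpace ℝ (Fin n))}
    {V : Submodule ℝ (EuclideanSpace ℝ (Fin n))} (h : IsSliceChart f Θ V) {y : M}
    (hy : y ∈ Θ.source) (hfy : f y = y) :
    Module.finrank ℝ (fixedVectors (n := n) f y) = Module.finrank ℝ V := by
  have hb := coordDeriv_bijective h.mem_maximalAtlas hy
  let D : EuclideanSpace ℝ (Fin n) ≃ₗ[ℝ] EuclideanSpace ℝ (Fin n) :=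
    LinearEquiv.ofBijective (coordDeriv Θ y).toLinearMap hb
  have h1 : fixedVectors (n := n) f y = V.comap D.toLinearMap := by
    ext u
    rw [mem_fixedVectors, h.tangent_iff y hy hfy]
    rfl
  rw [h1]
  exact (D.submoduleMap (V.comap D.toLinearMap)).finrank_eq.trans
    (by rw [Submodule.map_comap_eq_of_surjective D.surjective])

namespace EmbeddedSubmanifold

theorem tangentOp_inclDeriv (S : EmbeddedSubmanifold (n := n) d C) (hf : ContMDiff (𝓡 n) (𝓡 n) ∞ f)
    (hC : ∀ y ∈ C, f y = y) (x : C) (u : EuclideanSpace ℝ (Fin d)) :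
    tangentOp f x (S.inclDeriv x u) = S.inclDeriv x u := by
  let := S.chartedSpace
  have := S.isManifold
  have hι : MDifferentiableAt (𝓡 d) (𝓡 n) (Subtype.val : C → M) x :=
    S.isSmoothEmbedding.contMDiff.mdifferentiableAt (by simp)
  have h1 := (hf.mdifferentiableAt (x := (x : M)) (by simp)).hasMFDerivAt.comp x hι.hasMFDerivAt
  have h2 : f ∘ (Subtype.val : C → M) = Subtype.val := funext fun c => hC c c.2
  rw [h2] at h1
  exact congrArg (fun D : EuclideanSpace ℝ (Fin d) →L[ℝ] EuclideanSpace ℝ (Fin n) => D u)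
    (hasMFDerivAt_unique h1 hι.hasMFDerivAt)

/-- The tangent space of a submanifold which is relatively open in the fixed set. -/
theorem exists_inclDeriv_eq (S : EmbeddedSubmanifold (n := n) d C) {x : C}
    {Θ : OpenPartialHomeomorph M (EuclideanSpace ℝ (Fin n))}
    {V : Submodule ℝ (EuclideanSpace ℝ (Fin n))} (h : IsSliceChart f Θ V) (hx : (x : M) ∈ Θ.source)
    (hfx : f x = x) (hC : ∀ᶠ y in 𝓝 (x : M), f y = y → y ∈ C)
    {w : EuclideanSpace ℝ (Fin n)} (hw : tangentOp f (x : M) w = w) :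
    ∃ u, S.inclDeriv x u = w := by
  classical
  let := S.chartedSpace
  have := S.isManifold
  set a := coordDeriv Θ x w with ha
  have haV : a ∈ V := (h.tangent_iff x hx hfx w).1 hw
  -- A straight line in the slice chart, in a direction of `V`, consists of fixed points and so lies
  -- in `C` near time `0`; its velocity there is `w`.
  set c : ℝ → M := fun t => Θ.symm (Θ x + t • a) with hc
  have hline : ContDiff ℝ ∞ (fun t : ℝ => Θ x + t • a) :=
    contDiff_const.add (contDiff_id.smul contDiff_const)
  have h0 : Θ x + (0 : ℝ) • a = Θ x := by simp
  have hc0 : c 0 = x := by simp only [hc, h0]; exact Θ.left_inv hx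
  have hsymm : ContMDiffAt 𝓘(ℝ, EuclideanSpace ℝ (Fin n)) (𝓡 n) ∞ Θ.symm (Θ x + (0 : ℝ) • a) := by
    rw [h0]
    exact contMDiffAt_symm_of_mem_maximalAtlas h.mem_maximalAtlas (Θ.map_source hx)
  have hcs : ContMDiffAt 𝓘(ℝ, ℝ) (𝓡 n) ∞ c 0 := hsymm.comp (0 : ℝ) hline.contMDiff.contMDiffAt
  have hcC : ∀ᶠ t in 𝓝 (0 : ℝ), c t ∈ C := by
    have h1 : ∀ᶠ t in 𝓝 (0 : ℝ), f (c t) = c t → c t ∈ C :=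
      hcs.continuousAt.eventually (by rw [hc0]; exact hC)
    have h2 : ∀ᶠ t in 𝓝 (0 : ℝ), Θ x + t • a ∈ Θ.target :=
      hline.continuous.continuousAt.eventually_mem
        (by rw [h0]; exact Θ.open_target.mem_nhds (Θ.map_source hx))
    filter_upwards [h1, h2] with t h1 h2
    refine h1 ((h.fixed_iff _ (Θ.map_target h2)).2 ?_)
    rw [Θ.right_inv h2]
    exact V.add_mem ((h.fixed_iff x hx).1 hfx) (V.smul_mem _ haV)
  let κ : ℝ → C := fun t => if ht : c t ∈ C then ⟨c t, ht⟩ else x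
  have hκ : ∀ t, c t ∈ C → (κ t : M) = c t := fun t ht => by simp only [κ, dif_pos ht]
  have hκ0 : κ 0 = x := Subtype.ext ((hκ 0 (by rw [hc0]; exact x.2)).trans hc0)
  have hκc : (Subtype.val ∘ κ : ℝ → M) =ᶠ[𝓝 0] c := hcC.mono hκ
  have hκs : ContMDiffAt 𝓘(ℝ, ℝ) (𝓡 n) ∞ (Subtype.val ∘ κ : ℝ → M) 0 :=
    hcs.congr_of_eventuallyEq hκc
  -- A continuous map into the source of an immersion is smooth once its composite with the
  -- immersion is; continuity comes from the subspace topology on `C`.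
  have hκd : ContMDiffAt 𝓘(ℝ, ℝ) (𝓡 d) ∞ κ 0 := by
    rw [ContMDiffAt.iff_comp_isImmersionAt (φ := (Subtype.val : C → M)) (J' := 𝓡 n)
      (S.isSmoothEmbedding.isImmersion.isImmersionAt _)]
    exact ⟨IsInducing.subtypeVal.continuousAt_iff.2 hκs.continuousAt, hκs⟩
  have hι : MDifferentiableAt (𝓡 d) (𝓡 n) (Subtype.val : C → M) (κ 0) :=
    S.isSmoothEmbedding.contMDiff.mdifferentiableAt (by simp)
  have hd1 := hι.hasMFDerivAt.comp (0 : ℝ) (hκd.mdifferentiableAt (by simp)).hasMFDerivAt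
  have hΘd : MDifferentiableAt (𝓡 n) 𝓘(ℝ, EuclideanSpace ℝ (Fin n)) Θ (c 0) := by
    rw [hc0]
    exact (contMDiffAt_of_mem_maximalAtlas h.mem_maximalAtlas hx).mdifferentiableAt (by simp)
  have hd2 := hΘd.hasMFDerivAt.comp (0 : ℝ) (hd1.congr_of_eventuallyEq hκc.symm)
  have hd3 : HasMFDerivAt 𝓘(ℝ, ℝ) 𝓘(ℝ, EuclideanSpace ℝ (Fin n)) (fun t : ℝ => Θ x + t • a) 0
      (ContinuousLinearMap.toSpanSingleton ℝ a : ℝ →L[ℝ] EuclideanSpace ℝ (Fin n)) := by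
    have : HasDerivAt (fun t : ℝ => Θ x + t • a) a 0 := by
      simpa using ((hasDerivAt_id (0 : ℝ)).smul_const a).const_add (Θ x)
    exact this.hasFDerivAt.hasMFDerivAt
  have hev : (fun t : ℝ => Θ x + t • a) =ᶠ[𝓝 0] Θ ∘ c := by
    have h2 : ∀ᶠ t in 𝓝 (0 : ℝ), Θ x + t • a ∈ Θ.target :=
      hline.continuous.continuousAt.eventually_mem
        (by rw [h0]; exact Θ.open_target.mem_nhds (Θ.map_source hx))
    filter_upwards [h2] with t ht using (Θ.right_inv ht).symm
  have h6 := hasMFDerivAt_unique (hd2.congr_of_eventuallyEq hev) hd3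
  have h7 := congrArg (fun D : ℝ →L[ℝ] EuclideanSpace ℝ (Fin n) => D 1) h6
  refine ⟨mfderiv 𝓘(ℝ, ℝ) (𝓡 d) κ 0 (1 : ℝ), ?_⟩
  apply (coordDeriv_bijective h.mem_maximalAtlas hx).1
  rw [← ha]
  have h8 : coordDeriv Θ (c 0) (S.inclDeriv (κ 0) (mfderiv 𝓘(ℝ, ℝ) (𝓡 d) κ 0 (1 : ℝ))) =
      (1 : ℝ) • a := h7
  rw [hκ0, hc0, one_smul] at h8
  exact h8

end EmbeddedSubmanifold

end Tangent

/-! ### Components of the fixed set -/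

section Components

theorem isClosed_connectedComponentIn {X : Type*} [TopologicalSpace X] {F : Set X}
    (hF : IsClosed F) (x : X) : IsClosed (connectedComponentIn F x) := by
  by_cases hx : x ∈ F
  · refine isClosed_of_closure_subset ?_
    exact isPreconnected_connectedComponentIn.closure.subset_connectedComponentIn
      (subset_closure (mem_connectedComponentIn hx))
      (closure_minimal (connectedComponentIn_subset F x) hF)
  · rw [connectedComponentIn_eq_empty hx]
    exact isClosed_empty

variable {n : ℕ} {M : Type*} [TopologicalSpace M] [ChartedSpace (EuclideanSpace ℝ (Fin n)) M]
  {f : M → M}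

/-- In a small coordinate ball the fixed points form the image of `V ∩ ball`, which is convex, hence
connected. -/
theorem IsSliceChart.eventually_mem_connectedComponentIn
    {Θ : OpenPartialHomeomorph M (EuclideanSpace ℝ (Fin n))}
    {V : Submodule ℝ (EuclideanSpace ℝ (Fin n))} (h : IsSliceChart f Θ V) {x : M}
    (hx : x ∈ Θ.source) (hfx : f x = x) :
    ∀ᶠ y in 𝓝 x, f y = y → y ∈ connectedComponentIn {y | f y = y} x := by
  obtain ⟨r, hr, hball⟩ := Metric.isOpen_iff.1 Θ.open_target (Θ x) (Θ.map_source hx)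
  set K : Set M := Θ.symm '' ((V : Set (EuclideanSpace ℝ (Fin n))) ∩ Metric.ball (Θ x) r)
  have hmem : ∀ y ∈ Θ.source, Θ y ∈ Metric.ball (Θ x) r → f y = y → y ∈ K := fun y hy hyr hfy =>
    ⟨Θ y, ⟨(h.fixed_iff y hy).1 hfy, hyr⟩, Θ.left_inv hy⟩
  have hK : IsPreconnected K :=
    (V.convex.inter (convex_ball _ _)).isPreconnected.image _
      (Θ.continuousOn_symm.mono (inter_subset_right.trans hball))
  have hsub : K ⊆ connectedComponentIn {y | f y = y} x := by
    refine hK.subset_connectedComponentIn (hmem x hx (Metric.mem_ball_self hr) hfx) ?_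
    rintro _ ⟨w, ⟨hwV, hwr⟩, rfl⟩
    have hw := hball hwr
    exact (h.fixed_iff _ (Θ.map_target hw)).2 (by rw [Θ.right_inv hw]; exact hwV)
  filter_upwards [Θ.open_source.mem_nhds hx,
    (Θ.continuousAt hx).eventually_mem (Metric.ball_mem_nhds _ hr)] with y hy hyr hfy
  exact hsub (hmem y hy hyr hfy)

/-- If `V = ⊥` the chart domain holds no other fixed point; otherwise a line in `V` through `Θ x`
supplies fixed points arbitrarily near `x`. -/
theorem IsSliceChart.accPt_iff
    {Θ : OpenPartialHomeomorph M (EuclideanSpace ℝ (Fin n))}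
    {V : Submodule ℝ (EuclideanSpace ℝ (Fin n))} (h : IsSliceChart f Θ V) {x : M}
    (hx : x ∈ Θ.source) (hfx : f x = x) :
    AccPt x (𝓟 {y | f y = y}) ↔ V ≠ ⊥ := by
  rw [accPt_iff_nhds]
  have hxV := (h.fixed_iff x hx).1 hfx
  constructor
  · rintro hacc rfl
    obtain ⟨y, ⟨hy, hfy⟩, hne⟩ := hacc _ (Θ.open_source.mem_nhds hx)
    refine hne (Θ.injOn hy hx ?_)
    rw [(Submodule.mem_bot ℝ).1 hxV, (Submodule.mem_bot ℝ).1 ((h.fixed_iff y hy).1 hfy)]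
  · intro hV U hU
    obtain ⟨a, haV, ha⟩ := Submodule.exists_mem_ne_zero_of_ne_bot hV
    have hline : Continuous fun t : ℝ => Θ x + t • a := by fun_prop
    have h0 : Θ x + (0 : ℝ) • a = Θ x := by simp
    have h1 : ∀ᶠ t in 𝓝 (0 : ℝ), Θ x + t • a ∈ Θ.target :=
      hline.continuousAt.eventually_mem
        (by rw [h0]; exact Θ.open_target.mem_nhds (Θ.map_source hx))
    have h2 : ∀ᶠ t in 𝓝 (0 : ℝ), Θ.symm (Θ x + t • a) ∈ U := by
      refine hline.continuousAt.eventually (p := fun w => Θ.symm w ∈ U) ?_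
      beta_reduce
      rw [h0]
      refine (Θ.continuousAt_symm (Θ.map_source hx)).eventually_mem ?_
      rwa [Θ.left_inv hx]
    obtain ⟨t, ⟨ht1, ht2⟩, ht0⟩ :=
      (((h1.and h2).filter_mono nhdsWithin_le_nhds).and
        (self_mem_nhdsWithin : {(0 : ℝ)}ᶜ ∈ 𝓝[≠] 0)).exists
    refine ⟨Θ.symm (Θ x + t • a), ⟨ht2, (h.fixed_iff _ (Θ.map_target ht1)).2 ?_⟩, fun heq => ?_⟩
    · rw [Θ.right_inv ht1]
      exact V.add_mem hxV (V.smul_mem _ haV)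
    · have h3 := congrArg Θ heq
      rw [Θ.right_inv ht1, add_eq_left, smul_eq_zero] at h3
      exact h3.elim ht0 ha

variable [IsManifold (𝓡 n) ∞ M] [RiemannianBundle (fun x : M => TangentSpace (𝓡 n) x)]
  [IsContMDiffRiemannianBundle (𝓡 n) ∞ (EuclideanSpace ℝ (Fin n))
    (fun x : M => TangentSpace (𝓡 n) x)]

theorem IsRiemannianMap.eventually_mem_component (hf : IsRiemannianMap n f) {C : Set M}
    (hC : C ∈ components {y | f y = y}) {x : M} (hx : x ∈ C) :
    ∀ᶠ y in 𝓝 x, f y = y → y ∈ C := by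
  obtain ⟨z, -, rfl⟩ := hC
  have hfx : f x = x := connectedComponentIn_subset {y | f y = y} z hx
  obtain ⟨Θ, V, hxΘ, h⟩ := hf.exists_isSliceChart hfx
  rw [connectedComponentIn_eq hx]
  exact h.eventually_mem_connectedComponentIn hxΘ hfx

omit [IsManifold (𝓡 n) ∞ M] [RiemannianBundle (fun x : M => TangentSpace (𝓡 n) x)]
  [IsContMDiffRiemannianBundle (𝓡 n) ∞ (EuclideanSpace ℝ (Fin n))
    (fun x : M => TangentSpace (𝓡 n) x)] in
theorem apply_eq_of_mem_component {C : Set M} (hC : C ∈ components (M := M) {y | f y = y}) {x : M}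
    (hx : x ∈ C) : f x = x := by
  obtain ⟨z, -, rfl⟩ := hC
  exact connectedComponentIn_subset {y | f y = y} z hx

/-- The components are relatively open in a compact set and cover it. -/
theorem IsRiemannianMap.finite_components [T2Space M] [CompactSpace M] (hf : IsRiemannianMap n f) :
    (components {y | f y = y}).Finite := by
  have hcl : IsClosed {y | f y = y} := isClosed_eq hf.contMDiff.continuous continuous_id
  obtain ⟨t, ht, hcov⟩ := hcl.isCompact.elim_nhds_subcover
    (fun x => {y | f y = y → y ∈ connectedComponentIn {y | f y = y} x})
    (fun x hx => hf.eventually_mem_component ⟨x, hx, rfl⟩ (mem_connectedComponentIn hx))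
  refine (t.finite_toSet.image fun x => connectedComponentIn {y | f y = y} x).subset ?_
  rintro _ ⟨y, hy, rfl⟩
  obtain ⟨x, hx, hxy⟩ := mem_iUnion₂.1 (hcov hy)
  exact ⟨x, hx, connectedComponentIn_eq (hxy hy)⟩

omit [IsManifold (𝓡 n) ∞ M] [IsContMDiffRiemannianBundle (𝓡 n) ∞ (EuclideanSpace ℝ (Fin n))
    (fun x : M => TangentSpace (𝓡 n) x)] in
theorem IsRiemannianMap.isCompact_component [T2Space M] [CompactSpace M] (hf : IsRiemannianMap n f)
    {C : Set M} (hC : C ∈ components {y | f y = y}) : IsCompact C := by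
  obtain ⟨z, -, rfl⟩ := hC
  exact (isClosed_connectedComponentIn
    (isClosed_eq hf.contMDiff.continuous continuous_id) z).isCompact

theorem IsRiemannianMap.accPt_iff (hf : IsRiemannianMap n f) {x : M} (hx : f x = x) :
    AccPt x (𝓟 {y | f y = y}) ↔ fixedVectors (n := n) f x ≠ ⊥ := by
  obtain ⟨Θ, V, hxΘ, h⟩ := hf.exists_isSliceChart hx
  rw [h.accPt_iff hxΘ hx, ← Submodule.one_le_finrank_iff, ← Submodule.one_le_finrank_iff,
    h.finrank_fixedVectors hxΘ hx]

theorem IsRiemannianMap.finrank_fixedVectors_eq (hf : IsRiemannianMap n f)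
    {C : Set M} (hC : C ∈ components {y | f y = y}) {x y : M} (hx : x ∈ C) (hy : y ∈ C) :
    Module.finrank ℝ (fixedVectors (n := n) f x) = Module.finrank ℝ (fixedVectors (n := n) f y) := by
  have hpc : IsPreconnected C := by
    obtain ⟨z, -, rfl⟩ := hC
    exact isPreconnected_connectedComponentIn
  have : PreconnectedSpace C := isPreconnected_iff_preconnectedSpace.1 hpc
  have hlc : IsLocallyConstant fun z : C => Module.finrank ℝ (fixedVectors (n := n) f (z : M)) := by
    rw [IsLocallyConstant.iff_eventually_eq]
    intro z
    have hfz := apply_eq_of_mem_component hC z.2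
    obtain ⟨Θ, V, hzΘ, h⟩ := hf.exists_isSliceChart hfz
    filter_upwards [continuous_subtype_val.continuousAt.eventually_mem
      (Θ.open_source.mem_nhds hzΘ)] with w hw
    rw [h.finrank_fixedVectors hzΘ hfz,
      h.finrank_fixedVectors hw (apply_eq_of_mem_component hC w.2)]
  exact hlc.apply_eq_of_preconnectedSpace ⟨x, hx⟩ ⟨y, hy⟩

/-- Slice charts are shrunk to an open set whose fixed points all belong to `C`, since a chart could
otherwise meet other components. -/
theorem IsRiemannianMap.nonempty_embeddedSubmanifold (hf : IsRiemannianMap n f)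
    {C : Set M} (hC : C ∈ components {y | f y = y}) {x : M} (hx : x ∈ C) :
    Nonempty (EmbeddedSubmanifold (n := n)
      (Module.finrank ℝ (fixedVectors (n := n) f x)) C) := by
  refine exists_embeddedSubmanifold
    (F := EuclideanSpace ℝ (Fin (n - Module.finrank ℝ (fixedVectors (n := n) f x)))) fun y => ?_
  have hfy := apply_eq_of_mem_component hC y.2
  obtain ⟨Θ, V, hyΘ, h⟩ := hf.exists_isSliceChart hfy
  obtain ⟨O, hOC, hO, hyO⟩ := eventually_nhds_iff.1 (hf.eventually_mem_component hC y.2)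
  obtain ⟨L, hL⟩ := exists_equiv_prod V
    ((h.finrank_fixedVectors hyΘ hfy).symm.trans (hf.finrank_fixedVectors_eq hC y.2 hx))
  refine ⟨Θ.restr O, restr_mem_maximalAtlas _ h.mem_maximalAtlas hO, L, ?_, fun z hz => ?_⟩
  · rw [Θ.restr_source' O hO]
    exact ⟨hyΘ, hyO⟩
  · rw [Θ.restr_source' O hO] at hz
    change z ∈ C ↔ (L.symm (Θ z)).2 = 0
    rw [← hL, ← h.fixed_iff z hz.1]
    exact ⟨apply_eq_of_mem_component hC, hOC z hz.2⟩

namespace EmbeddedSubmanifold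

variable {d : ℕ} {C : Set M}

/-- This holds for every submanifold structure on the component, not only the constructed one, so
the dimension is forced. The codimension claims quantify over all structures. -/
theorem range_inclDeriv (S : EmbeddedSubmanifold (n := n) d C) (hf : IsRiemannianMap n f)
    (hC : C ∈ components {y | f y = y}) (x : C) :
    LinearMap.range (S.inclDeriv x).toLinearMap = fixedVectors f (x : M) := by
  ext w
  rw [mem_fixedVectors]
  constructor
  · rintro ⟨u, rfl⟩
    exact S.tangentOp_inclDeriv hf.contMDiff (fun y => apply_eq_of_mem_component hC) x u
  · intro hw
    have hfx := apply_eq_of_mem_component hC x.2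
    obtain ⟨Θ, V, hxΘ, h⟩ := hf.exists_isSliceChart hfx
    exact S.exists_inclDeriv_eq h hxΘ hfx (hf.eventually_mem_component hC x.2) hw

theorem finrank_fixedVectors (S : EmbeddedSubmanifold (n := n) d C) (hf : IsRiemannianMap n f)
    (hC : C ∈ components {y | f y = y}) (x : C) :
    Module.finrank ℝ (fixedVectors (n := n) f (x : M)) = d := by
  rw [← S.range_inclDeriv hf hC x, LinearMap.finrank_range_of_inj (S.inclDeriv_injective x),
    finrank_euclideanSpace_fin]

theorem totallyGeodesic (S : EmbeddedSubmanifold (n := n) d C) (hf : IsRiemannianMap n f)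
    (hC : C ∈ components {y | f y = y}) : S.TotallyGeodesic := by
  intro γ ε hε hγ h hv
  obtain ⟨u, hu⟩ := (S.mem_tangentSubspace _ _).1 hv
  have h0 : (0 : ℝ) ∈ Ioo (-ε) ε := ⟨by linarith, hε⟩
  have h1 := hf.eventually_fixed_geodesic hγ isOpen_Ioo h0 (apply_eq_of_mem_component hC h) (by
    rw [← hu]
    exact S.tangentOp_inclDeriv hf.contMDiff (fun y => apply_eq_of_mem_component hC) ⟨γ 0, h⟩ u)
  have h2 := ((hγ.1.continuousOn.continuousAt (isOpen_Ioo.mem_nhds h0)).eventually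
    (hf.eventually_mem_component hC h)).and h1
  obtain ⟨δ, hδ, hball⟩ := Metric.eventually_nhds_iff.1 h2
  refine ⟨δ, hδ, fun t ht => ?_⟩
  have h3 := hball (y := t) (by rwa [Real.dist_eq, sub_zero])
  exact h3.1 h3.2

end EmbeddedSubmanifold

end Components

/-! ### Fixed vectors of linear isometries -/

section LinearIsometries

open Module

variable {T : Type*} [NormedAddCommGroup T] [InnerProductSpace ℝ T] [FiniteDimensional ℝ T]

/-- The subspace of vectors fixed by a linear isometry. -/
def invariants (A : T ≃ₗᵢ[ℝ] T) : Submodule ℝ T :=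
  LinearMap.eqLocus A.toLinearEquiv.toLinearMap LinearMap.id

omit [FiniteDimensional ℝ T] in
theorem mem_invariants {A : T ≃ₗᵢ[ℝ] T} {v : T} : v ∈ invariants A ↔ A v = v := Iff.rfl

/-- A reflection in a nonzero vector flips the determinant and costs at most one dimension of fixed
vectors. Zero vectors contribute the identity, so `k` counts the nonzero ones. -/
theorem det_reflection_prod (l : List T) :
    ∃ k : ℕ, k ≤ l.length ∧
      LinearMap.det ((l.map fun v => (ℝ ∙ v)ᗮ.reflection).prod).toLinearEquiv.toLinearMap
        = (-1) ^ k ∧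
      finrank ℝ T ≤ finrank ℝ (invariants (l.map fun v => (ℝ ∙ v)ᗮ.reflection).prod) + k := by
  induction l with
  | nil =>
    refine ⟨0, le_rfl, ?_, ?_⟩
    · exact LinearMap.det_id
    · have : invariants (([] : List T).map fun v => (ℝ ∙ v)ᗮ.reflection).prod = ⊤ :=
        eq_top_iff.2 fun v _ => rfl
      rw [this, finrank_top, add_zero]
  | cons a l ih =>
    obtain ⟨k, hk, hdet, hdim⟩ := ih
    set P := (l.map fun v => (ℝ ∙ v)ᗮ.reflection).prod
    rw [List.map_cons, List.prod_cons]
    have h1 : LinearMap.det ((ℝ ∙ a)ᗮ.reflection * P).toLinearEquiv.toLinearMap =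
        (-1) ^ finrank ℝ (ℝ ∙ a) * (-1) ^ k := by
      have := LinearMap.det_comp (ℝ ∙ a)ᗮ.reflection.toLinearEquiv.toLinearMap
        P.toLinearEquiv.toLinearMap
      rw [hdet] at this
      refine this.trans (congrArg (· * _) ?_)
      have h2 := (ℝ ∙ a)ᗮ.det_reflection
      rw [Submodule.orthogonal_orthogonal] at h2
      exact h2
    have hle : finrank ℝ (ℝ ∙ a) ≤ 1 := (finrank_span_le_card {a}).trans (by simp)
    have hsub : invariants P ⊓ (ℝ ∙ a)ᗮ ≤ invariants ((ℝ ∙ a)ᗮ.reflection * P) := by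
      rintro v ⟨hv1, hv2⟩
      change (ℝ ∙ a)ᗮ.reflection (P v) = v
      rw [mem_invariants.1 hv1]
      exact Submodule.reflection_mem_subspace_eq_self hv2
    have h3 := Submodule.finrank_mono hsub
    have h4 := Submodule.finrank_sup_add_finrank_inf_eq (invariants P) (ℝ ∙ a)ᗮ
    have h5 := (ℝ ∙ a).finrank_add_finrank_orthogonal
    have h6 := (invariants P ⊔ (ℝ ∙ a)ᗮ).finrank_le
    refine ⟨finrank ℝ (ℝ ∙ a) + k, ?_, by rw [h1, pow_add], ?_⟩
    · rw [List.length_cons]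
      omega
    · change finrank ℝ T ≤ finrank ℝ (invariants ((ℝ ∙ a)ᗮ.reflection * P)) + _
      omega

/-- The subspace fixed by a rotation has even codimension. -/
theorem even_codim_invariants (A : T ≃ₗᵢ[ℝ] T)
    (hA : 0 < LinearMap.det A.toLinearEquiv.toLinearMap) :
    ∃ k, finrank ℝ T = finrank ℝ (invariants A) + 2 * k := by
  -- Sharp Cartan–Dieudonné: the number of reflections is at most the codimension of the fixed
  -- space. With the opposite bound `hdim` this makes `k` equal to that codimension, and the
  -- determinant gives its parity.
  obtain ⟨l, hl, hprod⟩ := A.reflections_generate_dim_aux le_rfl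
  obtain ⟨k, hk, hdet, hdim⟩ := det_reflection_prod l
  rw [← hprod] at hdet hdim
  have hker : LinearMap.ker (ContinuousLinearMap.id ℝ T - A.toContinuousLinearEquiv).toLinearMap
      = invariants A := by
    ext v
    rw [mem_invariants, eq_comm]
    exact sub_eq_zero
  have h1 := (invariants A).finrank_add_finrank_orthogonal
  have hl' : l.length ≤ finrank ℝ (invariants A)ᗮ := by
    rw [← hker]
    exact hl
  have hk2 : Even k := by
    by_contra hodd
    rw [hdet, (Nat.not_even_iff_odd.1 hodd).neg_one_pow] at hA
    linarith
  obtain ⟨j, hj⟩ := hk2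
  exact ⟨j, by omega⟩

/-- If a linear isometry which fixes a subspace of codimension two has a third vector whose image is
dependent on it modulo that subspace, then it is an involution. -/
theorem apply_apply_eq_of_dependent (A : T ≃ₗᵢ[ℝ] T)
    (hdim : finrank ℝ T = finrank ℝ (invariants A) + 2) {v : T} (hv : v ∉ invariants A) {a b : ℝ}
    (hab : a • v + b • A v ∈ invariants A) (h0 : b ≠ 0) (w : T) : A (A w) = w := by
  set K := invariants A
  have hinner : ∀ x ∈ K, ∀ y, inner ℝ x (A y) = inner ℝ x y := fun x hx y => by
    conv_lhs => rw [← mem_invariants.1 hx, A.inner_map_map]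
  -- Projected orthogonally to `K`, the dependence says that `w₀` is an eigenvector; its eigenvalue
  -- is `±1` as `A` is an isometry.
  set w₀ := v - K.starProjection v with hw₀
  have hw₀K : w₀ ∈ Kᗮ := K.sub_starProjection_mem_orthogonal v
  have hpK : K.starProjection v ∈ K := K.starProjection_apply_mem v
  have hw₀' : w₀ ∉ K := fun h => hv (by
    have := K.add_mem h hpK
    rwa [hw₀, sub_add_cancel] at this)
  have hAw₀ : A w₀ ∈ Kᗮ := by
    rw [Submodule.mem_orthogonal]
    intro x hx
    rw [hinner x hx]
    exact (Submodule.mem_orthogonal K w₀).1 hw₀K x hx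
  have hcomb : a • w₀ + b • A w₀ = 0 := by
    refine Submodule.disjoint_def.1 K.orthogonal_disjoint _ ?_
      (Kᗮ.add_mem (Kᗮ.smul_mem _ hw₀K) (Kᗮ.smul_mem _ hAw₀))
    have h1 : a • w₀ + b • A w₀ = (a • v + b • A v) - (a + b) • K.starProjection v := by
      rw [hw₀, map_sub, mem_invariants.1 hpK]
      module
    rw [h1]
    exact K.sub_mem hab (K.smul_mem _ hpK)
  have hne : w₀ ≠ 0 := fun h => hw₀' (h ▸ K.zero_mem)
  set c := -(a / b) with hc
  have hAc : A w₀ = c • w₀ := by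
    have : b • A w₀ = b • c • w₀ := by
      rw [smul_smul, hc, mul_neg, mul_div_cancel₀ _ h0, neg_smul, eq_neg_iff_add_eq_zero, add_comm]
      exact hcomb
    exact smul_right_injective T h0 this
  have hc2 : c * c = 1 := by
    have h1 : ‖c‖ * ‖w₀‖ = ‖w₀‖ := by rw [← norm_smul, ← hAc, A.norm_map]
    have h2 : ‖c‖ = 1 := mul_right_cancel₀ (norm_ne_zero_iff.2 hne) (h1.trans (one_mul _).symm)
    rw [← sq, ← sq_abs, ← Real.norm_eq_abs, h2, one_pow]
  have hsq : A (A w₀) = w₀ := by rw [hAc, map_smul, hAc, smul_smul, hc2, one_smul]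
  -- The square of `A` fixes more than `K`, so the codimension of its fixed space is at most one;
  -- being even, it is zero.
  have hlt : K < invariants (A * A) := by
    refine lt_of_le_of_ne (fun x hx => ?_) fun h => hw₀' ?_
    · change A (A x) = x
      rw [mem_invariants.1 hx, mem_invariants.1 hx]
    · rw [h]
      exact hsq
  have h1 := Submodule.finrank_lt_finrank_of_lt hlt
  have h2 : 0 < LinearMap.det (A * A).toLinearEquiv.toLinearMap := by
    have h3 := LinearMap.det_comp A.toLinearEquiv.toLinearMap A.toLinearEquiv.toLinearMap
    refine lt_of_lt_of_eq ?_ h3.symm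
    exact mul_self_pos.2 (LinearEquiv.isUnit_det' A.toLinearEquiv).ne_zero
  obtain ⟨k, hk⟩ := even_codim_invariants (A * A) h2
  have h4 : invariants (A * A) = ⊤ := Submodule.eq_top_of_finrank_eq (by
    have := (invariants (A * A)).finrank_le
    omega)
  have h5 : w ∈ invariants (A * A) := h4 ▸ Submodule.mem_top
  exact h5

end LinearIsometries

/-! ### The differential at a fixed point -/

section Differential

open Module

variable {n : ℕ} {M : Type*} [TopologicalSpace M] [ChartedSpace (EuclideanSpace ℝ (Fin n)) M]
  [IsManifold (𝓡 n) ∞ M] [RiemannianBundle (fun x : M => TangentSpace (𝓡 n) x)] {f : M → M}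

instance finiteDimensional_tangentSpace (x : M) : FiniteDimensional ℝ (TangentSpace (𝓡 n) x) :=
  inferInstanceAs (FiniteDimensional ℝ (EuclideanSpace ℝ (Fin n)))

omit [IsManifold (𝓡 n) ∞ M] [RiemannianBundle (fun x : M => TangentSpace (𝓡 n) x)] in
theorem finrank_tangentSpace (x : M) : finrank ℝ (TangentSpace (𝓡 n) x) = n :=
  finrank_euclideanSpace_fin

/-- The differential at a fixed point, as an isometry of the tangent space. -/
noncomputable def IsRiemannianMap.isometryAt (hf : IsRiemannianMap n f) {x : M} (hx : f x = x) :
    TangentSpace (𝓡 n) x ≃ₗᵢ[ℝ] TangentSpace (𝓡 n) x :=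
  LinearIsometry.toLinearIsometryEquiv
    (LinearMap.isometryOfInner (E := TangentSpace (𝓡 n) x) (E' := TangentSpace (𝓡 n) x)
      (tangentOp f x).toLinearMap fun v w => by
        have key : ∀ (y : M) (_ : y = x) (a b : EuclideanSpace ℝ (Fin n)),
            tangentInner (n := n) x a b = tangentInner (n := n) y a b := by
          rintro y rfl a b
          rfl
        exact (key _ hx _ _).trans (hf.inner_map x v w)) rfl

omit [IsManifold (𝓡 n) ∞ M] in
theorem IsRiemannianMap.finrank_invariants (hf : IsRiemannianMap n f) {x : M} (hx : f x = x) :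
    finrank ℝ (invariants (hf.isometryAt hx)) = finrank ℝ (fixedVectors (n := n) f x) := by
  have h : ∀ v : EuclideanSpace ℝ (Fin n), v ∈ invariants (hf.isometryAt hx) ↔
      v ∈ fixedVectors (n := n) f x := fun v => mem_fixedVectors.symm
  exact LinearEquiv.finrank_eq
    { toFun := fun v => (⟨v.1, (h v.1).1 v.2⟩ : fixedVectors (n := n) f x)
      invFun := fun v => ⟨v.1, (h v.1).2 v.2⟩
      map_add' := fun _ _ => rfl
      map_smul' := fun _ _ => rfl
      left_inv := fun _ => rfl
      right_inv := fun _ => rfl }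

/-- At a fixed point, source and target carry the same orientation. -/
theorem OrientedIsometry.det_isometryAt_pos {o : ManifoldOrientation n M} (φ : OrientedIsometry o)
    {x : M} (hx : φ.toHomeo x = x) :
    0 < LinearMap.det (φ.isRiemannianMap.isometryAt hx).toLinearEquiv.toLinearMap := by
  let e : TangentSpace (𝓡 n) x ≃ₗ[ℝ] TangentSpace (𝓡 n) x :=
    (φ.toDiffeo.mfderivToContinuousLinearEquiv (by simp) x).toLinearEquiv
  have h2 : (o.orient (φ.toDiffeo x) : Orientation ℝ (EuclideanSpace ℝ (Fin n)) (Fin n)) =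
      o.orient x := by
    let F : M → Orientation ℝ (EuclideanSpace ℝ (Fin n)) (Fin n) := o.orient
    exact congrArg F hx
  have h3 : Orientation.map (Fin n) e (o.orient x) = o.orient x := (φ.orient_map x).trans h2
  exact (Orientation.map_eq_iff_det_pos _ e
    ((Fintype.card_fin n).trans (finrank_tangentSpace x).symm)).1 h3

theorem OrientedIsometry.even_codim {o : ManifoldOrientation n M} (φ : OrientedIsometry o)
    {x : M} (hx : φ.toHomeo x = x) :
    ∃ k, n = finrank ℝ (fixedVectors (n := n) φ.toHomeo x) + 2 * k := by
  obtain ⟨k, hk⟩ := even_codim_invariants _ (φ.det_isometryAt_pos hx)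
  rw [φ.isRiemannianMap.finrank_invariants hx, finrank_tangentSpace] at hk
  exact ⟨k, hk⟩

end Differential

/-! ### Orienting the fixed subspace of codimension two -/

section Linear

open Module

theorem continuous_alternatingMap {T ι : Type*} [NormedAddCommGroup T] [NormedSpace ℝ T]
    [FiniteDimensional ℝ T] [Fintype ι] [DecidableEq ι] (b : Basis ι ℝ T)
    (η : T [⋀^ι]→ₗ[ℝ] ℝ) : Continuous fun v : ι → T => η v := by
  have h : ∀ v, η v = η b * (b.toMatrix v).det := fun v => by
    conv_lhs => rw [η.eq_smul_basis_det b]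
    rfl
  rw [show (fun v : ι → T => η v) = fun v => η b * (b.toMatrix v).det from funext h]
  refine continuous_const.mul (Continuous.matrix_det ?_)
  refine continuous_pi fun i => continuous_pi fun j => ?_
  exact (LinearMap.continuous_of_finiteDimensional (b.coord i)).comp (continuous_apply j)

/-- Top-degree forms are multiples of one determinant, so their values on a single basis decide. -/
theorem sameRay_of_mul_pos {T ι : Type*} [AddCommGroup T] [Module ℝ T]
    [Fintype ι] [DecidableEq ι] (b : Basis ι ℝ T) {α β : T [⋀^ι]→ₗ[ℝ] ℝ} (h : 0 < α b * β b) :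
    SameRay ℝ α β := by
  rw [α.eq_smul_basis_det b, β.eq_smul_basis_det b]
  exact sameRay_smul_smul_of_mul_nonneg h.le

variable {T : Type*} [NormedAddCommGroup T] [InnerProductSpace ℝ T] [FiniteDimensional ℝ T]
  {d : ℕ}

/-- The contraction of a volume form with a vector and its image, restricted along `j`. -/
noncomputable def transverseForm {E T : Type*} [AddCommGroup E] [Module ℝ E] [AddCommGroup T]
    [Module ℝ T] (A : T → T) (j : E →ₗ[ℝ] T) (η : T [⋀^Fin (d + 2)]→ₗ[ℝ] ℝ) (v : T) :
    E [⋀^Fin d]→ₗ[ℝ] ℝ :=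
  ((η.curryLeft v).curryLeft (A v)).compLinearMap j

theorem transverseForm_apply {E T : Type*} [AddCommGroup E] [Module ℝ E] [AddCommGroup T]
    [Module ℝ T] (A : T → T) (j : E →ₗ[ℝ] T) (η : T [⋀^Fin (d + 2)]→ₗ[ℝ] ℝ) (v : T)
    (b : Fin d → E) :
    transverseForm A j η v b = η (Fin.cons v (Fin.cons (A v) (j ∘ b))) := rfl

/-- The standard basis of `EuclideanSpace ℝ (Fin d)`. -/
noncomputable def stdBasis (d : ℕ) : Basis (Fin d) ℝ (EuclideanSpace ℝ (Fin d)) :=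
  (EuclideanSpace.basisFun (Fin d) ℝ).toBasis

variable {A : T ≃ₗᵢ[ℝ] T} {j : EuclideanSpace ℝ (Fin d) →ₗ[ℝ] T}

/-- By `apply_apply_eq_of_dependent`, `v` and `A v` are independent modulo the fixed space unless
`A` is an involution. With a basis of that space they form a basis of `T`, on which `η` cannot
vanish. -/
theorem transverseForm_ne_zero (hj : Function.Injective j) (hr : LinearMap.range j = invariants A)
    (hT : finrank ℝ T = d + 2) (hA : ∃ w, A (A w) ≠ w) {η : T [⋀^Fin (d + 2)]→ₗ[ℝ] ℝ} (hη : η ≠ 0)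
    {v : T} (hv : v ∉ invariants A) : transverseForm A j η v (stdBasis d) ≠ 0 := by
  have hK : finrank ℝ T = finrank ℝ (invariants A) + 2 := by
    rw [← hr, LinearMap.finrank_range_of_inj hj, finrank_euclideanSpace_fin, hT]
  have hspan : Submodule.span ℝ (range (j ∘ stdBasis d)) = invariants A := by
    rw [range_comp, Submodule.span_image, (stdBasis d).span_eq, Submodule.map_top, hr]
  have hAv : A v ∉ invariants A := fun h => hv (A.injective h)
  have hli : LinearIndependent ℝ
      (Fin.cons v (Fin.cons (A v) (j ∘ stdBasis d)) : Fin (d + 2) → T) := by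
    rw [linearIndependent_finCons, linearIndependent_finCons]
    refine ⟨⟨(stdBasis d).linearIndependent.map' j (LinearMap.ker_eq_bot.2 hj),
      by rwa [hspan]⟩, fun hmem => ?_⟩
    rw [Fin.range_cons, Submodule.mem_span_insert, hspan] at hmem
    obtain ⟨a, z, hz, h⟩ := hmem
    by_cases ha : a = 0
    · rw [ha, zero_smul, zero_add] at h
      exact hv (h ▸ hz)
    · obtain ⟨w, hw⟩ := hA
      refine hw (apply_apply_eq_of_dependent A hK hv (a := 1) (b := -a) ?_ (neg_ne_zero.2 ha) w)
      have : (1 : ℝ) • v + -a • A v = z := by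
        nth_rw 1 [h]
        module
      rwa [this]
  let b := basisOfLinearIndependentOfCardEqFinrank hli (by simp [hT])
  have hb : (b : Fin (d + 2) → T) = Fin.cons v (Fin.cons (A v) (j ∘ stdBasis d)) :=
    coe_basisOfLinearIndependentOfCardEqFinrank _ _
  rw [transverseForm_apply, ← hb]
  exact (η.map_basis_ne_zero_iff b).2 hη

/-- The complement of a subspace of codimension two is connected, and the value is continuous and
nowhere zero on it, so its sign does not depend on `v`. -/
theorem transverseForm_mul_pos (hj : Function.Injective j)
    (hr : LinearMap.range j = invariants A)
    (hT : finrank ℝ T = d + 2) (hA : ∃ w, A (A w) ≠ w) {η : T [⋀^Fin (d + 2)]→ₗ[ℝ] ℝ} (hη : η ≠ 0)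
    {v v' : T} (hv : v ∉ invariants A) (hv' : v' ∉ invariants A) :
    0 < transverseForm A j η v (stdBasis d) * transverseForm A j η v' (stdBasis d) := by
  have hK : finrank ℝ T = finrank ℝ (invariants A) + 2 := by
    rw [← hr, LinearMap.finrank_range_of_inj hj, finrank_euclideanSpace_fin, hT]
  have hcodim : 1 < Module.rank ℝ (T ⧸ invariants A) := by
    have := (invariants A).finrank_quotient_add_finrank
    rw [← finrank_eq_rank]
    exact_mod_cast (by omega : 1 < finrank ℝ (T ⧸ invariants A))
  have hconn := isConnected_compl_of_one_lt_codim hcodim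
  set q : T → ℝ := fun v => transverseForm A j η v (stdBasis d) with hq
  have hqc : Continuous q := by
    simp only [hq, transverseForm_apply]
    refine (continuous_alternatingMap (finBasisOfFinrankEq ℝ T hT) η).comp ?_
    refine continuous_pi fun i => ?_
    refine Fin.cases ?_ (fun i => Fin.cases ?_ (fun i => ?_) i) i
    · exact continuous_id
    · exact A.continuous
    · exact continuous_const
  have hq0 : ∀ x ∉ invariants A, q x ≠ 0 := fun x hx => transverseForm_ne_zero hj hr hT hA hη hx
  by_contra hneg
  have hlt : q v * q v' < 0 :=
    lt_of_le_of_ne (not_lt.1 hneg) (mul_ne_zero (hq0 v hv) (hq0 v' hv'))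
  have hzero : (0 : ℝ) ∈ q '' (invariants A : Set T)ᶜ := by
    rcases mul_neg_iff.1 hlt with ⟨h1, h2⟩ | ⟨h1, h2⟩
    · exact hconn.isPreconnected.intermediate_value hv' hv hqc.continuousOn ⟨h2.le, h1.le⟩
    · exact hconn.isPreconnected.intermediate_value hv hv' hqc.continuousOn ⟨h1.le, h2.le⟩
  obtain ⟨x, hx, hx0⟩ := hzero
  exact hq0 x hx hx0

/-- The fixed subspace of a rotation in codimension two which is not an involution is canonically
oriented. -/
theorem exists_invariants_orientation (hj : Function.Injective j)
    (hr : LinearMap.range j = invariants A) (hT : finrank ℝ T = d + 2) (hA : ∃ w, A (A w) ≠ w)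
    (O : Orientation ℝ T (Fin (d + 2))) :
    ∃ O' : Orientation ℝ (EuclideanSpace ℝ (Fin d)) (Fin d),
      ∀ (η : T [⋀^Fin (d + 2)]→ₗ[ℝ] ℝ) (hη : η ≠ 0) (v : T) (hv : transverseForm A j η v ≠ 0),
        rayOfNeZero ℝ η hη = O → O' = rayOfNeZero ℝ (transverseForm A j η v) hv := by
  have hK : finrank ℝ T = finrank ℝ (invariants A) + 2 := by
    rw [← hr, LinearMap.finrank_range_of_inj hj, finrank_euclideanSpace_fin, hT]
  -- A fixed `v` would enter `η` twice.
  have hne : ∀ (η : T [⋀^Fin (d + 2)]→ₗ[ℝ] ℝ) (v : T), transverseForm A j η v ≠ 0 →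
      v ∉ invariants A := by
    intro η v h hv
    refine h (AlternatingMap.ext fun b => ?_)
    rw [transverseForm_apply, mem_invariants.1 hv]
    exact η.map_eq_zero_of_eq _ (i := 0) (j := 1) rfl (by simp)
  obtain ⟨v₀, hv₀⟩ : ∃ v₀, v₀ ∉ invariants A := by
    by_contra! h
    have : invariants A = ⊤ := eq_top_iff.2 fun v _ => h v
    rw [this, finrank_top] at hK
    omega
  induction O using Module.Ray.ind with
  | h η₀ hη₀ =>
    have h0 : transverseForm A j η₀ v₀ ≠ 0 := fun h =>
      transverseForm_ne_zero hj hr hT hA hη₀ hv₀ (by rw [h]; rfl)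
    refine ⟨rayOfNeZero ℝ _ h0, fun η hη v hv hray => ?_⟩
    obtain ⟨r, s, hr0, hs0, hrs⟩ := ((ray_eq_iff hη hη₀).1 hray).exists_pos hη hη₀
    rw [ray_eq_iff]
    refine sameRay_of_mul_pos (stdBasis d) ?_
    have h1 := transverseForm_mul_pos hj hr hT hA hη₀ hv₀ (hne η v hv)
    have h2 : r * transverseForm A j η v (stdBasis d) =
        s * transverseForm A j η₀ v (stdBasis d) := by
      have := congrArg (fun α : T [⋀^Fin (d + 2)]→ₗ[ℝ] ℝ =>
        α (Fin.cons v (Fin.cons (A v) (j ∘ stdBasis d)))) hrs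
      exact this
    have h3 : transverseForm A j η v (stdBasis d) =
        s / r * transverseForm A j η₀ v (stdBasis d) := by
      field_simp
      linarith
    rw [h3, mul_left_comm]
    exact mul_pos (div_pos hs0 hr0) h1

end Linear

/-! ### Orienting components of codimension two -/

section Geometric

open Module

theorem continuousAt_trivialization_mfderiv {n d : ℕ} {M N : Type*} [TopologicalSpace M]
    [ChartedSpace (EuclideanSpace ℝ (Fin n)) M] [IsManifold (𝓡 n) ∞ M] [TopologicalSpace N]
    [ChartedSpace (EuclideanSpace ℝ (Fin d)) N] [IsManifold (𝓡 d) ∞ N] {g : N → M}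
    (hg : ContMDiff (𝓡 d) (𝓡 n) ∞ g)
    (e : Trivialization (EuclideanSpace ℝ (Fin d)) (π (EuclideanSpace ℝ (Fin d))
      (TangentSpace (𝓡 d) : N → Type _)))
    (e' : Trivialization (EuclideanSpace ℝ (Fin n)) (π (EuclideanSpace ℝ (Fin n))
      (TangentSpace (𝓡 n) : M → Type _))) {x₁ : N} (hx : x₁ ∈ e.baseSet) (hx' : g x₁ ∈ e'.baseSet)
    (v : EuclideanSpace ℝ (Fin d)) :
    ContinuousAt (fun x => (e' ⟨g x, mfderiv (𝓡 d) (𝓡 n) g x (e.symm x v)⟩).2) x₁ := by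
  have h1 : ContinuousAt (fun x => (⟨x, e.symm x v⟩ : TangentBundle (𝓡 d) N)) x₁ := by
    refine (e.continuousAt_symm_prodMk_left (v := v) hx).congr ?_
    filter_upwards [e.open_baseSet.mem_nhds hx] with x hx
    exact (e.mk_symm hx v).symm
  have h2 : Continuous (tangentMap (𝓡 d) (𝓡 n) g) := hg.continuous_tangentMap (by simp)
  have h3 : ContinuousAt e' (tangentMap (𝓡 d) (𝓡 n) g ⟨x₁, e.symm x₁ v⟩) :=
    e'.toOpenPartialHomeomorph.continuousAt (e'.mem_source.2 hx')
  exact continuous_snd.continuousAt.comp (ContinuousAt.comp (f := fun x =>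
    tangentMap (𝓡 d) (𝓡 n) g ⟨x, e.symm x v⟩) h3 (h2.continuousAt.comp h1))

variable {d : ℕ} {M N : Type*} [TopologicalSpace M]
  [ChartedSpace (EuclideanSpace ℝ (Fin (d + 2))) M] [IsManifold (𝓡 (d + 2)) ∞ M]
  [RiemannianBundle (fun x : M => TangentSpace (𝓡 (d + 2)) x)]
  [TopologicalSpace N] [ChartedSpace (EuclideanSpace ℝ (Fin d)) N] [IsManifold (𝓡 d) ∞ N]
  {f : M → M} {g : N → M}

/-- The orientations come pointwise from `exists_invariants_orientation`. For local constancy near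
`x₁`, a volume form `η` and the coordinates `v₀` of a transverse vector are frozen in
trivializations; the contracted form on the standard frame is then a function continuous and nonzero
at `x₁`, so its sign persists nearby. -/
theorem nonempty_manifoldOrientation (o : ManifoldOrientation (d + 2) M)
    (hf : IsRiemannianMap (d + 2) f) (hg : ContMDiff (𝓡 d) (𝓡 (d + 2)) ∞ g)
    (hfg : ∀ x, f (g x) = g x) (hinj : ∀ x, Function.Injective (mfderiv (𝓡 d) (𝓡 (d + 2)) g x))
    (hrange : ∀ x, LinearMap.range (mfderiv (𝓡 d) (𝓡 (d + 2)) g x).toLinearMap =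
      invariants (hf.isometryAt (hfg x)))
    (hne : ∀ x, ∃ w, hf.isometryAt (hfg x) (hf.isometryAt (hfg x) w) ≠ w) :
    Nonempty (ManifoldOrientation d N) := by
  let j : ∀ x : N, EuclideanSpace ℝ (Fin d) →ₗ[ℝ] TangentSpace (𝓡 (d + 2)) (g x) := fun x =>
    (mfderiv (𝓡 d) (𝓡 (d + 2)) g x).toLinearMap
  choose O hO using fun x => exists_invariants_orientation (j := j x) (hinj x) (hrange x)
    (finrank_tangentSpace (g x)) (hne x) (o.orient (g x))
  refine ⟨⟨O, fun x₀ => ?_⟩⟩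
  set e := trivializationAt (EuclideanSpace ℝ (Fin d)) (TangentSpace (𝓡 d) : N → Type _) x₀
  rw [IsLocallyConstant.iff_eventually_eq]
  rintro ⟨x₁, hx₁⟩
  set e' := trivializationAt (EuclideanSpace ℝ (Fin (d + 2)))
    (TangentSpace (𝓡 (d + 2)) : M → Type _) (g x₁)
  have hx₁' : g x₁ ∈ e'.baseSet := mem_baseSet_trivializationAt _ _ (g x₁)
  obtain ⟨v, hv⟩ : ∃ v, v ∉ invariants (hf.isometryAt (hfg x₁)) := by
    obtain ⟨w, hw⟩ := hne x₁
    refine ⟨w, fun h => hw ?_⟩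
    rw [mem_invariants.1 h, mem_invariants.1 h]
  set v₀ := (e' ⟨g x₁, v⟩).2 with hv₀
  obtain ⟨η, hη, hray⟩ : ∃ (η : EuclideanSpace ℝ (Fin (d + 2)) [⋀^Fin (d + 2)]→ₗ[ℝ] ℝ) (hη : η ≠ 0),
      Orientation.map (Fin (d + 2)) (e'.linearEquivAt ℝ (g x₁) hx₁') (o.orient (g x₁)) =
        rayOfNeZero ℝ η hη := by
    induction Orientation.map (Fin (d + 2)) (e'.linearEquivAt ℝ (g x₁) hx₁') (o.orient (g x₁))
      using Module.Ray.ind with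
    | h η hη => exact ⟨η, hη, rfl⟩
  -- the ambient orientation near `x₁`
  have hor : ∀ᶠ y in 𝓝 (g x₁), ∃ hy : y ∈ e'.baseSet,
      o.orient y = rayOfNeZero ℝ (η.compLinearMap (e'.linearEquivAt ℝ y hy).toLinearMap)
        (mt (η.compLinearEquiv_eq_zero_iff _).1 hη) := by
    have h1 := (IsLocallyConstant.iff_eventually_eq _).1 (o.isLocallyConstant (g x₁)) ⟨g x₁, hx₁'⟩
    rw [← e'.open_baseSet.isOpenEmbedding_subtypeVal.map_nhds_eq ⟨g x₁, hx₁'⟩]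
    rw [Filter.eventually_map]
    filter_upwards [h1] with y hy
    refine ⟨y.2, ?_⟩
    have h2 := hy.trans hray
    rw [← Equiv.eq_symm_apply] at h2
    exact h2
  -- the value of the contracted volume form on the frame of the trivialization
  set G : N → ℝ := fun x => η (Fin.cons v₀ (Fin.cons
    (e' ⟨f (g x), mfderiv (𝓡 (d + 2)) (𝓡 (d + 2)) f (g x) (e'.symm (g x) v₀)⟩).2
    fun i => (e' ⟨g x, mfderiv (𝓡 d) (𝓡 (d + 2)) g x (e.symm x (stdBasis d i))⟩).2)) with hG
  have hGc : ContinuousAt G x₁ := by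
    refine (continuous_alternatingMap (stdBasis (d + 2)) η).continuousAt.comp ?_
    refine continuousAt_pi.2 fun i => ?_
    refine Fin.cases ?_ (fun i => Fin.cases ?_ (fun i => ?_) i) i
    · exact continuousAt_const
    · exact ContinuousAt.comp (g := fun y : M => (e' ⟨f y, mfderiv (𝓡 (d + 2)) (𝓡 (d + 2)) f y
        (e'.symm y v₀)⟩).2) (continuousAt_trivialization_mfderiv hf.contMDiff e' e' hx₁'
          (by rw [hfg]; exact hx₁') v₀) hg.continuous.continuousAt
    · exact continuousAt_trivialization_mfderiv hg e e' hx₁ hx₁' _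
  have hGeq : ∀ (x : N) (hx : x ∈ e.baseSet) (hy : g x ∈ e'.baseSet),
      (transverseForm (hf.isometryAt (hfg x)) (j x)
        (η.compLinearMap (e'.linearEquivAt ℝ (g x) hy).toLinearMap)
        (e'.symm (g x) v₀)).compLinearMap (e.linearEquivAt ℝ x hx).symm.toLinearMap (stdBasis d) =
      G x := by
    intro x hx hy
    have hcast : ∀ (y z : M) (_ : y = z) (w : EuclideanSpace ℝ (Fin (d + 2))),
        (e' ⟨y, w⟩).2 = (e' ⟨z, w⟩).2 := by
      rintro y _ rfl w
      rfl
    refine congrArg η (funext fun i => ?_)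
    refine Fin.cases ?_ (fun i => Fin.cases ?_ (fun i => ?_) i) i
    · exact (e'.linearEquivAt ℝ (g x) hy).apply_symm_apply v₀
    · exact hcast _ _ (hfg x).symm _
    · rfl
  have hform : ∀ (x : N) (hx : x ∈ e.baseSet) (hy : g x ∈ e'.baseSet),
      transverseForm (hf.isometryAt (hfg x)) (j x)
        (η.compLinearMap (e'.linearEquivAt ℝ (g x) hy).toLinearMap) (e'.symm (g x) v₀) ≠ 0 ↔
      G x ≠ 0 := by
    intro x hx hy
    rw [← hGeq x hx hy, AlternatingMap.map_basis_ne_zero_iff, not_iff_not]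
    exact (AlternatingMap.compLinearEquiv_eq_zero_iff _ (e.linearEquivAt ℝ x hx).symm).symm
  have hG₁ : G x₁ ≠ 0 := by
    rw [← hform x₁ hx₁ hx₁']
    have hsymm : e'.symm (g x₁) v₀ = v := (e'.linearEquivAt ℝ (g x₁) hx₁').symm_apply_apply v
    rw [hsymm]
    intro h
    refine transverseForm_ne_zero (j := j x₁) (hinj x₁) (hrange x₁) (finrank_tangentSpace (g x₁))
      (hne x₁) (mt (η.compLinearEquiv_eq_zero_iff
        (e'.linearEquivAt ℝ (g x₁) hx₁')).1 hη) hv ?_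
    rw [h]
    rfl
  have hpos : ∀ᶠ x in 𝓝 x₁, 0 < G x * G x₁ :=
    (hGc.mul continuousAt_const).eventually (lt_mem_nhds (mul_self_pos.2 hG₁))
  have hmap : ∀ (x : N) (hx : x ∈ e.baseSet) (hGx : G x ≠ 0) (hy : g x ∈ e'.baseSet),
      o.orient (g x) = rayOfNeZero ℝ (η.compLinearMap (e'.linearEquivAt ℝ (g x) hy).toLinearMap)
        (mt (η.compLinearEquiv_eq_zero_iff _).1 hη) →
      ∃ h, Orientation.map (Fin d) (e.linearEquivAt ℝ x hx) (O x) = rayOfNeZero ℝ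
        ((transverseForm (hf.isometryAt (hfg x)) (j x)
          (η.compLinearMap (e'.linearEquivAt ℝ (g x) hy).toLinearMap)
          (e'.symm (g x) v₀)).compLinearMap (e.linearEquivAt ℝ x hx).symm.toLinearMap) h := by
    intro x hx hGx hy hoy
    have h1 := (hform x hx hy).2 hGx
    rw [hO x _ _ _ h1 hoy.symm]
    exact ⟨_, rfl⟩
  obtain ⟨hy₁, ho₁⟩ := hor.self_of_nhds
  obtain ⟨hn₁, hm₁⟩ := hmap x₁ hx₁ hG₁ hy₁ ho₁
  have hev := hpos.and (hg.continuous.continuousAt.eventually hor)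
  filter_upwards [continuous_subtype_val.continuousAt.eventually hev] with x hx
  obtain ⟨hxpos, hy, hox⟩ := hx
  obtain ⟨hn, hm⟩ := hmap x x.2 (left_ne_zero_of_mul hxpos.ne') hy hox
  refine hm.trans (Eq.trans ?_ hm₁.symm)
  rw [ray_eq_iff]
  refine sameRay_of_mul_pos (stdBasis d) ?_
  rw [hGeq, hGeq]
  exact hxpos

end Geometric

/-! ### Powers of the isometry, and orientability in codimension two -/

section Components

open Module

variable {n : ℕ} {M : Type*} [TopologicalSpace M] [ChartedSpace (EuclideanSpace ℝ (Fin n)) M]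
  [IsManifold (𝓡 n) ∞ M] [RiemannianBundle (fun x : M => TangentSpace (𝓡 n) x)] {f : M → M}

omit [IsManifold (𝓡 n) ∞ M] in
theorem IsRiemannianMap.tangentOp_iterate (hf : IsRiemannianMap n f) {x : M} (hx : f x = x) (k : ℕ)
    (u : EuclideanSpace ℝ (Fin n)) :
    tangentOp (n := n) f^[k] x u = (tangentOp (n := n) f x)^[k] u := by
  induction k generalizing u with
  | zero =>
    change tangentOp (n := n) _root_.id x u = u
    rw [tangentOp, mfderiv_id]
    rfl
  | succ k ih =>
    rw [Function.iterate_succ, Function.iterate_succ_apply, ← ih]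
    have h := mfderiv_comp x ((hf.iterate k).contMDiff.mdifferentiableAt (x := f x) (by simp))
      (hf.contMDiff.mdifferentiableAt (x := x) (by simp))
    have h2 : tangentOp (n := n) (f^[k] ∘ f) x u =
      tangentOp (n := n) f^[k] (f x) (tangentOp (n := n) f x u) :=
      congrArg (fun D : EuclideanSpace ℝ (Fin n) →L[ℝ] EuclideanSpace ℝ (Fin n) => D u) h
    rw [h2, hx]

/-- The differential of a power is the power of the differential, so its determinant is still
positive. -/
theorem OrientedIsometry.even_codim_iterate {o : ManifoldOrientation n M} (φ : OrientedIsometry o)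
    {x : M} (hx : φ.toHomeo x = x) (k : ℕ) :
    ∃ j, n = finrank ℝ (fixedVectors (n := n) φ.toHomeo^[k] x) + 2 * j := by
  have hf := φ.isRiemannianMap
  have hxk : φ.toHomeo^[k] x = x := Function.iterate_fixed hx k
  have hpow : ((hf.iterate k).isometryAt hxk).toLinearEquiv.toLinearMap =
      (hf.isometryAt hx).toLinearEquiv.toLinearMap ^ k := by
    ext v
    rw [Module.End.pow_apply]
    exact hf.tangentOp_iterate hx k v
  obtain ⟨j, hj⟩ := even_codim_invariants ((hf.iterate k).isometryAt hxk) (by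
    rw [hpow, map_pow]
    exact pow_pos (φ.det_isometryAt_pos hx) k)
  rw [(hf.iterate k).finrank_invariants hxk, finrank_tangentSpace] at hj
  exact ⟨j, hj⟩

variable [IsContMDiffRiemannianBundle (𝓡 n) ∞ (EuclideanSpace ℝ (Fin n))
    (fun x : M => TangentSpace (𝓡 n) x)]

theorem IsRiemannianMap.iterate_eq_id [T2Space M] [PreconnectedSpace M] (hf : IsRiemannianMap n f)
    {x : M} (hx : f x = x) {k : ℕ} (hd : ∀ u, (tangentOp (n := n) f x)^[k] u = u) (y : M) :
    f^[k] y = y :=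
  (hf.iterate k).eq_id (Function.iterate_fixed hx k)
    (fun u => (hf.tangentOp_iterate hx k u).trans (hd u)) y

/-- Were the differential an involution at a point of `C`, rigidity would make `f ∘ f` the identity.
-/
theorem EmbeddedSubmanifold.orientable_of_codim_two [T2Space M] [PreconnectedSpace M] {d : ℕ}
    {C : Set M} (S : EmbeddedSubmanifold (n := n) d C) (hd : d + 2 = n)
    (o : ManifoldOrientation n M) (hf : IsRiemannianMap n f) (hC : C ∈ components {y | f y = y})
    (hne : ∃ y, f (f y) ≠ y) : S.Orientable := by
  subst hd
  let := S.chartedSpace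
  have := S.isManifold
  have hfix : ∀ x : C, f x = x := fun x => apply_eq_of_mem_component hC x.2
  refine nonempty_manifoldOrientation o hf S.isSmoothEmbedding.contMDiff hfix
    (fun x => S.inclDeriv_injective x) (fun x => ?_) fun x => ?_
  · ext w
    have h := SetLike.ext_iff.1 (S.range_inclDeriv hf hC x) w
    exact h.trans mem_fixedVectors
  · by_contra! h
    obtain ⟨y, hy⟩ := hne
    exact hy (hf.iterate_eq_id (hfix x) (k := 2) h y)

end Components

/-! ### Products of orthonormal vectors in the Clifford algebra -/

section Clifford

open Module CliffordAlgebra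

variable {n : ℕ}

theorem euclideanForm_apply (v : EuclideanSpace ℝ (Fin n)) : euclideanForm n v = inner ℝ v v := rfl

theorem ι_mul_self_of_norm_eq_one {v : EuclideanSpace ℝ (Fin n)} (hv : ‖v‖ = 1) :
    ι (euclideanForm n) v * ι (euclideanForm n) v = 1 := by
  rw [ι_sq_scalar, euclideanForm_apply, real_inner_self_eq_norm_sq, hv, one_pow, map_one]

theorem ι_mul_ι_of_inner_eq_zero {v w : EuclideanSpace ℝ (Fin n)} (h : inner ℝ v w = 0) :
    ι (euclideanForm n) v * ι (euclideanForm n) w =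
      -(ι (euclideanForm n) w * ι (euclideanForm n) v) := by
  refine ι_mul_ι_comm_of_isOrtho (QuadraticMap.isOrtho_def.2 ?_)
  simp only [euclideanForm_apply, inner_add_left, inner_add_right, h, real_inner_comm v w]
  ring

theorem ι_euclideanForm_injective : Function.Injective (ι (euclideanForm n)) := by
  rw [injective_iff_map_eq_zero]
  intro v hv
  have h := ι_sq_scalar (euclideanForm n) v
  rw [hv, mul_zero, eq_comm, map_eq_zero_iff _ (FaithfulSMul.algebraMap_injective ℝ _),
    euclideanForm_apply, inner_self_eq_zero] at h
  exact h

/-- The product of a list of vectors in the Clifford algebra. -/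
noncomputable def cliffordProd (l : List (EuclideanSpace ℝ (Fin n))) :
    CliffordAlgebra (euclideanForm n) :=
  (l.map (ι (euclideanForm n))).prod

theorem cliffordProd_cons (a : EuclideanSpace ℝ (Fin n)) (l : List (EuclideanSpace ℝ (Fin n))) :
    cliffordProd (a :: l) = ι (euclideanForm n) a * cliffordProd l := by
  rw [cliffordProd, List.map_cons, List.prod_cons, cliffordProd]

theorem cliffordProd_mul_ι_of_orthogonal {l : List (EuclideanSpace ℝ (Fin n))}
    {v : EuclideanSpace ℝ (Fin n)} (h : ∀ a ∈ l, inner ℝ a v = 0) :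
    cliffordProd l * ι (euclideanForm n) v =
      ((-1 : ℝ) ^ l.length) • (ι (euclideanForm n) v * cliffordProd l) := by
  induction l with
  | nil => simp [cliffordProd]
  | cons a l ih =>
    rw [cliffordProd_cons, mul_assoc, ih fun b hb => h b (List.mem_cons_of_mem a hb),
      mul_smul_comm, ← mul_assoc, ι_mul_ι_of_inner_eq_zero (h a List.mem_cons_self), neg_mul,
      smul_neg, List.length_cons, pow_succ, mul_neg, mul_one, neg_smul, mul_assoc]

/-- One factor is `v` itself and commutes with it, so there is one sign fewer than for a vector
orthogonal to all factors. -/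
theorem cliffordProd_mul_ι_of_mem {l : List (EuclideanSpace ℝ (Fin n))}
    (hp : l.Pairwise fun a b => inner ℝ a b = 0) (hn : ∀ a ∈ l, ‖a‖ = 1)
    {v : EuclideanSpace ℝ (Fin n)} (hv : v ∈ l) :
    cliffordProd l * ι (euclideanForm n) v =
      -(((-1 : ℝ) ^ l.length) • (ι (euclideanForm n) v * cliffordProd l)) := by
  induction l with
  | nil => simp at hv
  | cons a l ih =>
    obtain ⟨hp1, hp2⟩ := List.pairwise_cons.1 hp
    rw [cliffordProd_cons, List.length_cons, pow_succ, mul_neg, mul_one, neg_smul, neg_neg,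
      mul_assoc]
    rcases List.mem_cons.1 hv with rfl | hv
    · rw [cliffordProd_mul_ι_of_orthogonal fun b hb => (real_inner_comm _ _).trans (hp1 b hb),
        mul_smul_comm]
    · rw [ih hp2 (fun b hb => hn b (List.mem_cons_of_mem a hb)) hv, mul_neg, mul_smul_comm,
        ← mul_assoc, ι_mul_ι_of_inner_eq_zero (hp1 v hv), neg_mul, smul_neg, neg_neg, mul_assoc]

/-- Moving each vector past those after it costs one sign per vector passed, whence the exponent;
unit vectors square to `+1` for this form. -/
theorem cliffordProd_mul_self {l : List (EuclideanSpace ℝ (Fin n))}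
    (hp : l.Pairwise fun a b => inner ℝ a b = 0) (hn : ∀ a ∈ l, ‖a‖ = 1) :
    cliffordProd l * cliffordProd l =
      ((-1 : ℝ) ^ (∑ i ∈ Finset.range l.length, i)) • (1 : CliffordAlgebra (euclideanForm n)) := by
  induction l with
  | nil => simp [cliffordProd]
  | cons a l ih =>
    obtain ⟨hp1, hp2⟩ := List.pairwise_cons.1 hp
    rw [cliffordProd_cons, mul_assoc, ← mul_assoc (cliffordProd l),
      cliffordProd_mul_ι_of_orthogonal fun b hb => (real_inner_comm _ _).trans (hp1 b hb),
      smul_mul_assoc, mul_smul_comm, mul_assoc, ih hp2 fun b hb => hn b (List.mem_cons_of_mem a hb),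
      ← mul_assoc, ι_mul_self_of_norm_eq_one (hn a List.mem_cons_self), one_mul, smul_smul,
      ← pow_add, List.length_cons, Finset.sum_range_succ, add_comm]

/-- Here `star` negates vectors, so `star a * a = -1` for a unit vector `a`; the signs cancel for
even length, as needed in the spin group. -/
theorem star_mul_cliffordProd {l : List (EuclideanSpace ℝ (Fin n))} (hn : ∀ a ∈ l, ‖a‖ = 1) :
    star (cliffordProd l) * cliffordProd l =
      ((-1 : ℝ) ^ l.length) • (1 : CliffordAlgebra (euclideanForm n)) := by
  induction l with
  | nil => simp [cliffordProd]
  | cons a l ih =>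
    rw [cliffordProd_cons, star_mul, star_ι, mul_assoc, ← mul_assoc (-ι (euclideanForm n) a),
      neg_mul, ι_mul_self_of_norm_eq_one (hn a List.mem_cons_self), neg_mul, one_mul, mul_neg,
      ih fun b hb => hn b (List.mem_cons_of_mem a hb), List.length_cons, pow_succ, mul_neg, mul_one,
      neg_smul]

theorem cliffordProd_mul_star {l : List (EuclideanSpace ℝ (Fin n))} (hn : ∀ a ∈ l, ‖a‖ = 1) :
    cliffordProd l * star (cliffordProd l) =
      ((-1 : ℝ) ^ l.length) • (1 : CliffordAlgebra (euclideanForm n)) := by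
  induction l with
  | nil => simp [cliffordProd]
  | cons a l ih =>
    rw [cliffordProd_cons, star_mul, star_ι, mul_assoc, ← mul_assoc (cliffordProd l),
      ih fun b hb => hn b (List.mem_cons_of_mem a hb), smul_mul_assoc, mul_smul_comm, one_mul,
      mul_neg, ι_mul_self_of_norm_eq_one (hn a List.mem_cons_self), List.length_cons, pow_succ,
      mul_neg, mul_one, neg_smul, smul_neg]

theorem cliffordProd_mem_evenOdd (l : List (EuclideanSpace ℝ (Fin n))) :
    cliffordProd l ∈ evenOdd (euclideanForm n) (l.length : ZMod 2) := by
  induction l with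
  | nil =>
    rw [cliffordProd, List.map_nil, List.prod_nil, List.length_nil, Nat.cast_zero]
    exact SetLike.GradedOne.one_mem
  | cons a l ih =>
    rw [cliffordProd_cons, List.length_cons, Nat.cast_succ, add_comm]
    exact SetLike.mul_mem_graded (ι_mem_evenOdd_one _ a) ih

theorem cliffordProd_mem_spinGroup {l : List (EuclideanSpace ℝ (Fin n))} (hn : ∀ a ∈ l, ‖a‖ = 1)
    (hl : Even l.length) : cliffordProd l ∈ spinGroup (euclideanForm n) := by
  refine ⟨⟨?_, ?_, ?_⟩, ?_⟩
  · refine Submonoid.list_prod_mem _ fun x hx => ?_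
    obtain ⟨a, ha, rfl⟩ := List.mem_map.1 hx
    have h1 := ι_mul_self_of_norm_eq_one (hn a ha)
    exact ⟨⟨ι _ a, ι _ a, h1, h1⟩, Subgroup.subset_closure ⟨a, rfl⟩, rfl⟩
  · rw [star_mul_cliffordProd hn, hl.neg_one_pow, one_smul]
  · rw [cliffordProd_mul_star hn, hl.neg_one_pow, one_smul]
  · have h := cliffordProd_mem_evenOdd l
    rw [(ZMod.natCast_eq_zero_iff_even).2 hl] at h
    exact h

/-! ### The vector representation -/

theorem ι_spinRep (g : Spin n) (v : EuclideanSpace ℝ (Fin n)) :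
    ι (euclideanForm n) (spinRep g v) = (g : CliffordAlgebra (euclideanForm n)) *
      ι (euclideanForm n) v * ((g⁻¹ : Spin n) : CliffordAlgebra (euclideanForm n)) :=
  Classical.choose_spec (exists_spinRep g v)

theorem coe_mul_coe_inv (g : Spin n) : (g : CliffordAlgebra (euclideanForm n)) *
    ((g⁻¹ : Spin n) : CliffordAlgebra (euclideanForm n)) = 1 := by
  rw [← Submonoid.coe_mul, mul_inv_cancel, Submonoid.coe_one]

theorem spinRep_eq_of_mul_ι {g : Spin n} {v w : EuclideanSpace ℝ (Fin n)}
    (h : (g : CliffordAlgebra (euclideanForm n)) * ι (euclideanForm n) v =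
      ι (euclideanForm n) w * g) : spinRep g v = w := by
  apply ι_euclideanForm_injective
  rw [ι_spinRep, h, mul_assoc, coe_mul_coe_inv, mul_one]

theorem spinRep_mul (g h : Spin n) (v : EuclideanSpace ℝ (Fin n)) :
    spinRep (g * h) v = spinRep g (spinRep h v) := by
  apply ι_euclideanForm_injective
  rw [ι_spinRep, ι_spinRep, ι_spinRep, mul_inv_rev, Submonoid.coe_mul, Submonoid.coe_mul]
  simp only [mul_assoc]

theorem spinRep_one (v : EuclideanSpace ℝ (Fin n)) : spinRep (1 : Spin n) v = v :=
  spinRep_eq_of_mul_ι (by simp)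

theorem spinRep_pow (g : Spin n) (k : ℕ) (v : EuclideanSpace ℝ (Fin n)) :
    spinRep (g ^ k) v = (spinRep g)^[k] v := by
  induction k generalizing v with
  | zero => rw [pow_zero, spinRep_one, Function.iterate_zero, id]
  | succ k ih => rw [pow_succ, spinRep_mul, ih, Function.iterate_succ_apply]

/-- The product of two orthonormal vectors squares to `-1`, hence the bound on `n`. -/
theorem exists_spin_eq_neg_one (hn : 2 ≤ n) :
    ∃ z : Spin n, (z : CliffordAlgebra (euclideanForm n)) = -1 := by
  set a : EuclideanSpace ℝ (Fin n) := EuclideanSpace.basisFun (Fin n) ℝ ⟨0, by omega⟩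
  set b : EuclideanSpace ℝ (Fin n) := EuclideanSpace.basisFun (Fin n) ℝ ⟨1, by omega⟩
  have hp : [a, b].Pairwise fun a b => inner ℝ a b = 0 := by
    refine List.pairwise_pair.2 ?_
    exact (EuclideanSpace.basisFun (Fin n) ℝ).orthonormal.2 (by simp)
  have hnorm : ∀ c ∈ [a, b], ‖c‖ = 1 := by
    intro c hc
    rcases List.mem_pair.1 hc with rfl | rfl
    · exact (EuclideanSpace.basisFun (Fin n) ℝ).orthonormal.1 _
    · exact (EuclideanSpace.basisFun (Fin n) ℝ).orthonormal.1 _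
  refine ⟨⟨cliffordProd [a, b], cliffordProd_mem_spinGroup hnorm even_two⟩ ^ 2, ?_⟩
  rw [sq, Submonoid.coe_mul, cliffordProd_mul_self hp hnorm]
  simp [Finset.sum_range_succ]

/-- An involution whose `-1`-eigenspace has dimension `2 * k` is the image of an element of the spin
group with square `(-1) ^ k`. -/
theorem exists_spinRep_eq_involution (B : EuclideanSpace ℝ (Fin n) ≃ₗᵢ[ℝ] EuclideanSpace ℝ (Fin n))
    (hB : ∀ v, B (B v) = v) {k : ℕ} (hk : n = finrank ℝ (invariants B) + 2 * k) :
    ∃ g : Spin n, (∀ v, spinRep g v = B v) ∧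
      (g : CliffordAlgebra (euclideanForm n)) * g = ((-1 : ℝ) ^ k) • 1 := by
  set K := invariants B
  have hfin : finrank ℝ Kᗮ = 2 * k := by
    have := K.finrank_add_finrank_orthogonal
    rw [finrank_euclideanSpace_fin] at this
    omega
  -- The vector `w + B w` is both fixed by `B` and orthogonal to the fixed space.
  have hneg : ∀ w ∈ Kᗮ, B w = -w := by
    intro w hw
    have h1 : w + B w ∈ K := by
      change B (w + B w) = w + B w
      rw [map_add, hB, add_comm]
    have h2 : w + B w ∈ Kᗮ := by
      refine Kᗮ.add_mem hw ((Submodule.mem_orthogonal K _).2 fun x hx => ?_)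
      rw [← mem_invariants.1 hx, B.inner_map_map]
      exact (Submodule.mem_orthogonal K w).1 hw x hx
    exact eq_neg_of_add_eq_zero_right (Submodule.disjoint_def.1 K.orthogonal_disjoint _ h1 h2)
  let b := stdOrthonormalBasis ℝ Kᗮ
  set l : List (EuclideanSpace ℝ (Fin n)) :=
    List.ofFn fun i => ((b i : Kᗮ) : EuclideanSpace ℝ (Fin n))
  have hlen : l.length = 2 * k := (List.length_ofFn).trans hfin
  have heven : Even l.length := hlen ▸ even_two_mul k
  have hp : l.Pairwise fun a b => inner ℝ a b = 0 :=
    List.pairwise_ofFn.2 fun i j hij => b.orthonormal.2 hij.ne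
  have hnorm : ∀ a ∈ l, ‖a‖ = 1 := by
    intro a ha
    obtain ⟨i, rfl⟩ := (List.mem_ofFn' _ _).1 ha
    exact b.orthonormal.1 i
  have hmemW : ∀ a ∈ l, a ∈ Kᗮ := by
    intro a ha
    obtain ⟨i, rfl⟩ := (List.mem_ofFn' _ _).1 ha
    exact (b i).2
  -- The product of an orthonormal basis of the `-1`-eigenspace has even length, so it commutes with
  -- the vectors of `K` and anticommutes with those of `Kᗮ`: conjugation by it is `B`.
  set P := cliffordProd l
  let L₁ : EuclideanSpace ℝ (Fin n) →ₗ[ℝ] CliffordAlgebra (euclideanForm n) :=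
    LinearMap.mulLeft ℝ P ∘ₗ ι (euclideanForm n)
  let L₂ : EuclideanSpace ℝ (Fin n) →ₗ[ℝ] CliffordAlgebra (euclideanForm n) :=
    LinearMap.mulRight ℝ P ∘ₗ ι (euclideanForm n) ∘ₗ B.toLinearEquiv.toLinearMap
  have hK : ∀ v ∈ K, L₁ v = L₂ v := by
    intro v hv
    change P * ι (euclideanForm n) v = ι (euclideanForm n) (B v) * P
    rw [mem_invariants.1 hv, cliffordProd_mul_ι_of_orthogonal fun a ha =>
      (real_inner_comm _ _).trans ((Submodule.mem_orthogonal K a).1 (hmemW a ha) v hv),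
      heven.neg_one_pow, one_smul]
  have hW : L₁ ∘ₗ Kᗮ.subtype = L₂ ∘ₗ Kᗮ.subtype := by
    refine b.toBasis.ext fun i => ?_
    rw [b.coe_toBasis]
    change P * ι (euclideanForm n) (b i : EuclideanSpace ℝ (Fin n)) =
      ι (euclideanForm n) (B (b i : EuclideanSpace ℝ (Fin n))) * P
    rw [hneg _ (b i).2, cliffordProd_mul_ι_of_mem hp hnorm ((List.mem_ofFn' _ _).2 ⟨i, rfl⟩),
      heven.neg_one_pow, one_smul, map_neg, neg_mul]
  have hall : ∀ v, L₁ v = L₂ v := by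
    intro v
    have h1 := hK _ (K.starProjection_apply_mem v)
    have h2 := LinearMap.congr_fun hW ⟨_, K.sub_starProjection_mem_orthogonal v⟩
    have h3 : L₁ (v - K.starProjection v) = L₂ (v - K.starProjection v) := h2
    rw [map_sub, map_sub, h1] at h3
    exact sub_left_injective h3
  refine ⟨⟨P, cliffordProd_mem_spinGroup hnorm heven⟩, fun v => spinRep_eq_of_mul_ι (hall v), ?_⟩
  refine (cliffordProd_mul_self hp hnorm).trans (congrArg (· • _) ?_)
  -- The exponent becomes `k * (2 * k - 1)`, which has the parity of `k`.
  rw [hlen, Finset.sum_range_id, mul_assoc, Nat.mul_div_cancel_left _ two_pos]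
  rcases Nat.even_or_odd k with hk | hk
  · rw [hk.neg_one_pow, (hk.mul_right _).neg_one_pow]
  · rw [hk.neg_one_pow, (hk.mul _).neg_one_pow]
    obtain ⟨j, rfl⟩ := hk
    exact ⟨2 * j, by omega⟩

theorem one_ne_neg_one_clifford : (1 : CliffordAlgebra (euclideanForm n)) ≠ -1 := by
  intro h
  have h1 : algebraMap ℝ (CliffordAlgebra (euclideanForm n)) 1 = algebraMap ℝ _ (-1) := by
    rw [map_neg, map_one, ← h]
  have := FaithfulSMul.algebraMap_injective ℝ (CliffordAlgebra (euclideanForm n)) h1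
  norm_num at this

end Clifford

/-! ### Principal bundles -/

namespace IsPrincipalBundle

variable {G P B : Type*} [Group G] [TopologicalSpace G] [TopologicalSpace P] [TopologicalSpace B]
  [MulAction Gᵐᵒᵖ P] {proj : P → B}

theorem exists_proj_eq (h : IsPrincipalBundle G proj) (b : B) : ∃ p, proj p = b := by
  obtain ⟨U, -, hb, e, he, -⟩ := h.locally_trivial b
  refine ⟨e.symm (⟨b, hb⟩, 1), ?_⟩
  rw [← he, e.apply_symm_apply]

theorem smul_injective (h : IsPrincipalBundle G proj) (p : P) :
    Function.Injective fun g : G => MulOpposite.op g • p := by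
  intro a b hab
  obtain ⟨U, -, hb, e, -, he⟩ := h.locally_trivial (proj p)
  have hq : ∀ g : G, proj (MulOpposite.op g • p) ∈ U := fun g => by rwa [h.proj_smul]
  have h1 := he ⟨p, hb⟩ ⟨_, hq a⟩ a rfl
  have h2 := he ⟨p, hb⟩ ⟨_, hq a⟩ b hab
  exact mul_left_cancel (h1.symm.trans h2)

theorem exists_smul_eq (h : IsPrincipalBundle G proj) {p q : P} (hpq : proj q = proj p) :
    ∃ g : G, q = MulOpposite.op g • p := by
  obtain ⟨U, -, hb, e, he1, he2⟩ := h.locally_trivial (proj p)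
  have hbq : proj q ∈ U := by rwa [hpq]
  set g := (e ⟨p, hb⟩).2⁻¹ * (e ⟨q, hbq⟩).2
  have hg : proj (MulOpposite.op g • p) ∈ U := by rwa [h.proj_smul]
  refine ⟨g, ?_⟩
  have h1 : e ⟨q, hbq⟩ = e ⟨_, hg⟩ := by
    refine Prod.ext (Subtype.ext ?_) ?_
    · rw [he1, he1]
      exact hpq.trans (h.proj_smul p g).symm
    · rw [he2 ⟨p, hb⟩ ⟨_, hg⟩ g rfl, mul_inv_cancel_left]
  exact congrArg Subtype.val (e.injective h1)

/-- Over a connected base, an open and closed invariant subset is empty or everything. -/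
theorem eq_univ_of_isClopen [PreconnectedSpace B] (h : IsPrincipalBundle G proj) {Z : Set P}
    (hZ : IsClopen Z) (hinv : ∀ p ∈ Z, ∀ g : G, MulOpposite.op g • p ∈ Z) (hne : Z.Nonempty) :
    Z = univ := by
  have hmem : ∀ {p q : P}, proj q = proj p → p ∈ Z → q ∈ Z := by
    intro p q hpq hp
    obtain ⟨g, rfl⟩ := h.exists_smul_eq hpq
    exact hinv p hp g
  -- Invariance reduces membership in the image of `Z` to whether a local section lies in `Z`, which
  -- is locally constant as `Z` is clopen. Connectedness of the group plays no role.
  have hlc : IsLocallyConstant fun b => b ∈ proj '' Z := by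
    rw [IsLocallyConstant.iff_eventually_eq]
    intro b
    obtain ⟨U, hU, hb, e, he, -⟩ := h.locally_trivial b
    have hσ : Continuous fun y : U => (e.symm (y, 1) : P) :=
      continuous_subtype_val.comp (e.symm.continuous.comp (continuous_id.prodMk continuous_const))
    have hproj : ∀ y : U, proj (e.symm (y, 1)) = y := fun y => by rw [← he, e.apply_symm_apply]
    have hiff : ∀ y : U, (y : B) ∈ proj '' Z ↔ (e.symm (y, 1) : P) ∈ Z := fun y =>
      ⟨fun ⟨p, hp, hpy⟩ => hmem ((hproj y).trans hpy.symm) hp, fun hy => ⟨_, hy, hproj y⟩⟩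
    rw [← hU.isOpenEmbedding_subtypeVal.map_nhds_eq ⟨b, hb⟩, Filter.eventually_map]
    by_cases hbZ : (e.symm (⟨b, hb⟩, 1) : P) ∈ Z
    · filter_upwards [hσ.continuousAt.eventually_mem (hZ.isOpen.mem_nhds hbZ)] with y hy
      exact propext (iff_of_true ((hiff y).2 hy) ((hiff ⟨b, hb⟩).2 hbZ))
    · filter_upwards [hσ.continuousAt.eventually_mem (hZ.compl.isOpen.mem_nhds hbZ)] with y hy
      exact propext (iff_of_false (mt (hiff y).1 hy) (mt (hiff ⟨b, hb⟩).1 hbZ))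
  obtain ⟨p₀, hp₀⟩ := hne
  refine eq_univ_of_forall fun q => ?_
  have h1 : proj q ∈ proj '' Z := by
    rw [hlc.apply_eq_of_preconnectedSpace (proj q) (proj p₀)]
    exact mem_image_of_mem _ hp₀
  obtain ⟨p, hp, hpq⟩ := h1
  exact hmem hpq.symm hp

end IsPrincipalBundle

/-! ### Symmetries of spin structures at a fixed point -/

section Symmetry

open Module

variable {n : ℕ} {M : Type u} [TopologicalSpace M] [ChartedSpace (EuclideanSpace ℝ (Fin n)) M]
  [IsManifold (𝓡 n) ∞ M] [RiemannianBundle (fun x : M => TangentSpace (𝓡 n) x)]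
  {o : ManifoldOrientation n M}

theorem Frame.ext_vec {w w' : Frame o} (h : ∀ v, w.vec v = w'.vec v) : w = w' := by
  obtain ⟨x, ⟨b⟩, hb⟩ := w
  obtain ⟨x', ⟨b'⟩, hb'⟩ := w'
  obtain rfl : x = x' := congrArg TotalSpace.proj (h 0)
  have h2 : b = b' := by
    have h3 : b.symm = b'.symm := by
      ext1 v
      exact TotalSpace.mk_injective x (h v)
    rw [← b.symm_symm, h3, b'.symm_symm]
  subst h2
  rfl

theorem OrientedIsometry.frameMap_vec (φ : OrientedIsometry o) (w : Frame o)
    (v : EuclideanSpace ℝ (Fin n)) :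
    (φ.frameMap w).vec v = tangentMap (𝓡 n) (𝓡 n) φ.toHomeo (w.vec v) := rfl

theorem OrientedIsometry.frameMap_frameMap (φ : OrientedIsometry o)
    (h : ∀ y, φ.toHomeo (φ.toHomeo y) = y) (w : Frame o) : φ.frameMap (φ.frameMap w) = w := by
  refine Frame.ext_vec fun v => ?_
  have hd : ∀ y, MDifferentiableAt (𝓡 n) (𝓡 n) φ.toHomeo y := fun y =>
    φ.isRiemannianMap.contMDiff.mdifferentiableAt (by simp)
  have hid : φ.toHomeo ∘ φ.toHomeo = _root_.id := funext h
  rw [φ.frameMap_vec, φ.frameMap_vec, ← tangentMap_comp_at _ (hd _) (hd _), hid, tangentMap_id]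
  rfl

namespace SpinStructure

variable {s : SpinStructure.{u, v} o}

/-- The covering replaces a computation of the kernel: elements acting alike move `p` to the same
fibre of a two-sheeted map, and `h` and `-h` already account for both of its points. -/
theorem eq_or_eq_neg_of_spinRep_eq (hn : 2 ≤ n) (s : SpinStructure.{u, v} o) (p : s.P)
    {g h : Spin n} (hgh : ∀ v, spinRep g v = spinRep h v) :
    (g : CliffordAlgebra (euclideanForm n)) = h ∨ (g : CliffordAlgebra (euclideanForm n)) = -h := by
  obtain ⟨z, hz⟩ := exists_spin_eq_neg_one hn
  have hfr : ∀ a b : Spin n, (∀ v, spinRep a v = spinRep b v) →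
      s.toFrame (MulOpposite.op a • p) = s.toFrame (MulOpposite.op b • p) := fun a b hab =>
    Frame.ext_vec fun v => by rw [s.equivariant, s.equivariant, hab]
  have hzv : ∀ v, spinRep z v = v := fun v =>
    spinRep_eq_of_mul_ι (by rw [hz, neg_one_mul, mul_neg_one])
  have hz1 : h * z ≠ h := by
    intro h1
    have h2 := congrArg (Subtype.val : Spin n → _) (mul_eq_left.1 h1)
    rw [hz, Submonoid.coe_one] at h2
    exact one_ne_neg_one_clifford h2.symm
  have hinj := s.isPrincipalBundle.smul_injective p
  obtain ⟨q₁, q₂, -, hq⟩ := Set.ncard_eq_two.1 (s.two_sheeted (s.toFrame (MulOpposite.op h • p)))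
  have m1 : MulOpposite.op h • p ∈ ({q₁, q₂} : Set s.P) := hq ▸ rfl
  have m2 : MulOpposite.op (h * z) • p ∈ ({q₁, q₂} : Set s.P) :=
    hq ▸ hfr _ _ fun v => by rw [spinRep_mul, hzv]
  have m3 : MulOpposite.op g • p ∈ ({q₁, q₂} : Set s.P) := hq ▸ hfr _ _ hgh
  have hne : MulOpposite.op (h * z) • p ≠ MulOpposite.op h • p := fun h => hz1 (hinj h)
  have hor : MulOpposite.op g • p = MulOpposite.op h • p ∨
      MulOpposite.op g • p = MulOpposite.op (h * z) • p := by
    rcases m1 with m1 | m1 <;> rcases m2 with m2 | m2 <;> rcases m3 with m3 | m3 <;>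
      simp_all
  rcases hor with h1 | h1
  · exact Or.inl (congrArg _ (hinj h1))
  · refine Or.inr ?_
    rw [hinj h1, Submonoid.coe_mul, hz, mul_neg_one]

variable {φ : OrientedIsometry o} {Φ : s.P ≃ₜ s.P}

/-- As `Φ` commutes with the right action, each application inserts one more `g` next to `p`. -/
theorem IsLift.iterate_apply (hΦ : s.IsLift φ Φ) {p : s.P} {g : Spin n}
    (hg : Φ p = MulOpposite.op g • p) (k : ℕ) : Φ^[k] p = MulOpposite.op (g ^ k) • p := by
  induction k with
  | zero => rw [pow_zero, MulOpposite.op_one, one_smul, Function.iterate_zero, id]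
  | succ k ih =>
    rw [Function.iterate_succ_apply', ih, hΦ.map_smul, hg, smul_smul, ← MulOpposite.op_mul,
      ← pow_succ']

theorem IsLift.exists_apply_eq (hΦ : s.IsLift φ Φ) {p : s.P}
    (hp : φ.toHomeo (s.toFrame p).pt = (s.toFrame p).pt) :
    ∃ g : Spin n, Φ p = MulOpposite.op g • p :=
  s.isPrincipalBundle.exists_smul_eq (by
    rw [hΦ.covers p]
    exact hp)

/-- An isometry of the tangent space, read in a frame. -/
noncomputable def frameConj (w : Frame o)
    (A : TangentSpace (𝓡 n) w.pt ≃ₗᵢ[ℝ] TangentSpace (𝓡 n) w.pt) :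
    EuclideanSpace ℝ (Fin n) ≃ₗᵢ[ℝ] EuclideanSpace ℝ (Fin n) :=
  w.basis.repr.symm.trans (A.trans w.basis.repr)

theorem frameConj_apply (w : Frame o)
    (A : TangentSpace (𝓡 n) w.pt ≃ₗᵢ[ℝ] TangentSpace (𝓡 n) w.pt) (v : EuclideanSpace ℝ (Fin n)) :
    frameConj w A v = w.basis.repr (A (w.basis.repr.symm v)) := rfl

theorem finrank_invariants_frameConj (w : Frame o)
    (A : TangentSpace (𝓡 n) w.pt ≃ₗᵢ[ℝ] TangentSpace (𝓡 n) w.pt) :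
    finrank ℝ (invariants (frameConj w A)) = finrank ℝ (invariants A) := by
  have h : invariants (frameConj w A) =
      (invariants A).map w.basis.repr.toLinearEquiv.toLinearMap := by
    ext v
    rw [mem_invariants, frameConj_apply]
    constructor
    · intro hv
      refine ⟨w.basis.repr.symm v, ?_, w.basis.repr.apply_symm_apply v⟩
      change A (w.basis.repr.symm v) = w.basis.repr.symm v
      conv_rhs => rw [← hv, w.basis.repr.symm_apply_apply]
    · rintro ⟨z, hz, rfl⟩
      change w.basis.repr (A (w.basis.repr.symm (w.basis.repr z))) = w.basis.repr z
      rw [w.basis.repr.symm_apply_apply, mem_invariants.1 hz]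
  rw [h]
  exact LinearEquiv.finrank_map_eq w.basis.repr.toLinearEquiv (invariants A)

/-- The frame under `Φ p` is described twice: as the translate by `g` and as the image under the
differential of `φ`. -/
theorem IsLift.spinRep_apply (hΦ : s.IsLift φ Φ) {p : s.P}
    (hp : φ.toHomeo (s.toFrame p).pt = (s.toFrame p).pt) {g : Spin n}
    (hg : Φ p = MulOpposite.op g • p) (v : EuclideanSpace ℝ (Fin n)) :
    spinRep g v = frameConj (s.toFrame p) (φ.isRiemannianMap.isometryAt hp) v := by
  rw [frameConj_apply, ← LinearIsometryEquiv.symm_apply_eq]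
  have h1 : (s.toFrame (Φ p)).vec v = (s.toFrame p).vec (spinRep g v) := by
    rw [hg, s.equivariant]
  rw [hΦ.covers, φ.frameMap_vec] at h1
  let F : TangentBundle (𝓡 n) M → EuclideanSpace ℝ (Fin n) := fun q => q.2
  exact (congrArg F h1).symm

theorem IsLift.spinRep_pow_apply (hΦ : s.IsLift φ Φ) {p : s.P}
    (hp : φ.toHomeo (s.toFrame p).pt = (s.toFrame p).pt) {g : Spin n}
    (hg : Φ p = MulOpposite.op g • p) (k : ℕ) (v : EuclideanSpace ℝ (Fin n)) :
    spinRep (g ^ k) v = frameConj (s.toFrame p)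
      ((φ.isRiemannianMap.iterate k).isometryAt (Function.iterate_fixed hp k)) v := by
  have h1 : spinRep g = frameConj (s.toFrame p) (φ.isRiemannianMap.isometryAt hp) :=
    funext (hΦ.spinRep_apply hp hg)
  have hsemi : Function.Semiconj (s.toFrame p).basis.repr.symm (spinRep g)
      (φ.isRiemannianMap.isometryAt hp) := fun v => by
    rw [h1, frameConj_apply, LinearIsometryEquiv.symm_apply_apply]
  rw [spinRep_pow, frameConj_apply, ← LinearIsometryEquiv.symm_apply_eq, (hsemi.iterate_right k) v]
  exact (φ.isRiemannianMap.tangentOp_iterate hp k _).symm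

/-- If the `k`-th power of the differential at a fixed point is an involution with `-1`-eigenspace
of dimension `2 * j`, then the `2 * k`-th power of a lift acts on the fibre as `(-1) ^ j`. -/
theorem IsLift.pow_two_mul_eq (hn : 2 ≤ n) (hΦ : s.IsLift φ Φ) {p : s.P}
    (hp : φ.toHomeo (s.toFrame p).pt = (s.toFrame p).pt) {g : Spin n}
    (hg : Φ p = MulOpposite.op g • p) {k j : ℕ} (h2k : ∀ y, φ.toHomeo^[2 * k] y = y)
    (hj : n = finrank ℝ (fixedVectors (n := n) φ.toHomeo^[k] (s.toFrame p).pt) + 2 * j) :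
    ((g ^ (2 * k) : Spin n) : CliffordAlgebra (euclideanForm n)) = ((-1 : ℝ) ^ j) • 1 := by
  have hf := φ.isRiemannianMap.iterate k
  have hpk : φ.toHomeo^[k] (s.toFrame p).pt = (s.toFrame p).pt := Function.iterate_fixed hp k
  set B := frameConj (s.toFrame p) (hf.isometryAt hpk) with hB
  have hB2 : ∀ v, B (B v) = v := by
    intro v
    rw [hB, ← hΦ.spinRep_pow_apply hp hg k, ← hΦ.spinRep_pow_apply hp hg k, ← spinRep_mul,
      ← pow_add, ← two_mul, hΦ.spinRep_pow_apply hp hg, frameConj_apply]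
    have h1 : ∀ u : EuclideanSpace ℝ (Fin n),
        tangentOp (n := n) φ.toHomeo^[2 * k] (s.toFrame p).pt u = u := by
      have hid : φ.toHomeo^[2 * k] = _root_.id := funext h2k
      intro u
      rw [hid, tangentOp, mfderiv_id]
      rfl
    rw [← LinearIsometryEquiv.eq_symm_apply]
    exact h1 _
  -- The elements `g ^ k` and `h` both represent the involution `B`, so they agree up to a sign,
  -- which squaring removes.
  obtain ⟨h, hh, hsq⟩ := exists_spinRep_eq_involution B hB2 (k := j) (by
    rw [hB, finrank_invariants_frameConj, hf.finrank_invariants]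
    exact hj)
  have hpm := s.eq_or_eq_neg_of_spinRep_eq hn p (g := g ^ k) (h := h) fun v => by
    rw [hh, hΦ.spinRep_pow_apply hp hg k]
  rw [two_mul, pow_add, Submonoid.coe_mul, ← hsq]
  rcases hpm with h1 | h1
  · rw [h1]
  · rw [h1, neg_mul_neg]

/-- If a lift has order dividing `2 * k`, then the `-1`-eigenspace of the `k`-th power of the
differential has dimension divisible by four. -/
theorem IsLift.even_of_iterate_eq (hn : 2 ≤ n) (hΦ : s.IsLift φ Φ) {x : M}
    (hx : φ.toHomeo x = x) {k j : ℕ} (h2k : ∀ y, φ.toHomeo^[2 * k] y = y)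
    (hj : n = finrank ℝ (fixedVectors (n := n) φ.toHomeo^[k] x) + 2 * j)
    (hΦk : ∀ p, Φ^[2 * k] p = p) : Even j := by
  obtain ⟨p, rfl⟩ := s.isPrincipalBundle.exists_proj_eq x
  obtain ⟨g, hg⟩ := hΦ.exists_apply_eq hx
  have h1 := hΦ.pow_two_mul_eq hn hx hg h2k hj
  have h2 : g ^ (2 * k) = 1 := by
    apply s.isPrincipalBundle.smul_injective p
    beta_reduce
    rw [← hΦ.iterate_apply hg, hΦk, MulOpposite.op_one, one_smul]
  rw [h2, Submonoid.coe_one] at h1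
  by_contra hodd
  rw [(Nat.not_even_iff_odd.1 hodd).neg_one_pow, neg_one_smul] at h1
  exact one_ne_neg_one_clifford h1

/-- A lift of an involution is an involution if the `-1`-eigenspace of the differential at some
fixed point has dimension divisible by four. -/
theorem IsLift.apply_apply_eq_of_even [PreconnectedSpace M] (hn : 2 ≤ n) (hΦ : s.IsLift φ Φ) {x : M}
    (hx : φ.toHomeo x = x) {j : ℕ} (h2 : ∀ y, φ.toHomeo (φ.toHomeo y) = y)
    (hj : n = finrank ℝ (fixedVectors (n := n) φ.toHomeo x) + 2 * j) (heven : Even j)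
    (q : s.P) : Φ (Φ q) = q := by
  obtain ⟨p, rfl⟩ := s.isPrincipalBundle.exists_proj_eq x
  obtain ⟨g, hg⟩ := hΦ.exists_apply_eq hx
  have h1 := hΦ.pow_two_mul_eq hn hx hg (k := 1) h2 hj
  rw [heven.neg_one_pow, one_smul, mul_one] at h1
  have hg2 : g ^ 2 = 1 := Subtype.ext h1
  -- Both `Φ ∘ Φ` and the identity lift the same map through the covering, so they agree on a clopen
  -- set. It is invariant under the group and contains `p`, hence is everything.
  have hcov : s.toFrame ∘ (Φ ∘ Φ) = s.toFrame ∘ id := funext fun q => by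
    simp only [Function.comp, hΦ.covers, φ.frameMap_frameMap h2, id]
  have hZ : IsClopen {q | (Φ ∘ Φ) q = id q} :=
    ⟨s.isCoveringMap.isSeparatedMap.isClosed_eqLocus (Φ.continuous.comp Φ.continuous) continuous_id
      hcov, s.isCoveringMap.isLocalHomeomorph.isLocallyInjective.isOpen_eqLocus
      (Φ.continuous.comp Φ.continuous) continuous_id hcov⟩
  have huniv := s.isPrincipalBundle.eq_univ_of_isClopen hZ
    (fun q hq g => by
      change Φ (Φ (MulOpposite.op g • q)) = MulOpposite.op g • q
      have hq' : Φ (Φ q) = q := hq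
      rw [hΦ.map_smul, hΦ.map_smul, hq'])
    ⟨p, by
      have h3 := hΦ.iterate_apply hg 2
      rw [hg2, MulOpposite.op_one, one_smul] at h3
      exact h3⟩
  exact huniv.ge (mem_univ q)

end SpinStructure

theorem homeomorph_pow_apply {X : Type*} [TopologicalSpace X] (f : X ≃ₜ X) (k : ℕ) (x : X) :
    (f ^ k) x = f^[k] x := by
  induction k generalizing x with
  | zero => rfl
  | succ k ih => rw [pow_succ, Homeomorph.mul_apply, ih, Function.iterate_succ_apply]

end Symmetry

end FixedSet

/-! ### The main theorem -/

theorem theorem6p2 {m : ℕ} {M : Type u} [TopologicalSpace M] [T2Space M] [CompactSpace M]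
    [ConnectedSpace M] [ChartedSpace (EuclideanSpace ℝ (Fin (2 * m))) M]
    [IsManifold (𝓡 (2 * m)) ∞ M]
    [RiemannianBundle (fun x : M => TangentSpace (𝓡 (2 * m)) x)]
    [IsContMDiffRiemannianBundle (𝓡 (2 * m)) ∞ (EuclideanSpace ℝ (Fin (2 * m)))
      (fun x : M => TangentSpace (𝓡 (2 * m)) x)]
    (o : ManifoldOrientation (2 * m) M) (φ : OrientedIsometry o)
    (hfix : φ.fixedSet.Nonempty) :
    ((components φ.fixedSet).Finite ∧
      ∀ C ∈ components φ.fixedSet, IsCompact C ∧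
        ∃ d : ℕ, Even d ∧ ∃ S : EmbeddedSubmanifold (n := 2 * m) d C, S.TotallyGeodesic) ∧
    (orderOf φ.toHomeo = 2 → OrientedIsometry.LiftsWithOrder.{u, v} φ 4 →
      (∀ C ∈ components φ.fixedSet, ∀ (d : ℕ) (_ : EmbeddedSubmanifold (n := 2 * m) d C),
        ((2 * m : ℕ) : ℤ) - (d : ℤ) ≡ 2 [ZMOD 4]) ∧
      (Even m → ∀ x ∈ φ.fixedSet, AccPt x (𝓟 φ.fixedSet))) ∧
    (orderOf φ.toHomeo = 2 → OrientedIsometry.LiftsWithOrder.{u, v} φ 2 →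
      (∀ C ∈ components φ.fixedSet, ∀ (d : ℕ) (_ : EmbeddedSubmanifold (n := 2 * m) d C),
        ((2 * m : ℕ) : ℤ) - (d : ℤ) ≡ 0 [ZMOD 4]) ∧
      (Odd m → ∀ x ∈ φ.fixedSet, AccPt x (𝓟 φ.fixedSet))) ∧
    (orderOf φ.toHomeo ≠ 0 → Even (orderOf φ.toHomeo) →
      OrientedIsometry.LiftsWithOrder.{u, v} φ (orderOf φ.toHomeo) → m = 2 →
      ∀ x ∈ φ.fixedSet, ¬ AccPt x (𝓟 φ.fixedSet)) ∧
    (orderOf φ.toHomeo = 0 ∨ 2 < orderOf φ.toHomeo →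
      ∀ C ∈ components φ.fixedSet, ∀ (d : ℕ) (S : EmbeddedSubmanifold (n := 2 * m) d C),
        d + 2 = 2 * m → S.Orientable) := by
  have hf := φ.isRiemannianMap
  -- Whatever the submanifold structure, half the codimension is the `j` that governs the lifts.
  have hcodim : ∀ C ∈ components φ.fixedSet, ∀ (d : ℕ) (_ : EmbeddedSubmanifold (n := 2 * m) d C),
      ∃ x j, φ.toHomeo x = x ∧
        2 * m = Module.finrank ℝ (fixedVectors (n := 2 * m) φ.toHomeo x) + 2 * j ∧
        2 * m = d + 2 * j := by
    intro C hC d S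
    obtain ⟨x, hx, rfl⟩ := id hC
    have hxC := mem_connectedComponentIn hx
    obtain ⟨j, hj⟩ := φ.even_codim hx
    have hd := S.finrank_fixedVectors hf hC ⟨x, hxC⟩
    exact ⟨x, j, hx, hj, by rw [← hd]; exact hj⟩
  have hacc : ∀ x ∈ φ.fixedSet, ¬ AccPt x (𝓟 φ.fixedSet) ↔
      Module.finrank ℝ (fixedVectors (n := 2 * m) φ.toHomeo x) = 0 := fun x hx => by
    rw [Submodule.finrank_eq_zero]
    exact (not_congr (hf.accPt_iff hx)).trans not_not
  have hpow : ∀ y, φ.toHomeo^[orderOf φ.toHomeo] y = y := fun y => by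
    rw [← homeomorph_pow_apply, pow_orderOf_eq_one]
    rfl
  -- The spin group contains `-1` only from dimension two on. In dimension zero the tangent space is
  -- trivial, and rigidity makes `φ` the identity, of order one.
  have hdim : orderOf φ.toHomeo ≠ 1 → 2 ≤ 2 * m := by
    intro hne
    obtain ⟨x, hx⟩ := hfix
    by_contra hlt
    obtain rfl : m = 0 := by omega
    refine hne (orderOf_eq_one_iff.2 (Homeomorph.ext fun y => ?_))
    exact hf.eq_id hx (fun u => Subsingleton.elim (α := EuclideanSpace ℝ (Fin 0)) _ _) y
  refine ⟨⟨hf.finite_components, fun C hC => ⟨hf.isCompact_component hC, ?_⟩⟩, ?_, ?_, ?_, ?_⟩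
  · obtain ⟨x, hx, rfl⟩ := id hC
    obtain ⟨S⟩ := hf.nonempty_embeddedSubmanifold hC (mem_connectedComponentIn hx)
    obtain ⟨j, hj⟩ := φ.even_codim hx
    exact ⟨_, (Nat.even_add.1 (hj ▸ even_two_mul m)).2 (even_two_mul j), S,
      S.totallyGeodesic hf hC⟩
  · rintro hord ⟨s, Φ, hΦ, hΦord⟩
    have h2 : ∀ y, φ.toHomeo (φ.toHomeo y) = y := fun y => by
      have := hpow y
      rwa [hord] at this
    -- For even `j` the lift would be an involution, so its order would divide two.
    have hodd : ∀ x j, φ.toHomeo x = x →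
        2 * m = Module.finrank ℝ (fixedVectors (n := 2 * m) φ.toHomeo x) + 2 * j → Odd j := by
      intro x j hx hj
      by_contra heven
      have hΦ2 : Φ ^ 2 = 1 := Homeomorph.ext fun q => (homeomorph_pow_apply Φ 2 q).trans
        (hΦ.apply_apply_eq_of_even (hdim (by omega)) hx h2 hj (Nat.not_odd_iff_even.1 heven) q)
      have := orderOf_dvd_of_pow_eq_one hΦ2
      rw [hΦord] at this
      omega
    refine ⟨fun C hC d S => ?_, fun hm x hx => ?_⟩
    · obtain ⟨x, j, hx, hj, hd⟩ := hcodim C hC d S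
      obtain ⟨i, rfl⟩ := hodd x j hx hj
      exact (Int.modEq_iff_dvd.2 ⟨-i, by push_cast; omega⟩)
    · by_contra hnot
      have h0 := (hacc x hx).1 hnot
      -- At an isolated fixed point there are no nonzero fixed vectors, so `j` is `m`.
      have := hodd x m hx (by rw [h0, zero_add])
      exact Nat.not_odd_iff_even.2 hm this
  · rintro hord ⟨s, Φ, hΦ, hΦord⟩
    have heven : ∀ x j, φ.toHomeo x = x →
        2 * m = Module.finrank ℝ (fixedVectors (n := 2 * m) φ.toHomeo x) + 2 * j → Even j := by
      intro x j hx hj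
      refine hΦ.even_of_iterate_eq (hdim (by omega)) hx (k := 1) (fun y => ?_) hj fun p => ?_
      · have := hpow y
        rwa [hord] at this
      · have := DFunLike.congr_fun (pow_orderOf_eq_one Φ) p
        rwa [homeomorph_pow_apply, hΦord] at this
    refine ⟨fun C hC d S => ?_, fun hm x hx => ?_⟩
    · obtain ⟨x, j, hx, hj, hd⟩ := hcodim C hC d S
      obtain ⟨i, rfl⟩ := heven x j hx hj
      exact (Int.modEq_iff_dvd.2 ⟨-i, by push_cast; omega⟩)
    · by_contra hnot
      have h0 := (hacc x hx).1 hnot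
      have := heven x m hx (by rw [h0, zero_add])
      exact Nat.not_even_iff_odd.2 hm this
  · rintro hord ⟨k, hk⟩ ⟨s, Φ, hΦ, hΦord⟩ rfl x hx
    by_contra hnot
    rw [← two_mul] at hk
    have hxk : φ.toHomeo^[k] x = x := Function.iterate_fixed hx k
    -- The involution `φ ^ k` is the one to study. Its differential fixes whatever that of `φ`
    -- fixes, in particular a line, as `x` is not isolated.
    have hle : fixedVectors (n := 2 * 2) φ.toHomeo x ≤ fixedVectors (n := 2 * 2) φ.toHomeo^[k] x := by
      intro w hw
      rw [mem_fixedVectors] at hw ⊢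
      rw [hf.tangentOp_iterate hx]
      exact Function.iterate_fixed hw k
    have hpos := (Nat.pos_of_ne_zero fun h => (hacc x hx).2 h hnot).trans_le
      (Submodule.finrank_mono hle)
    obtain ⟨j, hj⟩ := φ.even_codim_iterate hx k
    -- If `j = 0`, the differential of `φ ^ k` is the identity, so rigidity gives `φ ^ k = 1`
    -- although `0 < k < 2 * k`.
    have hj0 : j ≠ 0 := by
      rintro rfl
      have htop : fixedVectors (n := 2 * 2) φ.toHomeo^[k] x = ⊤ :=
        Submodule.eq_top_of_finrank_eq (by rw [finrank_euclideanSpace_fin]; omega)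
      refine pow_ne_one_of_lt_orderOf (x := φ.toHomeo) (n := k) (by omega) (by omega)
        (Homeomorph.ext fun y => ?_)
      rw [homeomorph_pow_apply]
      exact (hf.iterate k).eq_id hxk (fun w => mem_fixedVectors.1 (htop ▸ Submodule.mem_top)) y
    -- In dimension four a fixed space of positive dimension leaves only `j = 1`, while a lift of
    -- order `2 * k` needs `j` even.
    obtain rfl : j = 1 := by omega
    refine Nat.not_even_one (hΦ.even_of_iterate_eq (by norm_num) hx (k := k) (fun y => ?_) hj
      fun p => ?_)
    · have := hpow y
      rwa [hk] at this
    · have := DFunLike.congr_fun (pow_orderOf_eq_one Φ) p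
      rwa [homeomorph_pow_apply, hΦord, hk] at this
  · intro hord C hC d S hd
    refine S.orientable_of_codim_two hd o hf hC ?_
    by_contra! h
    have h2 : φ.toHomeo ^ 2 = 1 := Homeomorph.ext fun y => (homeomorph_pow_apply _ 2 y).trans (h y)
    have h3 := Nat.le_of_dvd two_pos (orderOf_dvd_of_pow_eq_one h2)
    have h4 := (orderOf_dvd_of_pow_eq_one h2)
    rcases hord with h0 | h0
    · rw [h0] at h4
      omega
    · omega
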